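/- Let $d\in\{1,2,3\}$, let $\Omega\subset\mathbb R^d$ be a bounded open set (for instance a bounded Lipschitz domain), $T>0$, $Q=\Omega\times(0,T)$, $\Sigma=\partial\Omega\times(0,T)$, $\omega=2\pi/T$, $\lambda>0$, $y_d\in L^2(Q)$, and let $\sigma,\nu:\Omega\to\mathbb R$ be measurable with $0<\underline\sigma\le\sigma\le\overline\sigma$ and $0<\underline\nu\le\nu\le\overline\nu$. Write $\|\cdot\|$ for the $L^2(Q)$-norm, $\underline{\mu_1}=\frac1{\sqrt2}\min\{\underline\nu,\underline\sigma\}$, and $\boldsymbol u_k=(u_k^c,u_k^s)$ with $u_k^c(x)=\frac2T\int_0^Tu(x,t)\cos(k\omega t)\,dt$, $u_k^s(x)=\frac2T\int_0^Tu(x,t)\sin(k\omega t)\,dt$ and $\boldsymbol u_k^\perp=(-u_k^s,u_k^c)$. Spaces. $H^{1,0}_0(Q)$ consists of the $u\in L^2(Q)$ with $\nabla u\in L^2(Q)^d$ and $u=0$ on $\Sigma$ (closure, in the norm of $u$ and $\nabla u$, of the smooth functions that vanish near $\Sigma$). $H^{1,1}_{0,per}(Q)$ consists of the $u\in H^{1,0}_0(Q)$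 with $\partial_tu\in L^2(Q)$ and $u(0)=u(T)$. $H^{1,1/2}_{0,per}(Q)$ consists of the $u\in H^{1,0}_0(Q)$ with $\frac T2\sum_{k\ge1}k\omega\|\boldsymbol u_k\|_{L^2(\Omega)}^2<\infty$. $H(\mathrm{div},Q)$ consists of the $\boldsymbol\tau\in L^2(Q)^d$ whose weak spatial divergence $\nabla\cdot\boldsymbol\tau$ is in $L^2(Q)$. Put $\langle\sigma\partial_t^{1/2}u,\partial_t^{1/2}q^\perp\rangle=\frac T2\sum_{k\ge1}k\omega\int_\Omega\sigma\,\boldsymbol u_k\cdot\boldsymbol q_k^\perp\,dx$. Control problem. For $v\in L^2(Q)$ the state $y(v)\in H^{1,1/2}_{0,per}(Q)$ is the weak solution of $\sigma\partial_ty-\nabla\cdot(\nu\nabla y)=v$ with $y=0$ on $\Sigma$, $y(0)=y(T)$, that is, $\int_Q\nu\nabla y\cdot\nabla q+\langle\sigma\partial_t^{1/2}y,\partial_t^{1/2}q^\perp\rangle=\int_Qvq$ for all $q\in H^{1,1/2}_{0,per}(Q)$. The optimal control $u$ minimizes $\mathcal J(y(v),v)=\frac12\|y(v)-y_d\|^2+\frac\lambda2\|v\|^2$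 over $v\in L^2(Q)$. Its adjoint state $p(u)\in H^{1,1/2}_{0,per}(Q)$ solves $$\int_Q(y(u)q-\nu\nabla p\cdot\nabla q)+\langle\sigma\partial_t^{1/2}p,\partial_t^{1/2}q^\perp\rangle=\int_Qy_dq\qquad\forall q\in H^{1,1/2}_{0,per}(Q).$$ The error is $|||u-v|||^2=\frac12\|y(u)-y(v)\|^2+\frac\lambda2\|u-v\|^2$. Functionals. Let $C_F>0$ be a Friedrichs constant of $\Omega$, i.e. $\|w\|_{L^2(\Omega)}\le C_F\|\nabla w\|_{L^2(\Omega)}$ for all $w\in C_c^\infty(\Omega)$. For $\eta,\zeta\in H^{1,1}_{0,per}(Q)$, $\boldsymbol\tau,\boldsymbol\rho\in H(\mathrm{div},Q)$, $v\in L^2(Q)$ and $\alpha,\beta>0$ let $\mathcal R_1(\eta,\boldsymbol\tau,v)=\sigma\partial_t\eta-\nabla\cdot\boldsymbol\tau-v$, $\mathcal R_2(\eta,\boldsymbol\tau)=\boldsymbol\tau-\nu\nabla\eta$, $\mathcal R_3(\zeta,\boldsymbol\rho,\eta)=\eta-y_d+\nabla\cdot\boldsymbol\rho+\sigma\partial_t\zeta$,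 $\mathcal R_4(\zeta,\boldsymbol\rho)=\boldsymbol\rho-\nu\nabla\zeta$, $\gamma=\frac{(1+\alpha)(1+\beta)C_F^2}{2\alpha\underline{\mu_1}^2}$, and abbreviate $I=\int_Q(\nu\nabla\eta\cdot\nabla\zeta+\sigma\partial_t\eta\,\zeta+\lambda^{-1}\zeta^2)$, $A=C_F\|\mathcal R_3(\zeta,\boldsymbol\rho,\eta)\|+\|\mathcal R_4(\zeta,\boldsymbol\rho)\|$, $B=C_F\|\mathcal R_1(\eta,\boldsymbol\tau,-\lambda^{-1}\zeta)\|+\|\mathcal R_2(\eta,\boldsymbol\tau)\|$. Define $$\mathcal J^\oplus(\alpha,\beta;\eta,\boldsymbol\tau,v)=\tfrac{1+\alpha}2\|\eta-y_d\|^2+\gamma\Big(\|\mathcal R_2(\eta,\boldsymbol\tau)\|^2+\tfrac{C_F^2}\beta\|\mathcal R_1(\eta,\boldsymbol\tau,v)\|^2\Big)+\tfrac\lambda2\|v\|^2,$$ $$\mathcal J^\ominus(\eta,\zeta,\boldsymbol\tau,\boldsymbol\rho)=\tfrac12\|\eta-y_d\|^2+\tfrac1{2\lambda}\|\zeta\|^2-I-\tfrac{C_F^2}{\underline{\mu_1}^2\lambda}A^2-\tfrac1{\underline{\mu_1}}BA,$$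 $$\mathcal M^\oplus(\alpha,\beta;\eta,\zeta,\boldsymbol\tau,\boldsymbol\rho,v)=\tfrac\alpha2\|\eta-y_d\|^2+\gamma\Big(\|\mathcal R_2(\eta,\boldsymbol\tau)\|^2+\tfrac{C_F^2}\beta\|\mathcal R_1(\eta,\boldsymbol\tau,v)\|^2\Big)+\tfrac\lambda2\|v\|^2-\tfrac1{2\lambda}\|\zeta\|^2+I+\tfrac{C_F^2}{\underline{\mu_1}^2\lambda}A^2+\tfrac1{\underline{\mu_1}}BA.$$ Theorem. The state $y(v)$ of every $v\in L^2(Q)$, the optimal control $u$ and its adjoint state $p(u)$ exist and are unique, and a Friedrichs constant exists. For $u\in L^2(Q)$ and $y,p\in H^{1,1/2}_{0,per}(Q)$, $u$ is the optimal control with state $y$ and adjoint state $p$ if and only if $u=-\lambda^{-1}p$ and $(y,p)$ solves the optimality system, which consists of the adjoint equation above and of $\int_Q(\nu\nabla y\cdot\nabla q+\lambda^{-1}pq)+\langle\sigma\partial_t^{1/2}y,\partial_t^{1/2}q^\perp\rangle=0$ for all $q\in H^{1,1/2}_{0,per}(Q)$. For every Friedrichs constant $C_F$ of $\Omega$: 1.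 For all $v\in L^2(Q)$, $\eta,\zeta\in H^{1,1}_{0,per}(Q)$, $\boldsymbol\tau,\boldsymbol\rho\in H(\mathrm{div},Q)$ and $\alpha,\beta>0$, $$|||u-v|||^2\le\mathcal M^\oplus(\alpha,\beta;\eta,\zeta,\boldsymbol\tau,\boldsymbol\rho,v)=\mathcal J^\oplus(\alpha,\beta;\eta,\boldsymbol\tau,v)-\mathcal J^\ominus(\eta,\zeta,\boldsymbol\tau,\boldsymbol\rho).$$ 2. The infimum of $\mathcal M^\oplus(\alpha,\beta;\eta,\zeta,\boldsymbol\tau,\boldsymbol\rho,v)$ over all these arguments is $0$. 3. It is approached at the exact solution as $\alpha\to0$: $y(u),p(u)\in H^{1,1}_{0,per}(Q)$, $\nu\nabla y(u),\nu\nabla p(u)\in H(\mathrm{div},Q)$, and for all $\alpha,\beta>0$ $$\mathcal M^\oplus(\alpha,\beta;y(u),p(u),\nu\nabla y(u),\nu\nabla p(u),u)=\tfrac\alpha2\|y(u)-y_d\|^2,$$ which tends to $0$ as $\alpha\to0^+$ with $\beta$ fixed. -/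

import Mathlib

open MeasureTheory Filter Topology Set
open scoped ContDiff

noncomputable section

namespace PeriodicControl

/-- The spatial Euclidean space `ℝ^d`. Points of space-time are pairs `(x, t)`. -/
abbrev Space (d : ℕ) : Type := EuclideanSpace ℝ (Fin d)

variable {d : ℕ}

/-! ### Measures, norms, test functions -/

/-- Lebesgue measure on the space-time cylinder `Q = Ω × (0,T)`. -/
def measQ (Ω : Set (Space d)) (T : ℝ) : Measure (Space d × ℝ) :=
  volume.restrict (Ω ×ˢ Ioo 0 T)

/-- The `L²` norm of a (scalar or vector valued) function; only used for `L²` functions. -/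
def l2norm {X F : Type*} [MeasurableSpace X] [NormedAddCommGroup F] (μ : Measure X)
    (f : X → F) : ℝ :=
  (eLpNorm f 2 μ).toReal

/-- Spatial gradient of a smooth function of `(x,t)`. -/
def gradX (φ : Space d × ℝ → ℝ) : Space d × ℝ → Space d :=
  fun z => gradient (fun x => φ (x, z.2)) z.1

/-- Time derivative of a smooth function of `(x,t)`. -/
def derivT (φ : Space d × ℝ → ℝ) : Space d × ℝ → ℝ :=
  fun z => deriv (fun t => φ (z.1, t)) z.2

/-- Smooth functions of `(x,t)` that vanish near the lateral surface `Σ = ∂Ω × (0,T)`;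
no condition is imposed at `t = 0` and `t = T`. -/
def IsLateralTest (Ω : Set (Space d)) (φ : Space d × ℝ → ℝ) : Prop :=
  ContDiff ℝ ∞ φ ∧ ∃ K : Set (Space d), IsCompact K ∧ K ⊆ Ω ∧ ∀ x, x ∉ K → ∀ t, φ (x, t) = 0

/-- `C` is a Friedrichs constant of `Ω`: `‖w‖_Ω ≤ C ‖∇w‖_Ω` for all `w ∈ C_c^∞(Ω)`
(equivalently, by density, for all `w ∈ H¹₀(Ω)`). -/
def IsFriedrichsConstant (Ω : Set (Space d)) (C : ℝ) : Prop :=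
  0 < C ∧ ∀ w : Space d → ℝ, ContDiff ℝ ∞ w → HasCompactSupport w → tsupport w ⊆ Ω →
    l2norm (volume.restrict Ω) w ≤ C * l2norm (volume.restrict Ω) (gradient w)

/-! ### Function spaces -/

/-- `u ∈ H^{1,0}_0(Q)` with weak spatial gradient `g`: `(u, g)` is a limit in `L²(Q) × L²(Q)^d` of
pairs `(φ, ∇φ)` with `φ` smooth and vanishing near the lateral surface. -/
def IsH10Zero (Ω : Set (Space d)) (T : ℝ) (u : Space d × ℝ → ℝ) (g : Space d × ℝ → Space d) :
    Prop :=
  MemLp u 2 (measQ Ω T) ∧ MemLp g 2 (measQ Ω T) ∧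
    ∃ φ : ℕ → Space d × ℝ → ℝ, (∀ n, IsLateralTest Ω (φ n)) ∧
      Tendsto (fun n => eLpNorm (u - φ n) 2 (measQ Ω T)) atTop (𝓝 0) ∧
      Tendsto (fun n => eLpNorm (g - gradX (φ n)) 2 (measQ Ω T)) atTop (𝓝 0)

/-- `w` is the weak time derivative of `u` in `Q`, and `a`, `b` are the traces `u(0)`, `u(T)`
(integration by parts in time; test functions compactly supported in `Q` give the weak derivative,
the remaining ones identify the traces). -/
def HasTimeDerivWithTraces (Ω : Set (Space d)) (T : ℝ) (u w : Space d × ℝ → ℝ)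
    (a b : Space d → ℝ) : Prop :=
  ∀ φ, IsLateralTest Ω φ →
    (∫ z, u z * derivT φ z ∂measQ Ω T) + ∫ z, w z * φ z ∂measQ Ω T =
      (∫ x in Ω, b x * φ (x, T)) - ∫ x in Ω, a x * φ (x, 0)

/-- `u ∈ H^{0,1}_{per}(Q)` with weak time derivative `w`: `u(0) = u(T)`. -/
def IsH01Per (Ω : Set (Space d)) (T : ℝ) (u w : Space d × ℝ → ℝ) : Prop :=
  MemLp u 2 (measQ Ω T) ∧ MemLp w 2 (measQ Ω T) ∧
    ∃ a : Space d → ℝ, MemLp a 2 (volume.restrict Ω) ∧ HasTimeDerivWithTraces Ω T u w a a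

/-- The space `H^{1,1}_{0,per}(Q)`; an element is given with its weak derivatives. -/
structure H11 (Ω : Set (Space d)) (T : ℝ) where
  val : Space d × ℝ → ℝ
  grad : Space d × ℝ → Space d
  dt : Space d × ℝ → ℝ
  isH10Zero : IsH10Zero Ω T val grad
  isH01Per : IsH01Per Ω T val dt

/-- The space `H(div,Q)`; an element is given with its weak spatial divergence in `L²(Q)`. -/
structure Hdiv (Ω : Set (Space d)) (T : ℝ) where
  val : Space d × ℝ → Space d
  div : Space d × ℝ → ℝ
  memLp_val : MemLp val 2 (measQ Ω T)
  memLp_div : MemLp div 2 (measQ Ω T)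
  integral_div : ∀ φ, IsLateralTest Ω φ →
    ∫ z, div z * φ z ∂measQ Ω T = -∫ z, inner ℝ (val z) (gradX φ z) ∂measQ Ω T

/-- The frequency `ω = 2π/T`. -/
def freq (T : ℝ) : ℝ := 2 * Real.pi / T

/-- Fourier coefficient `u_k^c(x) = (2/T) ∫₀ᵀ u(x,t) cos(kωt) dt`, `k ≥ 1`. -/
def cosCoeff (T : ℝ) (u : Space d × ℝ → ℝ) (k : ℕ) (x : Space d) : ℝ :=
  2 / T * ∫ t in Ioo 0 T, u (x, t) * Real.cos (k * freq T * t)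

/-- Fourier coefficient `u_k^s(x) = (2/T) ∫₀ᵀ u(x,t) sin(kωt) dt`, `k ≥ 1`. -/
def sinCoeff (T : ℝ) (u : Space d × ℝ → ℝ) (k : ℕ) (x : Space d) : ℝ :=
  2 / T * ∫ t in Ioo 0 T, u (x, t) * Real.sin (k * freq T * t)

/-- `‖∂_t^{1/2} u‖² = (T/2) ∑_{k ≥ 1} kω ‖u_k‖²_Ω` is finite (the term `k = 0` is zero). -/
def HasHalfDeriv (Ω : Set (Space d)) (T : ℝ) (u : Space d × ℝ → ℝ) : Prop :=
  Summable fun k : ℕ => k * freq T * ∫ x in Ω, (cosCoeff T u k x ^ 2 + sinCoeff T u k x ^ 2)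

/-- The space `H^{1,1/2}_{0,per}(Q)`; an element is given with its weak spatial gradient. -/
structure H1half (Ω : Set (Space d)) (T : ℝ) where
  val : Space d × ℝ → ℝ
  grad : Space d × ℝ → Space d
  isH10Zero : IsH10Zero Ω T val grad
  hasHalfDeriv : HasHalfDeriv Ω T val

/-- `⟨σ ∂_t^{1/2} u, ∂_t^{1/2} q^⊥⟩ = (T/2) ∑_{k ≥ 1} kω ⟨σ u_k, q_k^⊥⟩_Ω`, where
`u_k = (u_k^c, u_k^s)` and `q_k^⊥ = (-q_k^s, q_k^c)`. It equals `⟨σ ∂_t u, q⟩` for time periodic `u`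
with `∂_t u ∈ L²(Q)`. -/
def halfPerp (Ω : Set (Space d)) (T : ℝ) (σ : Space d → ℝ) (u q : Space d × ℝ → ℝ) : ℝ :=
  T / 2 * ∑' k : ℕ, k * freq T *
    ∫ x in Ω, σ x * (cosCoeff T u k x * (-sinCoeff T q k x) + sinCoeff T u k x * cosCoeff T q k x)

/-! ### The optimal control problem -/

/-- The data of the control problem: a bounded open set `Ω ⊆ ℝ^d`, a period `T`, measurable
coefficients `σ`, `ν` with positive lower bounds and upper bounds, the cost parameter `lam`, and the
desired state `yd ∈ L²(Q)`. -/
structure Problem (d : ℕ) where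
  Ω : Set (Space d)
  isOpen_Ω : IsOpen Ω
  isBounded_Ω : Bornology.IsBounded Ω
  T : ℝ
  T_pos : 0 < T
  σ : Space d → ℝ
  σlo : ℝ
  σhi : ℝ
  aemeasurable_σ : AEMeasurable σ (volume.restrict Ω)
  σlo_pos : 0 < σlo
  σ_mem : ∀ x ∈ Ω, σlo ≤ σ x ∧ σ x ≤ σhi
  ν : Space d → ℝ
  νlo : ℝ
  νhi : ℝ
  aemeasurable_ν : AEMeasurable ν (volume.restrict Ω)
  νlo_pos : 0 < νlo
  ν_mem : ∀ x ∈ Ω, νlo ≤ ν x ∧ ν x ≤ νhi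
  lam : ℝ
  lam_pos : 0 < lam
  yd : Space d × ℝ → ℝ
  memLp_yd : MemLp yd 2 (measQ Ω T)

namespace Problem

variable (P : Problem d)

/-- Lebesgue measure on `Q`. -/
def μ : Measure (Space d × ℝ) := measQ P.Ω P.T

/-- The space `H^{1,1/2}_{0,per}(Q)` of states and adjoint states. -/
abbrev StateSpace : Type := H1half P.Ω P.T

/-- `μ₁ = (1/√2) min{ν, σ}` (lower bounds). -/
def mu1 : ℝ := 1 / Real.sqrt 2 * min P.νlo P.σlo

/-- `y = y(v)`: weak time periodic solution of `σ ∂_t y - ∇·(ν∇y) = v`. -/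
def IsState (v : Space d × ℝ → ℝ) (y : P.StateSpace) : Prop :=
  ∀ q : P.StateSpace,
    (∫ z, P.ν z.1 * inner ℝ (y.grad z) (q.grad z) ∂P.μ) + halfPerp P.Ω P.T P.σ y.val q.val =
      ∫ z, v z * q.val z ∂P.μ

/-- The adjoint equation: the first equation of the optimality system. -/
def IsAdjoint (y p : P.StateSpace) : Prop :=
  ∀ q : P.StateSpace,
    (∫ z, (y.val z * q.val z - P.ν z.1 * inner ℝ (p.grad z) (q.grad z)) ∂P.μ)
      + halfPerp P.Ω P.T P.σ p.val q.val = ∫ z, P.yd z * q.val z ∂P.μ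

/-- The (reduced) optimality system for `(y, p)`. -/
def IsOptimalitySystem (y p : P.StateSpace) : Prop :=
  P.IsAdjoint y p ∧
  ∀ q : P.StateSpace,
    (∫ z, (P.ν z.1 * inner ℝ (y.grad z) (q.grad z) + P.lam⁻¹ * (p.val z * q.val z)) ∂P.μ)
      + halfPerp P.Ω P.T P.σ y.val q.val = 0

/-- The cost functional `J(y,u) = ½‖y - y_d‖² + (λ/2)‖u‖²`. -/
def cost (y u : Space d × ℝ → ℝ) : ℝ :=
  1 / 2 * l2norm P.μ (y - P.yd) ^ 2 + P.lam / 2 * l2norm P.μ u ^ 2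

/-- `u ∈ L²(Q)` is an optimal control with state `y = y(u)`: it minimizes `v ↦ J(y(v),v)` over all
controls `v ∈ L²(Q)`. -/
def IsOptimal (u : Space d × ℝ → ℝ) (y : P.StateSpace) : Prop :=
  MemLp u 2 P.μ ∧ P.IsState u y ∧
    ∀ (v : Space d × ℝ → ℝ) (yv : P.StateSpace), MemLp v 2 P.μ → P.IsState v yv →
      P.cost y.val u ≤ P.cost yv.val v

/-- `|||u - v|||² = ½‖y(u) - y(v)‖² + (λ/2)‖u - v‖²`, with `yu = y(u)` and `yv = y(v)`. -/
def errorSq (u yu v yv : Space d × ℝ → ℝ) : ℝ :=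
  1 / 2 * l2norm P.μ (yu - yv) ^ 2 + P.lam / 2 * l2norm P.μ (u - v) ^ 2

/-! ### Residuals, majorants, minorant -/

/-- `R₁(η,τ,v) = σ ∂_t η - ∇·τ - v`. -/
def R1 (η : H11 P.Ω P.T) (τ : Hdiv P.Ω P.T) (v : Space d × ℝ → ℝ) : Space d × ℝ → ℝ :=
  fun z => P.σ z.1 * η.dt z - τ.div z - v z

/-- `R₂(η,τ) = τ - ν∇η`. -/
def R2 (η : H11 P.Ω P.T) (τ : Hdiv P.Ω P.T) : Space d × ℝ → Space d :=
  fun z => τ.val z - P.ν z.1 • η.grad z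

/-- `R₃(ζ,ρ,η) = η - y_d + ∇·ρ + σ ∂_t ζ`. -/
def R3 (ζ : H11 P.Ω P.T) (ρ : Hdiv P.Ω P.T) (η : H11 P.Ω P.T) : Space d × ℝ → ℝ :=
  fun z => η.val z - P.yd z + ρ.div z + P.σ z.1 * ζ.dt z

/-- `R₄(ζ,ρ) = ρ - ν∇ζ`. -/
def R4 (ζ : H11 P.Ω P.T) (ρ : Hdiv P.Ω P.T) : Space d × ℝ → Space d :=
  fun z => ρ.val z - P.ν z.1 • ζ.grad z

/-- `γ = (1+α)(1+β) C_F² / (2 α μ₁²)`. -/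
def gam (CF α β : ℝ) : ℝ := (1 + α) * (1 + β) * CF ^ 2 / (2 * α * P.mu1 ^ 2)

/-- The cost majorant `J^⊕(α,β;η,τ,v)`. -/
def costMajorant (CF α β : ℝ) (η : H11 P.Ω P.T) (τ : Hdiv P.Ω P.T)
    (v : Space d × ℝ → ℝ) : ℝ :=
  (1 + α) / 2 * l2norm P.μ (η.val - P.yd) ^ 2
    + P.gam CF α β * (l2norm P.μ (P.R2 η τ) ^ 2 + CF ^ 2 / β * l2norm P.μ (P.R1 η τ v) ^ 2)
    + P.lam / 2 * l2norm P.μ v ^ 2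

/-- The cost minorant `J^⊖(η,ζ,τ,ρ)`. -/
def costMinorant (CF : ℝ) (η ζ : H11 P.Ω P.T) (τ ρ : Hdiv P.Ω P.T) : ℝ :=
  1 / 2 * l2norm P.μ (η.val - P.yd) ^ 2
    + 1 / (2 * P.lam) * l2norm P.μ ζ.val ^ 2
    - (∫ z, (P.ν z.1 * inner ℝ (η.grad z) (ζ.grad z) + P.σ z.1 * η.dt z * ζ.val z
        + P.lam⁻¹ * ζ.val z ^ 2) ∂P.μ)
    - CF ^ 2 / (P.mu1 ^ 2 * P.lam)
        * (CF * l2norm P.μ (P.R3 ζ ρ η) + l2norm P.μ (P.R4 ζ ρ)) ^ 2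
    - 1 / P.mu1
        * (CF * l2norm P.μ (P.R1 η τ (fun z => -P.lam⁻¹ * ζ.val z)) + l2norm P.μ (P.R2 η τ))
        * (CF * l2norm P.μ (P.R3 ζ ρ η) + l2norm P.μ (P.R4 ζ ρ))

/-- The error majorant `M^⊕(α,β;η,ζ,τ,ρ,v)`. -/
def errorMajorant (CF α β : ℝ) (η ζ : H11 P.Ω P.T) (τ ρ : Hdiv P.Ω P.T)
    (v : Space d × ℝ → ℝ) : ℝ :=
  α / 2 * l2norm P.μ (η.val - P.yd) ^ 2
    + P.gam CF α β * (l2norm P.μ (P.R2 η τ) ^ 2 + CF ^ 2 / β * l2norm P.μ (P.R1 η τ v) ^ 2)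
    + P.lam / 2 * l2norm P.μ v ^ 2
    - 1 / (2 * P.lam) * l2norm P.μ ζ.val ^ 2
    + (∫ z, (P.ν z.1 * inner ℝ (η.grad z) (ζ.grad z) + P.σ z.1 * η.dt z * ζ.val z
        + P.lam⁻¹ * ζ.val z ^ 2) ∂P.μ)
    + CF ^ 2 / (P.mu1 ^ 2 * P.lam)
        * (CF * l2norm P.μ (P.R3 ζ ρ η) + l2norm P.μ (P.R4 ζ ρ)) ^ 2
    + 1 / P.mu1
        * (CF * l2norm P.μ (P.R1 η τ (fun z => -P.lam⁻¹ * ζ.val z)) + l2norm P.μ (P.R2 η τ))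
        * (CF * l2norm P.μ (P.R3 ζ ρ η) + l2norm P.μ (P.R4 ζ ρ))

end Problem

end PeriodicControl

end

noncomputable section

namespace PeriodicControl

variable {d : ℕ}

/-! ### The Hartley system in time -/

/-- The Hartley functions `t ↦ (cos(nωt) + sin(nωt)) / √T`, `n ∈ ℤ`: a real orthonormal basis of
`L²(0,T)` with `e_n' = nω e_{-n}`. -/
def eT (T : ℝ) (n : ℤ) (t : ℝ) : ℝ :=
  (Real.cos (n * freq T * t) + Real.sin (n * freq T * t)) / Real.sqrt T

lemma contDiff_eT (T : ℝ) (n : ℤ) : ContDiff ℝ ∞ (eT T n) := by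
  unfold eT
  fun_prop

lemma continuous_eT (T : ℝ) (n : ℤ) : Continuous (eT T n) := (contDiff_eT T n).continuous

lemma hasDerivAt_eT (T : ℝ) (n : ℤ) (t : ℝ) :
    HasDerivAt (eT T n) (n * freq T * eT T (-n) t) t := by
  have h0 : HasDerivAt (fun t : ℝ => n * freq T * t) (n * freq T) t := by
    simpa using (hasDerivAt_id t).const_mul (n * freq T)
  have h := ((h0.cos).add (h0.sin)).div_const (Real.sqrt T)
  refine h.congr_deriv ?_
  have : ((-n : ℤ) : ℝ) * freq T * t = -(n * freq T * t) := by push_cast; ring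
  rw [eT, this, Real.cos_neg, Real.sin_neg]
  ring

lemma eT_zero (T : ℝ) (t : ℝ) : eT T 0 t = (Real.sqrt T)⁻¹ := by
  simp [eT]

lemma freq_mul {T : ℝ} (hT : 0 < T) : freq T * T = 2 * Real.pi := by
  unfold freq; field_simp

lemma freq_pos {T : ℝ} (hT : 0 < T) : 0 < freq T := by
  unfold freq; positivity

lemma eT_period {T : ℝ} (hT : 0 < T) (n : ℤ) : eT T n T = eT T n 0 := by
  have h : (n : ℝ) * freq T * T = n * (2 * Real.pi) := by rw [mul_assoc, freq_mul hT]
  have h2 : Real.sin (n * (2 * Real.pi)) = 0 := by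
    have := Real.sin_int_mul_pi (2 * n)
    rw [← this]; push_cast; ring_nf
  simp [eT, h, h2, Real.cos_int_mul_two_pi]

lemma abs_eT_le (T : ℝ) (n : ℤ) (t : ℝ) : |eT T n t| ≤ 2 / Real.sqrt T := by
  unfold eT
  rw [abs_div, abs_of_nonneg (Real.sqrt_nonneg T)]
  gcongr
  calc _ ≤ _ := abs_add_le _ _
    _ ≤ 1 + 1 := add_le_add (Real.abs_cos_le_one _) (Real.abs_sin_le_one _)
    _ = 2 := by norm_num

lemma integral_cos_freq {T : ℝ} (hT : 0 < T) (k : ℤ) :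
    ∫ t in (0)..T, Real.cos (k * freq T * t) = if k = 0 then T else 0 := by
  split_ifs with h
  · simp [h]
  · have hk : (k : ℝ) * freq T ≠ 0 := mul_ne_zero (by exact_mod_cast h) (freq_pos hT).ne'
    rw [intervalIntegral.integral_comp_mul_left _ hk, integral_cos]
    have h2 : Real.sin (k * freq T * T) = 0 := by
      rw [mul_assoc, freq_mul hT]
      have := Real.sin_int_mul_pi (2 * k)
      rw [← this]; push_cast; ring_nf
    simp [h2]

lemma integral_sin_freq {T : ℝ} (hT : 0 < T) (k : ℤ) :
    ∫ t in (0)..T, Real.sin (k * freq T * t) = 0 := by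
  by_cases h : k = 0
  · simp [h]
  · have hk : (k : ℝ) * freq T ≠ 0 := mul_ne_zero (by exact_mod_cast h) (freq_pos hT).ne'
    rw [intervalIntegral.integral_comp_mul_left _ hk, integral_sin]
    simp [mul_assoc, freq_mul hT, Real.cos_int_mul_two_pi]

lemma integral_eT_mul {T : ℝ} (hT : 0 < T) (n m : ℤ) :
    ∫ t in Ioo 0 T, eT T n t * eT T m t = if n = m then 1 else 0 := by
  rw [← integral_Ioc_eq_integral_Ioo, ← intervalIntegral.integral_of_le hT.le]
  have h : ∀ t, eT T n t * eT T m t = T⁻¹ * (Real.cos ((n - m : ℤ) * freq T * t) +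
      Real.sin ((n + m : ℤ) * freq T * t)) := by
    intro t
    have h1 : ((n - m : ℤ) : ℝ) * freq T * t = n * freq T * t - m * freq T * t := by
      push_cast; ring
    have h2 : ((n + m : ℤ) : ℝ) * freq T * t = n * freq T * t + m * freq T * t := by
      push_cast; ring
    rw [h1, h2, Real.cos_sub, Real.sin_add, eT, eT]
    have : Real.sqrt T * Real.sqrt T = T := Real.mul_self_sqrt hT.le
    rw [div_mul_div_comm, this]
    field_simp
    ring
  simp_rw [h]
  rw [intervalIntegral.integral_const_mul, intervalIntegral.integral_add, integral_cos_freq hT,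
    integral_sin_freq hT]
  · simp only [sub_eq_zero, add_zero]
    split_ifs with h
    · field_simp
    · simp
  · exact (Continuous.intervalIntegrable (by fun_prop) _ _)
  · exact (Continuous.intervalIntegrable (by fun_prop) _ _)

/-- Completeness of the Hartley system in `L²(0,T)`. -/
lemma ae_eq_zero_of_integral_eT {T : ℝ} (hT : 0 < T) {f : ℝ → ℝ}
    (hf : MemLp f 2 (volume.restrict (Ioo 0 T)))
    (h : ∀ n, ∫ t in Ioo 0 T, eT T n t * f t = 0) :
    f =ᵐ[volume.restrict (Ioo 0 T)] 0 := by
  have hI : Integrable f (volume.restrict (Ioo 0 T)) := hf.integrable one_le_two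
  have hcos (n : ℤ) : Integrable (fun t => Real.cos (n * freq T * t) * f t)
      (volume.restrict (Ioo 0 T)) :=
    hI.bdd_mul (c := 1) (by fun_prop : Continuous _).aestronglyMeasurable
      (ae_of_all _ fun t => by simpa using Real.abs_cos_le_one _)
  have hsin (n : ℤ) : Integrable (fun t => Real.sin (n * freq T * t) * f t)
      (volume.restrict (Ioo 0 T)) :=
    hI.bdd_mul (c := 1) (by fun_prop : Continuous _).aestronglyMeasurable
      (ae_of_all _ fun t => by simpa using Real.abs_sin_le_one _)
  have key (n : ℤ) : ∫ t in Ioo 0 T, Real.cos (n * freq T * t) * f t =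
      -∫ t in Ioo 0 T, Real.sin (n * freq T * t) * f t := by
    have h1 := h n
    have : ∀ t, eT T n t * f t = (Real.sqrt T)⁻¹ * (Real.cos (n * freq T * t) * f t +
        Real.sin (n * freq T * t) * f t) := by
      intro t; rw [eT]; field_simp
    simp_rw [this] at h1
    rw [integral_const_mul, integral_add (hcos n) (hsin n)] at h1
    have h0 : (Real.sqrt T)⁻¹ ≠ 0 := by positivity
    linarith [(mul_eq_zero.mp h1).resolve_left h0]
  have hs0 (n : ℤ) : ∫ t in Ioo 0 T, Real.sin (n * freq T * t) * f t = 0 := by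
    have h1 := key n
    have h2 := key (-n)
    simp only [Int.cast_neg, neg_mul, Real.cos_neg, Real.sin_neg, integral_neg] at h2
    linarith
  have hc0 (n : ℤ) : ∫ t in Ioo 0 T, Real.cos (n * freq T * t) * f t = 0 := by
    rw [key, hs0, neg_zero]
  have hfC : MemLp (fun t => (f t : ℂ)) 2 (volume.restrict (Ioc 0 T)) := by
    rw [restrict_Ioo_eq_restrict_Ioc] at hf
    exact hf.ofReal
  have hP := hasSum_sq_fourierCoeffOn hT hfC
  have hz : ∀ n, fourierCoeffOn hT (fun t => (f t : ℂ)) n = 0 := by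
    intro n
    rw [fourierCoeffOn_eq_integral]
    have e : ∀ t : ℝ, fourier (-n) (t : AddCircle (T - 0)) • (f t : ℂ) =
        ((Real.cos (n * freq T * t) * f t : ℝ) : ℂ) -
          Complex.I * ((Real.sin (n * freq T * t) * f t : ℝ) : ℂ) := by
      intro t
      rw [fourier_coe_apply]
      have : (2 * Real.pi * Complex.I * (-n : ℤ) * t / ((T - 0 : ℝ) : ℂ)) =
          ((-(n * freq T * t) : ℝ) : ℂ) * Complex.I := by
        simp only [freq, sub_zero]; push_cast; field_simp
      rw [this, Complex.exp_mul_I, ← Complex.ofReal_cos, ← Complex.ofReal_sin, Real.cos_neg,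
        Real.sin_neg]
      simp only [smul_eq_mul]; push_cast; ring
    simp_rw [e]
    rw [intervalIntegral.integral_of_le hT.le, integral_Ioc_eq_integral_Ioo, integral_sub,
      integral_const_mul, integral_complex_ofReal, integral_complex_ofReal, hs0, hc0]
    · simp
    · exact (hcos n).ofReal
    · exact (hsin n).ofReal.const_mul _
  simp only [hz, norm_zero, ne_eq, OfNat.ofNat_ne_zero, not_false_eq_true, zero_pow] at hP
  have h0 : ∫ t in Ioo 0 T, f t ^ 2 = 0 := by
    have := hP.unique hasSum_zero
    rw [sub_zero, smul_eq_mul, intervalIntegral.integral_of_le hT.le,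
      integral_Ioc_eq_integral_Ioo] at this
    simpa [hT.ne'] using this
  rw [integral_eq_zero_iff_of_nonneg (fun t => sq_nonneg _) hf.integrable_sq] at h0
  filter_upwards [h0] with t ht
  simpa using ht

/-! ### Tensor products with time functions -/

lemma measQ_eq (Ω : Set (Space d)) (T : ℝ) :
    measQ Ω T = (volume.restrict Ω).prod (volume.restrict (Ioo 0 T)) := by
  rw [measQ, Measure.prod_restrict]; rfl

lemma integrable_measQ {E : Type*} [NormedAddCommGroup E] {Ω : Set (Space d)} {T : ℝ}
    {f : Space d × ℝ → E} : Integrable f (measQ Ω T) ↔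
      Integrable f ((volume.restrict Ω).prod (volume.restrict (Ioo 0 T))) := by
  rw [measQ_eq]

lemma integral_measQ {E : Type*} [NormedAddCommGroup E] [NormedSpace ℝ E] {Ω : Set (Space d)}
    {T : ℝ} {f : Space d × ℝ → E} (hf : Integrable f (measQ Ω T)) :
    ∫ z, f z ∂measQ Ω T = ∫ x in Ω, ∫ t in Ioo 0 T, f (x, t) := by
  rw [measQ_eq]
  exact integral_prod _ (integrable_measQ.1 hf)

lemma ae_measQ_of_ae_ae {Ω : Set (Space d)} {T : ℝ} {p : Space d × ℝ → Prop}
    (hp : MeasurableSet {z | p z})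
    (h : ∀ᵐ x ∂(volume.restrict Ω), ∀ᵐ t ∂(volume.restrict (Ioo 0 T)), p (x, t)) :
    ∀ᵐ z ∂measQ Ω T, p z := by
  rw [measQ_eq]
  exact (Measure.ae_prod_iff_ae_ae hp).2 h

instance (Ω : Set (Space d)) (T : ℝ) [IsFiniteMeasure (volume.restrict Ω)] :
    IsFiniteMeasure (measQ Ω T) := by
  rw [measQ_eq]; infer_instance

variable {F : Type*} [NormedAddCommGroup F] [InnerProductSpace ℝ F]

lemma quasi_fst (Ω : Set (Space d)) (T : ℝ) :
    Measure.QuasiMeasurePreserving Prod.fst (measQ Ω T) (volume.restrict Ω) := by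
  rw [measQ_eq]; exact Measure.quasiMeasurePreserving_fst

lemma memLp_tens {Ω : Set (Space d)} {T : ℝ} {f : Space d → F} {θ : ℝ → ℝ}
    (hf : MemLp f 2 (volume.restrict Ω)) (hθ : Continuous θ) :
    MemLp (fun z : Space d × ℝ => θ z.2 • f z.1) 2 (measQ Ω T) := by
  have hm : AEStronglyMeasurable (fun z : Space d × ℝ => θ z.2 • f z.1) (measQ Ω T) :=
    ((hθ.comp continuous_snd).aestronglyMeasurable).smul
      (hf.1.comp_quasiMeasurePreserving (quasi_fst Ω T))
  rw [memLp_two_iff_integrable_sq_norm hm, measQ_eq]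
  have h1 : Integrable (fun t => θ t ^ 2) (volume.restrict (Ioo 0 T)) :=
    ((hθ.pow 2).integrableOn_Icc (a := 0) (b := T)).mono_set Ioo_subset_Icc_self
  have h2 := ((memLp_two_iff_integrable_sq_norm hf.1).1 hf)
  refine (h2.mul_prod h1).congr (ae_of_all _ fun z => ?_)
  simp [norm_smul, mul_pow, mul_comm]

lemma tens_coe_ae {Ω : Set (Space d)} {T : ℝ} {f g : Space d → F} (θ : ℝ → ℝ)
    (h : f =ᵐ[volume.restrict Ω] g) :
    (fun z : Space d × ℝ => θ z.2 • f z.1) =ᵐ[measQ Ω T] fun z => θ z.2 • g z.1 := by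
  filter_upwards [(quasi_fst Ω T).ae_eq_comp h] with z hz
  simp only [Function.comp] at hz
  rw [hz]

/-- `f ↦ e_n(t) f(x)`, as a linear map. -/
def tensₗ (Ω : Set (Space d)) (T : ℝ) (n : ℤ) :
    Lp F 2 (volume.restrict Ω) →ₗ[ℝ] Lp F 2 (measQ Ω T) where
  toFun f := (memLp_tens (T := T) (Lp.memLp f) (continuous_eT T n)).toLp _
  map_add' f g := by
    rw [← MemLp.toLp_add, MemLp.toLp_eq_toLp_iff]
    filter_upwards [tens_coe_ae (T := T) (eT T n) (Lp.coeFn_add f g)] with z hz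
    simpa using hz
  map_smul' c f := by
    rw [RingHom.id_apply, ← MemLp.toLp_const_smul, MemLp.toLp_eq_toLp_iff]
    filter_upwards [tens_coe_ae (T := T) (eT T n) (Lp.coeFn_smul c f)] with z hz
    rw [hz]
    simp [smul_comm c]

lemma tensₗ_ae (Ω : Set (Space d)) (T : ℝ) (n : ℤ) (f : Lp F 2 (volume.restrict Ω)) :
    tensₗ Ω T n f =ᵐ[measQ Ω T] fun z => eT T n z.2 • f z.1 :=
  (memLp_tens (T := T) (Lp.memLp f) (continuous_eT T n)).coeFn_toLp

lemma inner_tensₗ {Ω : Set (Space d)} {T : ℝ} (hT : 0 < T) (n m : ℤ)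
    (f g : Lp F 2 (volume.restrict Ω)) :
    inner ℝ (tensₗ Ω T n f) (tensₗ Ω T m g) = if n = m then inner ℝ f g else 0 := by
  rw [L2.inner_def]
  have h : ∫ z, inner ℝ (tensₗ Ω T n f z) (tensₗ Ω T m g z) ∂measQ Ω T =
      ∫ z, inner ℝ (f z.1) (g z.1) * (eT T n z.2 * eT T m z.2) ∂measQ Ω T := by
    refine integral_congr_ae ?_
    filter_upwards [tensₗ_ae Ω T n f, tensₗ_ae Ω T m g] with z h1 h2
    rw [h1, h2, real_inner_smul_left, real_inner_smul_right]
    ring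
  rw [h, measQ_eq, integral_prod_mul (fun x => inner ℝ (f x) (g x))
    (fun t => eT T n t * eT T m t), integral_eT_mul hT, L2.inner_def]
  split_ifs <;> simp

/-- `f ↦ e_n(t) f(x)`, as an isometry `L²(Ω) → L²(Q)`. -/
def tens (Ω : Set (Space d)) {T : ℝ} (hT : 0 < T) (n : ℤ) :
    Lp F 2 (volume.restrict Ω) →ₗᵢ[ℝ] Lp F 2 (measQ Ω T) :=
  (tensₗ Ω T n).isometryOfInner fun f g => by rw [inner_tensₗ hT]; simp

lemma tens_ae (Ω : Set (Space d)) {T : ℝ} (hT : 0 < T) (n : ℤ)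
    (f : Lp F 2 (volume.restrict Ω)) :
    tens Ω hT n f =ᵐ[measQ Ω T] fun z => eT T n z.2 • f z.1 :=
  tensₗ_ae Ω T n f

lemma inner_tens (Ω : Set (Space d)) {T : ℝ} (hT : 0 < T) (n m : ℤ)
    (f g : Lp F 2 (volume.restrict Ω)) :
    inner ℝ (tens Ω hT n f) (tens Ω hT m g) = if n = m then inner ℝ f g else 0 :=
  inner_tensₗ hT n m f g

lemma integrable_eT_smul {Ω : Set (Space d)} {T : ℝ} {u : Space d × ℝ → F}
    (hu : Integrable u (measQ Ω T)) (n : ℤ) :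
    Integrable (fun z => eT T n z.2 • u z) (measQ Ω T) :=
  hu.bdd_smul (2 / Real.sqrt T)
    ((continuous_eT T n).comp continuous_snd).aestronglyMeasurable
    (ae_of_all _ fun z => abs_eT_le T n z.2)

variable [CompleteSpace F]

/-- The Fourier coefficient `x ↦ ∫₀ᵀ e_n(t) u(x,t) dt`, defined as the adjoint of `tens`. -/
def coef (Ω : Set (Space d)) {T : ℝ} (hT : 0 < T) (n : ℤ) :
    Lp F 2 (measQ Ω T) →L[ℝ] Lp F 2 (volume.restrict Ω) :=
  ContinuousLinearMap.adjoint (tens Ω hT n).toContinuousLinearMap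

lemma inner_coef_left (Ω : Set (Space d)) {T : ℝ} (hT : 0 < T) (n : ℤ)
    (u : Lp F 2 (measQ Ω T)) (f : Lp F 2 (volume.restrict Ω)) :
    inner ℝ (coef Ω hT n u) f = inner ℝ u (tens Ω hT n f) :=
  ContinuousLinearMap.adjoint_inner_left _ _ _

lemma inner_coef_right (Ω : Set (Space d)) {T : ℝ} (hT : 0 < T) (n : ℤ)
    (u : Lp F 2 (measQ Ω T)) (f : Lp F 2 (volume.restrict Ω)) :
    inner ℝ f (coef Ω hT n u) = inner ℝ (tens Ω hT n f) u :=
  ContinuousLinearMap.adjoint_inner_right _ _ _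

lemma coef_tens (Ω : Set (Space d)) {T : ℝ} (hT : 0 < T) (n m : ℤ)
    (f : Lp F 2 (volume.restrict Ω)) :
    coef Ω hT n (tens Ω hT m f) = if m = n then f else 0 := by
  refine ext_inner_right ℝ fun g => ?_
  rw [inner_coef_left, inner_tens]
  split_ifs <;> simp

lemma coef_ae (Ω : Set (Space d)) [IsFiniteMeasure (volume.restrict Ω)] {T : ℝ} (hT : 0 < T)
    (n : ℤ) (u : Lp F 2 (measQ Ω T)) :
    coef Ω hT n u =ᵐ[volume.restrict Ω] fun x => ∫ t in Ioo 0 T, eT T n t • u (x, t) := by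
  have hu : Integrable u (measQ Ω T) := (Lp.memLp u).integrable one_le_two
  have hu' := integrable_eT_smul hu n
  rw [integrable_measQ] at hu'
  have hI := hu'.integral_prod_left
  refine Integrable.ae_eq_of_forall_setIntegral_eq _ _
    ((Lp.memLp _).integrable one_le_two) hI fun s hs _ => ?_
  refine ext_inner_left ℝ fun c => ?_
  have hc := inner_coef_right Ω hT n u (indicatorConstLp 2 hs (measure_ne_top _ s) c)
  rw [L2.inner_indicatorConstLp_eq_inner_setIntegral] at hc
  rw [hc, L2.inner_def]
  have h1 : ∫ z, inner ℝ (tens Ω hT n (indicatorConstLp 2 hs (measure_ne_top _ s) c) z) (u z)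
      ∂measQ Ω T = ∫ z, s.indicator (fun x => inner ℝ c (eT T n z.2 • u (x, z.2))) z.1
        ∂measQ Ω T := by
    refine integral_congr_ae ?_
    filter_upwards [tens_ae Ω hT n (indicatorConstLp 2 hs (measure_ne_top _ s) c),
      (quasi_fst Ω T).ae_eq_comp (indicatorConstLp_coeFn (p := 2) (hs := hs)
        (hμs := measure_ne_top (volume.restrict Ω) s) (c := c))] with z h1 h2
    simp only [Function.comp] at h2
    rw [h1, h2]
    by_cases hz : z.1 ∈ s <;> simp [hz, real_inner_smul_left, real_inner_smul_right]
  rw [h1, integral_measQ]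
  · rw [← integral_inner hI.integrableOn, ← integral_indicator hs]
    refine integral_congr_ae ?_
    filter_upwards [hu'.prod_right_ae] with x hx
    by_cases hxs : x ∈ s
    · simp only [hxs, indicator_of_mem]
      exact integral_inner hx c
    · simp [hxs]
  · have : (fun z : Space d × ℝ => s.indicator (fun x => inner ℝ c (eT T n z.2 • u (x, z.2))) z.1)
        = (s ×ˢ univ).indicator (fun z => inner ℝ c (eT T n z.2 • u z)) := by
      ext z
      by_cases hz : z.1 ∈ s <;> simp [hz]
    rw [this, integrable_measQ]
    exact (hu'.const_inner c).indicator (hs.prod MeasurableSet.univ)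

variable [SecondCountableTopology F]

lemma eq_zero_of_coef_eq_zero (Ω : Set (Space d)) [IsFiniteMeasure (volume.restrict Ω)] {T : ℝ}
    (hT : 0 < T) (u : Lp F 2 (measQ Ω T)) (h : ∀ n, coef Ω hT n u = 0) : u = 0 := by
  rw [Lp.eq_zero_iff_ae_eq_zero]
  refine ae_eq_zero_of_forall_inner (𝕜 := ℝ) fun c => ?_
  have hu2 := (memLp_two_iff_integrable_sq_norm (Lp.memLp u).1).1 (Lp.memLp u)
  have hu1 : Integrable u (measQ Ω T) := (Lp.memLp u).integrable one_le_two
  have hsm := (Lp.stronglyMeasurable u)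
  have hmeas : MeasurableSet {z | inner ℝ c (u z) = 0} :=
    (((stronglyMeasurable_const (b := c)).inner hsm).measurable) (measurableSet_singleton 0)
  have hzero : ∀ᵐ x ∂(volume.restrict Ω), ∀ n, ∫ t in Ioo 0 T, eT T n t • u (x, t) = 0 := by
    rw [ae_all_iff]
    intro n
    filter_upwards [coef_ae Ω hT n u, Lp.coeFn_zero F 2 (volume.restrict Ω)] with x hx h0
    rw [← hx, h n, h0]; rfl
  have key : ∀ᵐ x ∂(volume.restrict Ω), ∀ᵐ t ∂(volume.restrict (Ioo 0 T)),
      inner ℝ c (u (x, t)) = 0 := by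
    rw [integrable_measQ] at hu2 hu1
    filter_upwards [hzero, hu2.prod_right_ae, hu1.prod_right_ae] with x hx h2 h1
    have hm : MemLp (fun t => u (x, t)) 2 (volume.restrict (Ioo 0 T)) :=
      (memLp_two_iff_integrable_sq_norm h1.1).2 h2
    refine ae_eq_zero_of_integral_eT hT (hm.const_inner c) fun n => ?_
    have h3 := congrArg (fun v => inner ℝ c v) (hx n)
    simp only [inner_zero_right] at h3
    rw [← integral_inner] at h3
    · simpa [real_inner_smul_right] using h3
    · exact h1.bdd_smul (2 / Real.sqrt T) (continuous_eT T n).aestronglyMeasurable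
        (ae_of_all _ fun z => abs_eT_le T n z)
  exact ae_measQ_of_ae_ae hmeas key

/-- `L²(Q)` is the Hilbert sum of the images of `L²(Ω)` under `f ↦ e_n f`. -/
lemma isHilbertSum_tens (Ω : Set (Space d)) [IsFiniteMeasure (volume.restrict Ω)] {T : ℝ}
    (hT : 0 < T) :
    IsHilbertSum ℝ (fun _ : ℤ => Lp F 2 (volume.restrict Ω))
      (fun n => (tens Ω hT n : _ →ₗᵢ[ℝ] Lp F 2 (measQ Ω T))) := by
  refine IsHilbertSum.mk (fun n m hnm f g => by rw [inner_tens, if_neg hnm]) ?_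
  rw [← Submodule.orthogonal_orthogonal_eq_closure, top_le_iff, Submodule.orthogonal_eq_top_iff,
    Submodule.eq_bot_iff]
  intro u hu
  refine eq_zero_of_coef_eq_zero Ω hT u fun n => ?_
  refine ext_inner_left ℝ fun f => ?_
  rw [inner_coef_right, inner_zero_right]
  refine (Submodule.mem_orthogonal _ _).1 hu _ (Submodule.mem_iSup_of_mem n ⟨f, rfl⟩)

/-- The Fourier coefficients as an isometry onto the square summable sequences. -/
def coefEquiv (Ω : Set (Space d)) [IsFiniteMeasure (volume.restrict Ω)] {T : ℝ} (hT : 0 < T) :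
    Lp F 2 (measQ Ω T) ≃ₗᵢ[ℝ] lp (fun _ : ℤ => Lp F 2 (volume.restrict Ω)) 2 :=
  (isHilbertSum_tens Ω hT).linearIsometryEquiv

lemma hasSum_tens_symm (Ω : Set (Space d)) [IsFiniteMeasure (volume.restrict Ω)] {T : ℝ}
    (hT : 0 < T) (w : lp (fun _ : ℤ => Lp F 2 (volume.restrict Ω)) 2) :
    HasSum (fun n => tens Ω hT n (w n)) ((coefEquiv Ω hT).symm w) :=
  (isHilbertSum_tens Ω hT).hasSum_linearIsometryEquiv_symm w

lemma coef_coefEquiv_symm (Ω : Set (Space d)) [IsFiniteMeasure (volume.restrict Ω)] {T : ℝ}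
    (hT : 0 < T) (w : lp (fun _ : ℤ => Lp F 2 (volume.restrict Ω)) 2) (n : ℤ) :
    coef Ω hT n ((coefEquiv Ω hT).symm w) = w n := by
  have h := (hasSum_tens_symm Ω hT w).mapL (coef Ω hT n)
  simp only [coef_tens] at h
  refine h.unique ?_
  convert hasSum_ite_eq n (w n) using 2 with m
  split_ifs with h <;> simp [h]

lemma coefEquiv_apply (Ω : Set (Space d)) [IsFiniteMeasure (volume.restrict Ω)] {T : ℝ}
    (hT : 0 < T) (u : Lp F 2 (measQ Ω T)) (n : ℤ) :
    coefEquiv Ω hT u n = coef Ω hT n u := by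
  rw [← coef_coefEquiv_symm Ω hT (coefEquiv Ω hT u), LinearIsometryEquiv.symm_apply_apply]

lemma hasSum_tens_coef (Ω : Set (Space d)) [IsFiniteMeasure (volume.restrict Ω)] {T : ℝ}
    (hT : 0 < T) (u : Lp F 2 (measQ Ω T)) :
    HasSum (fun n => tens Ω hT n (coef Ω hT n u)) u := by
  have := hasSum_tens_symm Ω hT (coefEquiv Ω hT u)
  simpa only [coefEquiv_apply, LinearIsometryEquiv.symm_apply_apply] using this

/-- Parseval's identity. -/
lemma hasSum_inner_coef (Ω : Set (Space d)) [IsFiniteMeasure (volume.restrict Ω)] {T : ℝ}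
    (hT : 0 < T) (u v : Lp F 2 (measQ Ω T)) :
    HasSum (fun n => inner ℝ (coef Ω hT n u) (coef Ω hT n v)) (inner ℝ u v) := by
  have := lp.hasSum_inner (𝕜 := ℝ) (coefEquiv Ω hT u) (coefEquiv Ω hT v)
  simpa only [coefEquiv_apply, LinearIsometryEquiv.inner_map_map] using this

lemma summable_norm_coef_sq (Ω : Set (Space d)) [IsFiniteMeasure (volume.restrict Ω)] {T : ℝ}
    (hT : 0 < T) (u : Lp F 2 (measQ Ω T)) :
    Summable (fun n => ‖coef Ω hT n u‖ ^ 2) := by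
  simpa only [real_inner_self_eq_norm_sq] using (hasSum_inner_coef Ω hT u u).summable

/-- The Riesz-Fischer theorem for the Fourier coefficients in time. -/
lemma exists_coef_eq (Ω : Set (Space d)) [IsFiniteMeasure (volume.restrict Ω)] {T : ℝ}
    (hT : 0 < T) (w : ℤ → Lp F 2 (volume.restrict Ω)) (hw : Summable (fun n => ‖w n‖ ^ 2)) :
    ∃ u : Lp F 2 (measQ Ω T), ∀ n, coef Ω hT n u = w n := by
  have hm : Memℓp w 2 := memℓp_gen (by simpa using hw)
  exact ⟨(coefEquiv Ω hT).symm ⟨w, hm⟩, fun n => coef_coefEquiv_symm Ω hT _ n⟩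

end PeriodicControl

end

noncomputable section

namespace PeriodicControl

variable {d : ℕ}

/-! ### Multiplication operators -/

section Mul

variable {α : Type*} [MeasurableSpace α] {μ : Measure α}
variable {F : Type*} [NormedAddCommGroup F] [InnerProductSpace ℝ F]

/-- Multiplication of `L²` functions by a bounded function. -/
def mulL {m : α → ℝ} (hm : MemLp m ⊤ μ) : Lp F 2 μ →L[ℝ] Lp F 2 μ :=
  ContinuousLinearMap.holderL μ ⊤ 2 2 (ContinuousLinearMap.lsmul ℝ ℝ) hm.toLp

lemma mulL_ae {m : α → ℝ} (hm : MemLp m ⊤ μ) (f : Lp F 2 μ) :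
    mulL hm f =ᵐ[μ] fun x => m x • f x := by
  have h := ContinuousLinearMap.coeFn_holder (r := 2)
    (ContinuousLinearMap.lsmul ℝ ℝ : ℝ →L[ℝ] F →L[ℝ] F) hm.toLp f
  filter_upwards [h, hm.coeFn_toLp] with x h1 h2
  rw [h2] at h1
  exact h1

lemma inner_mulL {m : α → ℝ} (hm : MemLp m ⊤ μ) (f g : Lp F 2 μ) :
    inner ℝ (mulL hm f) g = ∫ x, m x * inner ℝ (f x) (g x) ∂μ := by
  rw [L2.inner_def]
  refine integral_congr_ae ?_
  filter_upwards [mulL_ae hm f] with x hx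
  rw [hx, real_inner_smul_left]

lemma inner_mulL_symm {m : α → ℝ} (hm : MemLp m ⊤ μ) (f g : Lp F 2 μ) :
    inner ℝ (mulL hm f) g = inner ℝ f (mulL hm g) := by
  rw [← real_inner_comm f, inner_mulL, inner_mulL]
  simp_rw [real_inner_comm]

lemma le_inner_mulL {m : α → ℝ} (hm : MemLp m ⊤ μ) {c : ℝ} (hc : ∀ᵐ x ∂μ, c ≤ m x)
    (f : Lp F 2 μ) : c * ‖f‖ ^ 2 ≤ inner ℝ (mulL hm f) f := by
  rw [← real_inner_self_eq_norm_sq, L2.inner_def, L2.inner_def, ← integral_const_mul]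
  refine integral_mono_ae ((L2.integrable_inner f f).const_mul c) (L2.integrable_inner _ _) ?_
  filter_upwards [hc, mulL_ae hm f] with x h1 h2
  rw [h2, real_inner_smul_left]
  exact mul_le_mul_of_nonneg_right h1 real_inner_self_nonneg

end Mul

lemma memLp_comp_fst {Ω : Set (Space d)} {m : Space d → ℝ}
    (hm : MemLp m ⊤ (volume.restrict Ω)) (T : ℝ) :
    MemLp (fun z : Space d × ℝ => m z.1) ⊤ (measQ Ω T) := by
  refine ⟨hm.1.comp_quasiMeasurePreserving (quasi_fst Ω T), lt_of_le_of_lt ?_ hm.2⟩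
  rw [eLpNorm_exponent_top, eLpNorm_exponent_top]
  refine essSup_le_of_ae_le _ ?_
  exact (quasi_fst Ω T).ae (ae_le_eLpNormEssSup (f := m))

variable {F : Type*} [NormedAddCommGroup F] [InnerProductSpace ℝ F]

lemma mulL_tens {Ω : Set (Space d)} {T : ℝ} (hT : 0 < T) {m : Space d → ℝ}
    (hm : MemLp m ⊤ (volume.restrict Ω)) (n : ℤ) (f : Lp F 2 (volume.restrict Ω)) :
    mulL (memLp_comp_fst hm T) (tens Ω hT n f) = tens Ω hT n (mulL hm f) := by
  refine Lp.ext ?_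
  filter_upwards [mulL_ae (memLp_comp_fst hm T) (tens Ω hT n f), tens_ae Ω hT n f,
    tens_ae Ω hT n (mulL hm f), (quasi_fst Ω T).ae_eq_comp (mulL_ae hm f)] with z h1 h2 h3 h4
  simp only [Function.comp] at h4
  rw [h1, h2, h3, h4, smul_comm]

lemma coef_mulL [CompleteSpace F] {Ω : Set (Space d)} {T : ℝ} (hT : 0 < T) {m : Space d → ℝ}
    (hm : MemLp m ⊤ (volume.restrict Ω)) (n : ℤ) (u : Lp F 2 (measQ Ω T)) :
    coef Ω hT n (mulL (memLp_comp_fst hm T) u) = mulL hm (coef Ω hT n u) := by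
  refine ext_inner_right ℝ fun f => ?_
  rw [inner_coef_left, inner_mulL_symm, mulL_tens, inner_mulL_symm, inner_coef_left]

/-! ### Lateral test functions -/

lemma IsLateralTest.zero (Ω : Set (Space d)) : IsLateralTest Ω (0 : Space d × ℝ → ℝ) :=
  ⟨contDiff_const, ∅, isCompact_empty, empty_subset _, fun _ _ _ => rfl⟩

lemma IsLateralTest.add {Ω : Set (Space d)} {φ ψ : Space d × ℝ → ℝ} (hφ : IsLateralTest Ω φ)
    (hψ : IsLateralTest Ω ψ) : IsLateralTest Ω (φ + ψ) := by
  obtain ⟨h1, K, hK, hKΩ, hz⟩ := hφ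
  obtain ⟨h2, K', hK', hKΩ', hz'⟩ := hψ
  refine ⟨h1.add h2, K ∪ K', hK.union hK', union_subset hKΩ hKΩ', fun x hx t => ?_⟩
  rw [mem_union, not_or] at hx
  simp [hz x hx.1, hz' x hx.2]

lemma IsLateralTest.const_smul {Ω : Set (Space d)} {φ : Space d × ℝ → ℝ}
    (hφ : IsLateralTest Ω φ) (c : ℝ) : IsLateralTest Ω (c • φ) := by
  obtain ⟨h1, K, hK, hKΩ, hz⟩ := hφ
  exact ⟨h1.const_smul c, K, hK, hKΩ, fun x hx t => by simp [hz x hx]⟩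

lemma IsLateralTest.mul_time {Ω : Set (Space d)} {φ : Space d × ℝ → ℝ}
    (hφ : IsLateralTest Ω φ) {θ : ℝ → ℝ} (hθ : ContDiff ℝ ∞ θ) :
    IsLateralTest Ω (fun z => θ z.2 * φ z) := by
  obtain ⟨h1, K, hK, hKΩ, hz⟩ := hφ
  exact ⟨(hθ.comp contDiff_snd).mul h1, K, hK, hKΩ, fun x hx t => by simp [hz x hx]⟩

lemma isLateralTest_of_space {Ω : Set (Space d)} {w : Space d → ℝ} (hw : ContDiff ℝ ∞ w)
    (hc : HasCompactSupport w) (hs : tsupport w ⊆ Ω) : IsLateralTest Ω (fun z => w z.1) :=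
  ⟨hw.comp contDiff_fst, tsupport w, hc, hs, fun _ hx _ => image_eq_zero_of_notMem_tsupport hx⟩

lemma hasFDerivAt_slice {φ : Space d × ℝ → ℝ} (hφ : ContDiff ℝ ∞ φ) (z : Space d × ℝ) :
    HasFDerivAt (fun x => φ (x, z.2))
      ((fderiv ℝ φ z).comp (ContinuousLinearMap.inl ℝ (Space d) ℝ)) z.1 :=
  ((hφ.differentiable (by simp)) z).hasFDerivAt.comp z.1 (hasFDerivAt_prodMk_left z.1 z.2)

lemma gradX_eq {φ : Space d × ℝ → ℝ} (hφ : ContDiff ℝ ∞ φ) : gradX φ = fun z =>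
    (InnerProductSpace.toDual ℝ (Space d)).symm
      ((fderiv ℝ φ z).comp (ContinuousLinearMap.inl ℝ (Space d) ℝ)) := by
  ext1 z
  rw [gradX, gradient, (hasFDerivAt_slice hφ z).fderiv]

lemma continuous_gradX {φ : Space d × ℝ → ℝ} (hφ : ContDiff ℝ ∞ φ) : Continuous (gradX φ) := by
  rw [gradX_eq hφ]
  exact (LinearIsometryEquiv.continuous _).comp
    ((hφ.continuous_fderiv (by simp)).clm_comp continuous_const)

lemma gradX_add {φ ψ : Space d × ℝ → ℝ} (hφ : ContDiff ℝ ∞ φ) (hψ : ContDiff ℝ ∞ ψ) :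
    gradX (φ + ψ) = gradX φ + gradX ψ := by
  ext1 z
  have h : HasFDerivAt (fun x => (φ + ψ) (x, z.2)) _ z.1 :=
    (hasFDerivAt_slice hφ z).add (hasFDerivAt_slice hψ z)
  simp only [gradX_eq hφ, gradX_eq hψ, Pi.add_apply]
  rw [gradX, gradient, h.fderiv, map_add]

lemma gradX_const_smul {φ : Space d × ℝ → ℝ} (hφ : ContDiff ℝ ∞ φ) (c : ℝ) :
    gradX (c • φ) = c • gradX φ := by
  ext1 z
  have h : HasFDerivAt (fun x => (c • φ) (x, z.2)) _ z.1 := (hasFDerivAt_slice hφ z).const_smul c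
  simp only [gradX_eq hφ, Pi.smul_apply]
  rw [gradX, gradient, h.fderiv]
  simp

lemma gradX_mul_time {φ : Space d × ℝ → ℝ} (hφ : ContDiff ℝ ∞ φ) (θ : ℝ → ℝ) :
    gradX (fun z => θ z.2 * φ z) = fun z => θ z.2 • gradX φ z := by
  ext1 z
  have h : HasFDerivAt (fun x => θ z.2 * φ (x, z.2)) _ z.1 :=
    (hasFDerivAt_slice hφ z).const_mul (θ z.2)
  simp only [gradX_eq hφ]
  rw [gradX, gradient, h.fderiv]
  simp

lemma gradX_eq_zero {φ : Space d × ℝ → ℝ} {K : Set (Space d)} (hK : IsClosed K)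
    (hz : ∀ x, x ∉ K → ∀ t, φ (x, t) = 0) {x : Space d} (hx : x ∉ K) (t : ℝ) :
    gradX φ (x, t) = 0 := by
  have : (fun x => φ (x, t)) =ᶠ[𝓝 x] fun _ => 0 := by
    filter_upwards [hK.isOpen_compl.mem_nhds hx] with y hy using hz y hy t
  rw [gradX, gradient, this.fderiv_eq]
  simp

lemma memLp_of_continuous_of_lateral {E : Type*} [NormedAddCommGroup E]
    {Ω : Set (Space d)} {T : ℝ} [IsFiniteMeasure (volume.restrict Ω)] {f : Space d × ℝ → E}
    [SecondCountableTopologyEither (Space d × ℝ) E]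
    (hf : Continuous f) {K : Set (Space d)} (hK : IsCompact K)
    (hz : ∀ x, x ∉ K → ∀ t, f (x, t) = 0) : MemLp f 2 (measQ Ω T) := by
  obtain ⟨C, hC⟩ := (hK.prod (isCompact_Icc (a := (0 : ℝ)) (b := T))).exists_bound_of_continuousOn
    hf.continuousOn
  refine MemLp.of_bound hf.aestronglyMeasurable (max C 0) ?_
  have : ∀ᵐ z ∂measQ Ω T, z.2 ∈ Ioo 0 T := by
    rw [measQ_eq]
    exact Measure.quasiMeasurePreserving_snd.ae (ae_restrict_mem measurableSet_Ioo)
  filter_upwards [this] with z h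
  by_cases hx : z.1 ∈ K
  · exact (hC z ⟨hx, Ioo_subset_Icc_self h⟩).trans (le_max_left _ _)
  · rw [← Prod.mk.eta (p := z), hz _ hx]; simp

lemma IsLateralTest.memLp {Ω : Set (Space d)} {T : ℝ} [IsFiniteMeasure (volume.restrict Ω)]
    {φ : Space d × ℝ → ℝ} (hφ : IsLateralTest Ω φ) : MemLp φ 2 (measQ Ω T) := by
  obtain ⟨h1, K, hK, -, hz⟩ := hφ
  exact memLp_of_continuous_of_lateral h1.continuous hK hz

lemma IsLateralTest.memLp_gradX {Ω : Set (Space d)} {T : ℝ}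
    [IsFiniteMeasure (volume.restrict Ω)] {φ : Space d × ℝ → ℝ} (hφ : IsLateralTest Ω φ) :
    MemLp (gradX φ) 2 (measQ Ω T) := by
  obtain ⟨h1, K, hK, -, hz⟩ := hφ
  exact memLp_of_continuous_of_lateral (continuous_gradX h1) hK
    fun x hx t => gradX_eq_zero hK.isClosed hz hx t

lemma hasDerivAt_time {φ : Space d × ℝ → ℝ} (hφ : ContDiff ℝ ∞ φ) (z : Space d × ℝ) :
    HasDerivAt (fun t => φ (z.1, t)) (derivT φ z) z.2 := by
  have := HasFDerivAt.comp (f := fun t => (z.1, t)) z.2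
    ((hφ.differentiable (by simp)) z).hasFDerivAt (hasFDerivAt_prodMk_right z.1 z.2)
  exact this.differentiableAt.hasDerivAt

lemma contDiff_derivT {φ : Space d × ℝ → ℝ} (hφ : ContDiff ℝ ∞ φ) :
    ContDiff ℝ ∞ (derivT φ) := by
  have : derivT φ = fun z => fderiv ℝ φ z ((0 : Space d), (1 : ℝ)) := by
    ext1 z
    have := HasFDerivAt.comp (f := fun t => (z.1, t)) z.2
      ((hφ.differentiable (by simp)) z).hasFDerivAt (hasFDerivAt_prodMk_right z.1 z.2)
    have h2 := this.hasDerivAt.deriv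
    simpa [derivT, Function.comp_def] using h2
  rw [this]
  exact (hφ.fderiv_right (m := ∞) (by simp)).clm_apply contDiff_const

lemma IsLateralTest.derivT {Ω : Set (Space d)} {φ : Space d × ℝ → ℝ} (hφ : IsLateralTest Ω φ) :
    IsLateralTest Ω (derivT φ) := by
  obtain ⟨h1, K, hK, hKΩ, hz⟩ := hφ
  refine ⟨contDiff_derivT h1, K, hK, hKΩ, fun x hx t => ?_⟩
  simp [PeriodicControl.derivT, hz x hx]

/-! ### Integration of smooth functions over time -/

lemma hasFDerivAt_time_integral {E G : Type*} [NormedAddCommGroup E] [NormedSpace ℝ E]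
    [ProperSpace E] [NormedAddCommGroup G] [NormedSpace ℝ G] (T : ℝ)
    {f : E × ℝ → G} (hf : ContDiff ℝ 1 f) (x : E) :
    HasFDerivAt (fun x => ∫ t in Ioo 0 T, f (x, t))
      (∫ t in Ioo 0 T, (fderiv ℝ f (x, t)).comp (ContinuousLinearMap.inl ℝ E ℝ)) x := by
  have hc' : Continuous fun z : E × ℝ =>
      (fderiv ℝ f z).comp (ContinuousLinearMap.inl ℝ E ℝ) :=
    (hf.continuous_fderiv one_ne_zero).clm_comp continuous_const
  obtain ⟨C, hC⟩ := ((isCompact_closedBall x 1).prod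
    (isCompact_Icc (a := (0 : ℝ)) (b := T))).exists_bound_of_continuousOn hc'.continuousOn
  refine (hasFDerivAt_integral_of_dominated_of_fderiv_le (μ := volume.restrict (Ioo 0 T))
    (F := fun x t => f (x, t))
    (F' := fun x t => (fderiv ℝ f (x, t)).comp (ContinuousLinearMap.inl ℝ E ℝ))
    (bound := fun _ => C) (Metric.ball_mem_nhds x one_pos) ?_ ?_ ?_ ?_ ?_ ?_)
  · exact Eventually.of_forall fun y =>
      (hf.continuous.comp (by fun_prop : Continuous fun t : ℝ => (y, t))).aestronglyMeasurable
  · exact ((hf.continuous.comp (by fun_prop : Continuous fun t : ℝ => (x, t))).integrableOn_Icc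
      (a := 0) (b := T)).mono_set Ioo_subset_Icc_self
  · exact (hc'.comp (by fun_prop : Continuous fun t : ℝ => (x, t))).aestronglyMeasurable
  · filter_upwards [ae_restrict_mem measurableSet_Ioo] with t ht y hy
    exact hC (y, t) ⟨Metric.ball_subset_closedBall hy, Ioo_subset_Icc_self ht⟩
  · exact integrable_const C
  · refine ae_of_all _ fun t y _ => ?_
    exact ((hf.differentiable one_ne_zero) (y, t)).hasFDerivAt.comp y (hasFDerivAt_prodMk_left y t)

lemma contDiff_time_integral {E : Type} [NormedAddCommGroup E] [NormedSpace ℝ E]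
    [ProperSpace E] (T : ℝ) (n : ℕ) : ∀ {G : Type} [NormedAddCommGroup G] [NormedSpace ℝ G]
    {f : E × ℝ → G} (_ : ContDiff ℝ ∞ f),
    ContDiff ℝ n (fun x => ∫ t in Ioo 0 T, f (x, t)) := by
  induction n with
  | zero =>
    intro G _ _ f hf
    have h : Continuous (fun x => ∫ t in Ioo 0 T, f (x, t)) :=
      continuous_iff_continuousAt.2 fun x =>
        (hasFDerivAt_time_integral T (hf.of_le (by simp)) x).continuousAt
    exact_mod_cast contDiff_zero.2 h
  | succ n ih =>
    intro G _ _ f hf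
    have h1 := fun x => hasFDerivAt_time_integral T (f := f) (hf.of_le (by simp)) x
    push_cast
    rw [contDiff_succ_iff_fderiv]
    refine ⟨fun x => (h1 x).differentiableAt, by simp, ?_⟩
    have : fderiv ℝ (fun x => ∫ t in Ioo 0 T, f (x, t)) = fun x =>
      ∫ t in Ioo 0 T, (fderiv ℝ f (x, t)).comp (ContinuousLinearMap.inl ℝ E ℝ) :=
      funext fun x => (h1 x).fderiv
    rw [this]
    exact ih (f := fun z => (fderiv ℝ f z).comp (ContinuousLinearMap.inl ℝ E ℝ))
      ((hf.fderiv_right (m := ∞) (by simp)).clm_comp contDiff_const)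

lemma IsLateralTest.time_integral {Ω : Set (Space d)} {φ : Space d × ℝ → ℝ}
    (hφ : IsLateralTest Ω φ) (T : ℝ) :
    IsLateralTest Ω (fun z => ∫ t in Ioo 0 T, φ (z.1, t)) := by
  obtain ⟨h1, K, hK, hKΩ, hz⟩ := hφ
  refine ⟨?_, K, hK, hKΩ, fun x hx t => by simp [hz x hx]⟩
  exact ContDiff.comp (g := fun x => ∫ t in Ioo 0 T, φ (x, t))
    (contDiff_infty.2 fun n => contDiff_time_integral T n h1) contDiff_fst

lemma gradX_time_integral {φ : Space d × ℝ → ℝ} (hφ : ContDiff ℝ ∞ φ) (T : ℝ) :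
    gradX (fun z => ∫ t in Ioo 0 T, φ (z.1, t)) = fun z => ∫ t in Ioo 0 T, gradX φ (z.1, t) := by
  ext1 z
  rw [gradX, gradient, (hasFDerivAt_time_integral T (hφ.of_le (by simp)) z.1).fderiv, gradX_eq hφ]
  exact ((InnerProductSpace.toDual ℝ (Space d)).symm.toContinuousLinearEquiv.integral_comp_comm
    (μ := volume.restrict (Ioo 0 T)) _).symm

end PeriodicControl

end

noncomputable section

namespace PeriodicControl

variable {d : ℕ}

/-! ### The space `H^{1,0}_0(Q)` as a closed subspace of `L²(Q) × L²(Q)^d` -/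

/-- The pairs `(φ, ∇φ)` with a lateral test function `φ`. -/
def lateralPairs (Ω : Set (Space d)) [IsFiniteMeasure (volume.restrict Ω)] (T : ℝ) :
    Submodule ℝ (Lp ℝ 2 (measQ Ω T) × Lp (Space d) 2 (measQ Ω T)) where
  carrier := {p | ∃ (φ : Space d × ℝ → ℝ) (hφ : IsLateralTest Ω φ),
    p = (hφ.memLp.toLp φ, hφ.memLp_gradX.toLp (gradX φ))}
  zero_mem' := by
    refine ⟨0, IsLateralTest.zero Ω, ?_⟩
    have h : gradX (0 : Space d × ℝ → ℝ) = 0 := by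
      have := gradX_const_smul (contDiff_const (c := (0 : ℝ)) : ContDiff ℝ ∞
        (fun _ : Space d × ℝ => (0 : ℝ))) 0
      rw [zero_smul, zero_smul] at this
      exact this
    simp only [h]
    rfl
  add_mem' := by
    rintro p q ⟨φ, hφ, rfl⟩ ⟨ψ, hψ, rfl⟩
    refine ⟨φ + ψ, hφ.add hψ, ?_⟩
    simp only [gradX_add hφ.1 hψ.1]
    rfl
  smul_mem' := by
    rintro c p ⟨φ, hφ, rfl⟩
    refine ⟨c • φ, hφ.const_smul c, ?_⟩
    simp only [gradX_const_smul hφ.1]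
    rfl

/-- `H^{1,0}_0(Q)` as the closure of the pairs `(φ, ∇φ)`. -/
def h10 (Ω : Set (Space d)) [IsFiniteMeasure (volume.restrict Ω)] (T : ℝ) :
    Submodule ℝ (Lp ℝ 2 (measQ Ω T) × Lp (Space d) 2 (measQ Ω T)) :=
  (lateralPairs Ω T).topologicalClosure

lemma memLp_top_eT {Ω : Set (Space d)} {T : ℝ} (n : ℤ) (c : ℝ) :
    MemLp (fun z : Space d × ℝ => c * eT T n z.2) ⊤ (measQ Ω T) :=
  memLp_top_of_bound
    ((continuous_eT T n).comp continuous_snd |>.const_smul c).aestronglyMeasurable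
    (|c| * (2 / Real.sqrt T)) (ae_of_all _ fun z => by
      rw [Real.norm_eq_abs, abs_mul]
      exact mul_le_mul_of_nonneg_left (abs_eT_le T n z.2) (abs_nonneg c))

lemma mulL_eT_tens {Ω : Set (Space d)} {T : ℝ} {F : Type*}
    [NormedAddCommGroup F] [InnerProductSpace ℝ F]
    (hT : 0 < T) (n : ℤ) (f : Lp F 2 (volume.restrict Ω)) :
    mulL (memLp_top_eT n (Real.sqrt T)) (tens Ω hT 0 f) = tens Ω hT n f := by
  refine Lp.ext ?_
  filter_upwards [mulL_ae (memLp_top_eT n (Real.sqrt T)) (tens Ω hT 0 f), tens_ae Ω hT 0 f,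
    tens_ae Ω hT n f] with z h1 h2 h3
  rw [h1, h2, h3, eT_zero, smul_smul]
  have : Real.sqrt T ≠ 0 := (Real.sqrt_pos.2 hT).ne'
  congr 1
  field_simp

lemma ae_ae_of_ae_measQ {Ω : Set (Space d)} {T : ℝ} {p : Space d × ℝ → Prop}
    (h : ∀ᵐ z ∂measQ Ω T, p z) :
    ∀ᵐ x ∂(volume.restrict Ω), ∀ᵐ t ∂(volume.restrict (Ioo 0 T)), p (x, t) := by
  rw [measQ_eq] at h
  exact Measure.ae_ae_of_ae_prod h

section

variable {Ω : Set (Space d)} [IsFiniteMeasure (volume.restrict Ω)] {T : ℝ}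

lemma lateral_mem_h10 {φ : Space d × ℝ → ℝ} (hφ : IsLateralTest Ω φ) :
    (hφ.memLp.toLp φ, hφ.memLp_gradX.toLp (gradX φ)) ∈ h10 Ω T :=
  Submodule.le_topologicalClosure _ ⟨φ, hφ, rfl⟩

lemma isClosed_h10 : IsClosed (h10 Ω T).carrier := Submodule.isClosed_topologicalClosure _

lemma toLp_mem_h10_iff {u : Space d × ℝ → ℝ} {g : Space d × ℝ → Space d}
    (hu : MemLp u 2 (measQ Ω T)) (hg : MemLp g 2 (measQ Ω T)) :
    (hu.toLp u, hg.toLp g) ∈ h10 Ω T ↔ IsH10Zero Ω T u g := by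
  constructor
  · intro h
    obtain ⟨x, hx, hlim⟩ := mem_closure_iff_seq_limit.1 h
    choose φ hφ hxφ using hx
    refine ⟨hu, hg, φ, hφ, ?_, ?_⟩
    · have h1 := (continuous_fst.tendsto _).comp hlim
      have h2 := (Lp.tendsto_Lp_iff_tendsto_eLpNorm'' φ (fun n => (hφ n).memLp) u hu).1
        (h1.congr fun n => by simp [hxφ n])
      exact h2.congr fun n => eLpNorm_sub_comm _ _ _ _
    · have h1 := (continuous_snd.tendsto _).comp hlim
      have h2 := (Lp.tendsto_Lp_iff_tendsto_eLpNorm'' (fun n => gradX (φ n))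
        (fun n => (hφ n).memLp_gradX) g hg).1 (h1.congr fun n => by simp [hxφ n])
      exact h2.congr fun n => eLpNorm_sub_comm _ _ _ _
  · rintro ⟨-, -, φ, hφ, h1, h2⟩
    refine mem_closure_iff_seq_limit.2
      ⟨fun n => ((hφ n).memLp.toLp, (hφ n).memLp_gradX.toLp), fun n => ⟨φ n, hφ n, rfl⟩, ?_⟩
    refine Tendsto.prodMk_nhds ?_ ?_
    · exact (Lp.tendsto_Lp_iff_tendsto_eLpNorm'' φ (fun n => (hφ n).memLp) u hu).2
        (h1.congr fun n => eLpNorm_sub_comm _ _ _ _)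
    · exact (Lp.tendsto_Lp_iff_tendsto_eLpNorm'' (fun n => gradX (φ n))
        (fun n => (hφ n).memLp_gradX) g hg).2 (h2.congr fun n => eLpNorm_sub_comm _ _ _ _)

lemma mem_h10_iff {p : Lp ℝ 2 (measQ Ω T) × Lp (Space d) 2 (measQ Ω T)} :
    p ∈ h10 Ω T ↔ IsH10Zero Ω T p.1 p.2 := by
  rw [← toLp_mem_h10_iff (Lp.memLp p.1) (Lp.memLp p.2), Lp.toLp_coeFn, Lp.toLp_coeFn]

/-- `(w, h)` such that `w`, `h`, as functions on `Q` that are constant in time, belong to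
`H^{1,0}_0(Q)`; these are the pairs of `H¹₀(Ω)` functions and their gradients. -/
def h10Space (Ω : Set (Space d)) [IsFiniteMeasure (volume.restrict Ω)] {T : ℝ} (hT : 0 < T) :
    Submodule ℝ (WithLp 2 (Lp ℝ 2 (volume.restrict Ω) × Lp (Space d) 2 (volume.restrict Ω))) :=
  (h10 Ω T).comap (((tens Ω hT 0).toContinuousLinearMap ∘L WithLp.fstL 2 ℝ _ _).prod
    ((tens Ω hT 0).toContinuousLinearMap ∘L WithLp.sndL 2 ℝ _ _)).toLinearMap

lemma mem_h10Space_iff (hT : 0 < T)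
    {p : WithLp 2 (Lp ℝ 2 (volume.restrict Ω) × Lp (Space d) 2 (volume.restrict Ω))} :
    p ∈ h10Space Ω hT ↔ (tens Ω hT 0 p.fst, tens Ω hT 0 p.snd) ∈ h10 Ω T := Iff.rfl

lemma isClosed_h10Space (hT : 0 < T) : IsClosed (h10Space Ω hT).carrier :=
  isClosed_h10.preimage (((tens Ω hT 0).toContinuousLinearMap ∘L WithLp.fstL 2 ℝ _ _).prod
    ((tens Ω hT 0).toContinuousLinearMap ∘L WithLp.sndL 2 ℝ _ _)).continuous

lemma mulL_eT_mem_h10 (n : ℤ) (c : ℝ)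
    {p : Lp ℝ 2 (measQ Ω T) × Lp (Space d) 2 (measQ Ω T)} (hp : p ∈ h10 Ω T) :
    (mulL (memLp_top_eT n c) p.1, mulL (memLp_top_eT n c) p.2) ∈ h10 Ω T := by
  have hcont : Continuous fun p : Lp ℝ 2 (measQ Ω T) × Lp (Space d) 2 (measQ Ω T) =>
    (mulL (memLp_top_eT n c) p.1, mulL (memLp_top_eT n c) p.2) := by fun_prop
  refine hcont.closure_preimage_subset _ (closure_mono ?_ hp)
  rintro p ⟨φ, hφ, rfl⟩
  have hθ : ContDiff ℝ ∞ fun t => c * eT T n t := contDiff_const.mul (contDiff_eT T n)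
  refine ⟨_, hφ.mul_time hθ, ?_⟩
  ext1
  · refine Lp.ext ?_
    filter_upwards [mulL_ae (memLp_top_eT n c) (hφ.memLp.toLp φ),
      hφ.memLp.coeFn_toLp (μ := measQ Ω T),
      (hφ.mul_time hθ).memLp.coeFn_toLp (μ := measQ Ω T)] with z h1 h2 h3
    rw [h1, h2, h3, smul_eq_mul]
  · refine Lp.ext ?_
    filter_upwards [mulL_ae (memLp_top_eT n c) (hφ.memLp_gradX.toLp (gradX φ)),
      hφ.memLp_gradX.coeFn_toLp (μ := measQ Ω T),
      (hφ.mul_time hθ).memLp_gradX.coeFn_toLp (μ := measQ Ω T)] with z h1 h2 h3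
    rw [h1, h2, h3, gradX_mul_time hφ.1 fun t => c * eT T n t]

lemma tens_mem_h10 (hT : 0 < T) (n : ℤ)
    {p : WithLp 2 (Lp ℝ 2 (volume.restrict Ω) × Lp (Space d) 2 (volume.restrict Ω))}
    (hp : p ∈ h10Space Ω hT) : (tens Ω hT n p.fst, tens Ω hT n p.snd) ∈ h10 Ω T := by
  have := mulL_eT_mem_h10 n (Real.sqrt T) ((mem_h10Space_iff hT).1 hp)
  simpa only [mulL_eT_tens] using this

lemma tens_zero_coef_toLp {F : Type*} [NormedAddCommGroup F] [InnerProductSpace ℝ F]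
    [CompleteSpace F] (hT : 0 < T) (n : ℤ) {f : Space d × ℝ → F} (hf : MemLp f 2 (measQ Ω T)) :
    tens Ω hT 0 (coef Ω hT n (hf.toLp f)) =ᵐ[measQ Ω T] fun z =>
      (Real.sqrt T)⁻¹ • ∫ t in Ioo 0 T, eT T n t • f (z.1, t) := by
  have h : ∀ᵐ x ∂(volume.restrict Ω), ∀ᵐ t ∂(volume.restrict (Ioo 0 T)),
      hf.toLp f (x, t) = f (x, t) := ae_ae_of_ae_measQ hf.coeFn_toLp
  filter_upwards [tens_ae Ω hT 0 (coef Ω hT n (hf.toLp f)),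
    (quasi_fst Ω T).ae_eq_comp (coef_ae Ω hT n (hf.toLp f)), (quasi_fst Ω T).ae h] with z h1 h2 h3
  simp only [Function.comp] at h2
  rw [h1, h2, eT_zero]
  congr 1
  refine integral_congr_ae ?_
  filter_upwards [h3] with t ht
  rw [ht]

lemma coef_mem_h10Space (hT : 0 < T) (n : ℤ)
    {p : Lp ℝ 2 (measQ Ω T) × Lp (Space d) 2 (measQ Ω T)} (hp : p ∈ h10 Ω T) :
    WithLp.toLp 2 (coef Ω hT n p.1, coef Ω hT n p.2) ∈ h10Space Ω hT := by
  rw [mem_h10Space_iff]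
  have hcont : Continuous fun p : Lp ℝ 2 (measQ Ω T) × Lp (Space d) 2 (measQ Ω T) =>
    (tens Ω hT 0 (coef Ω hT n p.1), tens Ω hT 0 (coef Ω hT n p.2)) := by fun_prop
  refine hcont.closure_preimage_subset _ (closure_mono ?_ hp)
  rintro p ⟨φ, hφ, rfl⟩
  have h1 := (((hφ.mul_time (contDiff_eT T n)).time_integral T).const_smul (Real.sqrt T)⁻¹)
  refine ⟨_, h1, ?_⟩
  ext1
  · refine Lp.ext ?_
    filter_upwards [tens_zero_coef_toLp hT n (hφ.memLp (T := T)),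
      h1.memLp.coeFn_toLp (μ := measQ Ω T)] with z h2 h3
    rw [h2, h3]
    rfl
  · refine Lp.ext ?_
    filter_upwards [tens_zero_coef_toLp hT n (hφ.memLp_gradX (T := T)),
      h1.memLp_gradX.coeFn_toLp (μ := measQ Ω T)] with z h2 h3
    rw [h2, h3, gradX_const_smul ((hφ.mul_time (contDiff_eT T n)).time_integral T).1,
      gradX_time_integral (hφ.mul_time (contDiff_eT T n)).1, gradX_mul_time hφ.1]
    rfl

end

/-! ### Friedrichs' inequality -/

lemma l2norm_eq_norm {X E : Type*} [MeasurableSpace X] [NormedAddCommGroup E] {μ : Measure X}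
    {f : X → E} (hf : MemLp f 2 μ) : l2norm μ f = ‖hf.toLp f‖ := by
  rw [l2norm, Lp.norm_toLp]

lemma l2norm_sq {X E : Type*} [MeasurableSpace X] [NormedAddCommGroup E] {μ : Measure X}
    {f : X → E} (hf : MemLp f 2 μ) : l2norm μ f ^ 2 = ∫ x, ‖f x‖ ^ 2 ∂μ := by
  rw [l2norm, hf.eLpNorm_eq_integral_rpow_norm (by norm_num) (by norm_num),
    ENNReal.toReal_ofReal (by positivity), ← Real.rpow_natCast, ← Real.rpow_mul]
  · simp
  · positivity

lemma integral_norm_mul_norm_le {X E E' : Type*} [MeasurableSpace X] [NormedAddCommGroup E]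
    [NormedAddCommGroup E'] {μ : Measure X} {f : X → E} {g : X → E'} (hf : MemLp f 2 μ)
    (hg : MemLp g 2 μ) : ∫ x, ‖f x‖ * ‖g x‖ ∂μ ≤ l2norm μ f * l2norm μ g := by
  have h := real_inner_le_norm (hf.norm.toLp _) (hg.norm.toLp _)
  rw [Lp.norm_toLp, Lp.norm_toLp, eLpNorm_norm, eLpNorm_norm, L2.inner_def] at h
  refine le_trans (le_of_eq (integral_congr_ae ?_)) h
  filter_upwards [hf.norm.coeFn_toLp, hg.norm.coeFn_toLp] with x h1 h2
  rw [h1, h2, mul_comm]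
  rfl

lemma memLp_of_hasCompactSupport {E : Type*} [NormedAddCommGroup E] {w : Space d → E}
    (hw : Continuous w) (hc : HasCompactSupport w) (Ω : Set (Space d)) :
    MemLp w 2 (volume.restrict Ω) :=
  (hw.memLp_of_hasCompactSupport hc).mono_measure Measure.restrict_le_self

lemma continuous_gradient {w : Space d → ℝ} (hw : ContDiff ℝ ∞ w) : Continuous (gradient w) :=
  (LinearIsometryEquiv.continuous _).comp (hw.continuous_fderiv (by simp))

lemma hasCompactSupport_gradient {w : Space d → ℝ} (hc : HasCompactSupport w) :
    HasCompactSupport (gradient w) := by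
  refine (hc.fderiv ℝ).mono fun x hx => ?_
  contrapose! hx
  simp only [Function.mem_support, not_not] at hx ⊢
  simp [gradient, hx]

lemma friedrichs_test {Ω : Set (Space d)} [IsFiniteMeasure (volume.restrict Ω)] {T : ℝ} {C : ℝ}
    (hC : IsFriedrichsConstant Ω C) {φ : Space d × ℝ → ℝ} (hφ : IsLateralTest Ω φ) :
    l2norm (measQ Ω T) φ ≤ C * l2norm (measQ Ω T) (gradX φ) := by
  have h1 := hφ.memLp (T := T)
  have h2 := hφ.memLp_gradX (T := T)
  have hn (X : Space d × ℝ → ℝ) : 0 ≤ l2norm (measQ Ω T) X := ENNReal.toReal_nonneg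
  have hg : 0 ≤ l2norm (measQ Ω T) (gradX φ) := ENNReal.toReal_nonneg
  have hs1 := integrable_measQ.1 ((memLp_two_iff_integrable_sq_norm h1.1).1 h1)
  have hs2 := integrable_measQ.1 ((memLp_two_iff_integrable_sq_norm h2.1).1 h2)
  rw [← pow_le_pow_iff_left₀ (hn _) (mul_nonneg hC.1.le hg) two_ne_zero, mul_pow, l2norm_sq h1,
    l2norm_sq h2, measQ_eq, integral_prod_symm _ hs1, integral_prod_symm _ hs2,
    ← integral_const_mul]
  refine integral_mono hs1.integral_prod_right (hs2.integral_prod_right.const_mul _) fun t => ?_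
  obtain ⟨hsm, K, hK, hKΩ, hz⟩ := hφ
  have hw : ContDiff ℝ ∞ fun x => φ (x, t) := hsm.comp (contDiff_id.prodMk contDiff_const)
  have hsupp : tsupport (fun x => φ (x, t)) ⊆ K :=
    closure_minimal (fun x hx => by by_contra h; exact hx (hz x h t)) hK.isClosed
  have hcs : HasCompactSupport fun x => φ (x, t) :=
    hK.of_isClosed_subset (isClosed_tsupport _) hsupp
  have h := hC.2 _ hw hcs (hsupp.trans hKΩ)
  have h' := pow_le_pow_left₀ ENNReal.toReal_nonneg h 2
  rw [mul_pow] at h'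
  erw [l2norm_sq (memLp_of_hasCompactSupport hw.continuous hcs Ω),
    l2norm_sq (memLp_of_hasCompactSupport (continuous_gradient hw)
      (hasCompactSupport_gradient hcs) Ω)] at h'
  exact h'

/-- Friedrichs' inequality in `H^{1,0}_0(Q)`. -/
lemma friedrichs_h10 {Ω : Set (Space d)} [IsFiniteMeasure (volume.restrict Ω)] {T : ℝ} {C : ℝ}
    (hC : IsFriedrichsConstant Ω C)
    {p : Lp ℝ 2 (measQ Ω T) × Lp (Space d) 2 (measQ Ω T)} (hp : p ∈ h10 Ω T) :
    ‖p.1‖ ≤ C * ‖p.2‖ := by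
  have hcl : IsClosed {p : Lp ℝ 2 (measQ Ω T) × Lp (Space d) 2 (measQ Ω T) |
      ‖p.1‖ ≤ C * ‖p.2‖} := isClosed_le (by fun_prop) (by fun_prop)
  refine closure_minimal ?_ hcl hp
  rintro p ⟨φ, hφ, rfl⟩
  have := friedrichs_test (T := T) hC hφ
  rwa [l2norm_eq_norm hφ.memLp, l2norm_eq_norm hφ.memLp_gradX] at this

lemma friedrichs_h10Space {Ω : Set (Space d)} [IsFiniteMeasure (volume.restrict Ω)] {T : ℝ}
    (hT : 0 < T) {C : ℝ} (hC : IsFriedrichsConstant Ω C)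
    {p : WithLp 2 (Lp ℝ 2 (volume.restrict Ω) × Lp (Space d) 2 (volume.restrict Ω))}
    (hp : p ∈ h10Space Ω hT) : ‖p.fst‖ ≤ C * ‖p.snd‖ := by
  have := friedrichs_h10 hC ((mem_h10Space_iff hT).1 hp)
  simpa using this

/-- Bounded open sets have a Friedrichs constant. -/
lemma exists_friedrichs (hd : 1 ≤ d) {Ω : Set (Space d)} (hΩ : IsOpen Ω)
    (hb : Bornology.IsBounded Ω) :
    ∃ C, IsFriedrichsConstant Ω C := by
  obtain ⟨R, hR0, hR⟩ := hb.exists_pos_norm_le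
  refine ⟨2 * R, by positivity, fun w hw hc hs => ?_⟩
  let i : Fin d := ⟨0, hd⟩
  let e : Space d := EuclideanSpace.single i 1
  have he : ‖e‖ = 1 := by simp [e]
  let g : Space d →L[ℝ] ℝ := EuclideanSpace.proj i
  have hge : g e = 1 := by simp [g, e]
  have hw1 : Differentiable ℝ w := hw.differentiable (by simp)
  have hwc := hw.continuous
  have hfc : Continuous fun x => fderiv ℝ w x e := (hw.continuous_fderiv (by simp)).clm_apply
    continuous_const
  have hcw : HasCompactSupport fun x => fderiv ℝ w x e := hc.fderiv_apply ℝ e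
  have hd2 (x : Space d) : fderiv ℝ (fun x => w x ^ 2) x e = 2 * (w x * fderiv ℝ w x e) := by
    rw [((hw1 x).hasFDerivAt.pow 2).fderiv]
    simp; ring
  have hIP : ∫ x, w x ^ 2 * fderiv ℝ g x e = -∫ x, fderiv ℝ (fun x => w x ^ 2) x e * g x := by
    refine integral_mul_fderiv_eq_neg_fderiv_mul_of_integrable ?_ ?_ ?_ ?_ ?_
    · simp only [hd2]
      refine Continuous.integrable_of_hasCompactSupport (by fun_prop) ?_
      exact ((hc.mul_right (f' := fun x => fderiv ℝ w x e)).mul_left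
        (f := fun _ => (2 : ℝ))).mul_right
    · simp only [ContinuousLinearMap.fderiv, hge, mul_one]
      refine Continuous.integrable_of_hasCompactSupport (by fun_prop) ?_
      simp only [sq]; exact hc.mul_right (f' := w)
    · refine Continuous.integrable_of_hasCompactSupport (by fun_prop) ?_
      simp only [sq]; exact (hc.mul_right (f' := w)).mul_right (f' := g)
    · exact fun x _ => (hw1 x).pow 2
    · exact fun x _ => g.differentiableAt
  simp only [ContinuousLinearMap.fderiv, hge, mul_one, hd2] at hIP
  have hw0 : ∀ x, x ∉ Ω → w x = 0 := fun x hx =>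
    image_eq_zero_of_notMem_tsupport fun h => hx (hs h)
  have hm1 := memLp_of_hasCompactSupport hwc hc Ω
  have hm2 := memLp_of_hasCompactSupport (continuous_gradient hw) (hasCompactSupport_gradient hc) Ω
  have hsq : l2norm (volume.restrict Ω) w ^ 2 =
      -∫ x in Ω, 2 * (w x * fderiv ℝ w x e) * g x := by
    rw [l2norm_sq hm1, setIntegral_eq_integral_of_forall_compl_eq_zero,
      setIntegral_eq_integral_of_forall_compl_eq_zero, ← hIP]
    · simp
    · intro x hx; simp [hw0 x hx]
    · intro x hx; simp [hw0 x hx]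
  have hbd : l2norm (volume.restrict Ω) w ^ 2 ≤
      2 * R * (l2norm (volume.restrict Ω) w * l2norm (volume.restrict Ω) (gradient w)) := by
    refine le_trans ?_ (mul_le_mul_of_nonneg_left (integral_norm_mul_norm_le hm1 hm2)
      (by positivity))
    rw [hsq, ← integral_const_mul, ← integral_neg]
    refine integral_mono_ae ?_ ((hm1.norm.integrable_mul hm2.norm).const_mul _) ?_
    · refine (Continuous.integrable_of_hasCompactSupport (by fun_prop) ?_).integrableOn.neg
      exact ((hc.mul_right (f' := fun x => fderiv ℝ w x e)).mul_left
        (f := fun _ => (2 : ℝ))).mul_right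
    · filter_upwards [ae_restrict_mem hΩ.measurableSet] with x hx
      have h1 : |fderiv ℝ w x e| ≤ ‖gradient w x‖ := by
        have := (fderiv ℝ w x).le_opNorm e
        rw [he, mul_one] at this
        simpa [gradient] using this
      have h2 : |g x| ≤ R := (PiLp.norm_apply_le x i).trans (hR x hx)
      calc -(2 * (w x * fderiv ℝ w x e) * g x) ≤ |2 * (w x * fderiv ℝ w x e) * g x| := neg_le_abs _
        _ = 2 * |g x| * (|w x| * |fderiv ℝ w x e|) := by simp only [abs_mul, abs_two]; ring
        _ ≤ 2 * R * (‖w x‖ * ‖gradient w x‖) := by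
          rw [Real.norm_eq_abs]; gcongr
  have hn1 : 0 ≤ l2norm (volume.restrict Ω) w := ENNReal.toReal_nonneg
  have hn2 : 0 ≤ l2norm (volume.restrict Ω) (gradient w) := ENNReal.toReal_nonneg
  rcases hn1.eq_or_lt with h | h
  · rw [← h]; positivity
  · nlinarith

end PeriodicControl

end

noncomputable section

namespace PeriodicControl

/-! ### The elliptic systems for the Fourier modes -/

section Modes

variable {K H G : Type*} [NormedAddCommGroup K] [InnerProductSpace ℝ K]
  [NormedAddCommGroup H] [InnerProductSpace ℝ H] [NormedAddCommGroup G] [InnerProductSpace ℝ G]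

/-- The bilinear form `⟨N D a, D φ⟩ - κ ⟨S ι b, ι φ⟩ + ⟨N D b, D ψ⟩ + κ ⟨S ι a, ι ψ⟩` of a pair of
modes. -/
def pairForm (ι : K →L[ℝ] H) (D : K →L[ℝ] G) (S : H →L[ℝ] H) (N : G →L[ℝ] G) (κ : ℝ) :
    WithLp 2 (K × K) →L[ℝ] WithLp 2 (K × K) →L[ℝ] ℝ :=
  let p := WithLp.fstL 2 ℝ K K
  let q := WithLp.sndL 2 ℝ K K
  (innerSL ℝ).bilinearComp (N ∘L D ∘L p) (D ∘L p)
    - κ • (innerSL ℝ).bilinearComp (S ∘L ι ∘L q) (ι ∘L p)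
    + ((innerSL ℝ).bilinearComp (N ∘L D ∘L q) (D ∘L q)
      + κ • (innerSL ℝ).bilinearComp (S ∘L ι ∘L p) (ι ∘L q))

lemma pairForm_apply (ι : K →L[ℝ] H) (D : K →L[ℝ] G) (S : H →L[ℝ] H) (N : G →L[ℝ] G) (κ : ℝ)
    (x y : WithLp 2 (K × K)) : pairForm ι D S N κ x y =
      inner ℝ (N (D x.fst)) (D y.fst) - κ * inner ℝ (S (ι x.snd)) (ι y.fst) +
      (inner ℝ (N (D x.snd)) (D y.snd) + κ * inner ℝ (S (ι x.fst)) (ι y.snd)) := rfl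

variable {ι : K →L[ℝ] H} {D : K →L[ℝ] G} {S : H →L[ℝ] H} {N : G →L[ℝ] G} {C cN cS : ℝ}

lemma exists_pair [CompleteSpace K] [CompleteSpace H]
    (hnorm : ∀ k, ‖k‖ ^ 2 = ‖ι k‖ ^ 2 + ‖D k‖ ^ 2)
    (hF : ∀ k, ‖ι k‖ ≤ C * ‖D k‖) (hcN : 0 < cN) (hN : ∀ g, cN * ‖g‖ ^ 2 ≤ inner ℝ (N g) g)
    (hS : ∀ h k, inner ℝ (S h) k = inner ℝ h (S k)) (κ : ℝ) (f₁ f₂ : H) :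
    ∃ a b : K, (∀ r, inner ℝ (N (D a)) (D r) - κ * inner ℝ (S (ι b)) (ι r) = inner ℝ f₁ (ι r)) ∧
      ∀ r, inner ℝ (N (D b)) (D r) + κ * inner ℝ (S (ι a)) (ι r) = inner ℝ f₂ (ι r) := by
  have hco : IsCoercive (pairForm ι D S N κ) := by
    refine ⟨cN / (C ^ 2 + 1), by positivity, fun x => ?_⟩
    have hk (k : K) : ‖k‖ ^ 2 ≤ (C ^ 2 + 1) * ‖D k‖ ^ 2 := by
      have := pow_le_pow_left₀ (norm_nonneg _) (hF k) 2
      rw [hnorm]; nlinarith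
    have hc : cN / (C ^ 2 + 1) * ‖x‖ * ‖x‖ = cN / (C ^ 2 + 1) * (‖x.fst‖ ^ 2 + ‖x.snd‖ ^ 2) := by
      rw [mul_assoc, ← sq, WithLp.prod_norm_sq_eq_of_L2]
    have h1 := hN (D x.fst)
    have h2 := hN (D x.snd)
    have h3 : inner ℝ (S (ι x.snd)) (ι x.fst) = inner ℝ (S (ι x.fst)) (ι x.snd) := by
      rw [hS, real_inner_comm]
    rw [hc, pairForm_apply, h3, div_mul_eq_mul_div, div_le_iff₀ (by positivity)]
    have h4 := mul_le_mul_of_nonneg_left (add_le_add (hk x.fst) (hk x.snd)) hcN.le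
    have h5 := mul_le_mul_of_nonneg_left (add_le_add h1 h2) (by positivity : 0 ≤ C ^ 2 + 1)
    linarith
  let p := WithLp.fstL 2 ℝ K K
  let q := WithLp.sndL 2 ℝ K K
  let ℓ : WithLp 2 (K × K) →L[ℝ] ℝ := innerSL ℝ f₁ ∘L ι ∘L p + innerSL ℝ f₂ ∘L ι ∘L q
  let x := hco.continuousLinearEquivOfBilin.symm ((InnerProductSpace.toDual ℝ _).symm ℓ)
  have hx (y : WithLp 2 (K × K)) : pairForm ι D S N κ x y =
      inner ℝ f₁ (ι y.fst) + inner ℝ f₂ (ι y.snd) := by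
    rw [← hco.continuousLinearEquivOfBilin_apply, ContinuousLinearEquiv.apply_symm_apply,
      InnerProductSpace.toDual_symm_apply]
    rfl
  refine ⟨x.fst, x.snd, fun r => ?_, fun r => ?_⟩
  · simpa [pairForm_apply] using hx (WithLp.toLp 2 (r, 0))
  · simpa [pairForm_apply] using hx (WithLp.toLp 2 (0, r))

lemma pair_unique (hnorm : ∀ k, ‖k‖ ^ 2 = ‖ι k‖ ^ 2 + ‖D k‖ ^ 2)
    (hF : ∀ k, ‖ι k‖ ≤ C * ‖D k‖) (hcN : 0 < cN) (hN : ∀ g, cN * ‖g‖ ^ 2 ≤ inner ℝ (N g) g)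
    (hS : ∀ h k, inner ℝ (S h) k = inner ℝ h (S k)) {κ : ℝ} {a b : K}
    (ha : ∀ r, inner ℝ (N (D a)) (D r) - κ * inner ℝ (S (ι b)) (ι r) = 0)
    (hb : ∀ r, inner ℝ (N (D b)) (D r) + κ * inner ℝ (S (ι a)) (ι r) = 0) : a = 0 ∧ b = 0 := by
  have h1 := ha a
  have h2 := hb b
  have h3 : inner ℝ (S (ι b)) (ι a) = inner ℝ (S (ι a)) (ι b) := by rw [hS, real_inner_comm]
  rw [h3] at h1
  have h4 := hN (D a)
  have h5 := hN (D b)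
  have hz (k : K) (hk : ‖D k‖ ^ 2 = 0) : k = 0 := by
    have hk' : ‖D k‖ = 0 := by simpa using hk
    have := hF k
    rw [hk', mul_zero] at this
    have h6 := hnorm k
    rw [le_antisymm this (norm_nonneg _), hk'] at h6
    simpa using h6
  constructor
  · refine hz a (le_antisymm ?_ (sq_nonneg _))
    nlinarith [sq_nonneg ‖D a‖, sq_nonneg ‖D b‖]
  · refine hz b (le_antisymm ?_ (sq_nonneg _))
    nlinarith [sq_nonneg ‖D a‖, sq_nonneg ‖D b‖]

lemma exists_modes [CompleteSpace K] [CompleteSpace H]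
    (hnorm : ∀ k, ‖k‖ ^ 2 = ‖ι k‖ ^ 2 + ‖D k‖ ^ 2)
    (hF : ∀ k, ‖ι k‖ ≤ C * ‖D k‖) (hcN : 0 < cN) (hN : ∀ g, cN * ‖g‖ ^ 2 ≤ inner ℝ (N g) g)
    (hS : ∀ h k, inner ℝ (S h) k = inner ℝ h (S k)) (c : ℝ) (f : ℤ → H) :
    ∃ U : ℤ → K, ∀ n r, inner ℝ (N (D (U n))) (D r) - n * c * inner ℝ (S (ι (U (-n)))) (ι r) =
      inner ℝ (f n) (ι r) := by
  choose a b ha hb using fun n : ℤ => exists_pair hnorm hF hcN hN hS (n * c) (f n) (f (-n))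
  have hab (n : ℤ) : a (-n) = b n := by
    have h := pair_unique (a := a n - b (-n)) (b := b n - a (-n)) (κ := n * c) hnorm hF hcN hN hS
      (fun r => ?_) (fun r => ?_)
    · exact (sub_eq_zero.1 h.2).symm
    · have h1 := ha n r
      have h2 := hb (-n) r
      simp only [map_sub, inner_sub_left]
      push_cast at h2
      rw [neg_neg] at h2
      linarith
    · have h1 := hb n r
      have h2 := ha (-n) r
      simp only [map_sub, inner_sub_left]
      push_cast at h2
      linarith
  refine ⟨a, fun n r => ?_⟩
  rw [hab]
  exact ha n r

lemma add_sq_le_of_le {X Y p q : ℝ} (h : X ^ 2 + Y ^ 2 ≤ p * X + q * Y) :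
    X ^ 2 + Y ^ 2 ≤ p ^ 2 + q ^ 2 := by
  nlinarith [sq_nonneg (X - p), sq_nonneg (Y - q)]

lemma modes_bound_grad (hC : 0 < C)
    (hF : ∀ k, ‖ι k‖ ≤ C * ‖D k‖) (hcN : 0 < cN) (hN : ∀ g, cN * ‖g‖ ^ 2 ≤ inner ℝ (N g) g)
    (hS : ∀ h k, inner ℝ (S h) k = inner ℝ h (S k)) {c : ℝ} {f : ℤ → H} {U : ℤ → K}
    (hU : ∀ n r, inner ℝ (N (D (U n))) (D r) - n * c * inner ℝ (S (ι (U (-n)))) (ι r) =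
      inner ℝ (f n) (ι r)) (n : ℤ) :
    ‖D (U n)‖ ^ 2 ≤ (C / cN) ^ 2 * (‖f n‖ ^ 2 + ‖f (-n)‖ ^ 2) := by
  have h1 := hU n (U n)
  have h2 := hU (-n) (U (-n))
  rw [neg_neg] at h2
  have h3 : inner ℝ (S (ι (U (-n)))) (ι (U n)) = inner ℝ (S (ι (U n))) (ι (U (-n))) := by
    rw [hS, real_inner_comm]
  rw [h3] at h1
  push_cast at h2
  have h4 := hN (D (U n))
  have h5 := hN (D (U (-n)))
  have hb (m : ℤ) : inner ℝ (f m) (ι (U m)) ≤ ‖f m‖ * (C * ‖D (U m)‖) :=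
    (real_inner_le_norm _ _).trans (mul_le_mul_of_nonneg_left (hF _) (norm_nonneg _))
  have h6 : cN * (‖D (U n)‖ ^ 2 + ‖D (U (-n))‖ ^ 2) ≤
      ‖f n‖ * (C * ‖D (U n)‖) + ‖f (-n)‖ * (C * ‖D (U (-n))‖) := by
    linarith [hb n, hb (-n)]
  have h7 := add_sq_le_of_le (X := ‖D (U n)‖) (Y := ‖D (U (-n))‖) (p := C / cN * ‖f n‖)
    (q := C / cN * ‖f (-n)‖) (by
      have : C / cN * ‖f n‖ * ‖D (U n)‖ + C / cN * ‖f (-n)‖ * ‖D (U (-n))‖ =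
        (‖f n‖ * (C * ‖D (U n)‖) + ‖f (-n)‖ * (C * ‖D (U (-n))‖)) / cN := by
        field_simp
      rw [this, le_div_iff₀ hcN]
      linarith)
  rw [mul_add, ← mul_pow, ← mul_pow]
  linarith [sq_nonneg ‖D (U (-n))‖]

lemma modes_bound_deriv (hcS : 0 < cS) (hS' : ∀ h, cS * ‖h‖ ^ 2 ≤ inner ℝ (S h) h)
    (hN : ∀ h k, inner ℝ (N h) k = inner ℝ h (N k)) {c : ℝ} {f : ℤ → H} {U : ℤ → K}
    (hU : ∀ n r, inner ℝ (N (D (U n))) (D r) - n * c * inner ℝ (S (ι (U (-n)))) (ι r) =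
      inner ℝ (f n) (ι r)) (n : ℤ) :
    (n * c) ^ 2 * ‖ι (U n)‖ ^ 2 ≤ (1 / cS) ^ 2 * (‖f n‖ ^ 2 + ‖f (-n)‖ ^ 2) := by
  have h1 := hU n (U (-n))
  have h2 := hU (-n) (U n)
  rw [neg_neg] at h2
  have h3 : inner ℝ (N (D (U (-n)))) (D (U n)) = inner ℝ (N (D (U n))) (D (U (-n))) := by
    rw [hN, real_inner_comm]
  rw [h3] at h2
  push_cast at h2
  have h4 := hS' (ι (U n))
  have h5 := hS' (ι (U (-n)))
  have h6 : n * c * (inner ℝ (S (ι (U n))) (ι (U n)) + inner ℝ (S (ι (U (-n)))) (ι (U (-n)))) =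
      inner ℝ (f (-n)) (ι (U n)) - inner ℝ (f n) (ι (U (-n))) := by linarith
  have h7 : |(n * c : ℝ)| * (cS * (‖ι (U n)‖ ^ 2 + ‖ι (U (-n))‖ ^ 2)) ≤
      ‖f (-n)‖ * ‖ι (U n)‖ + ‖f n‖ * ‖ι (U (-n))‖ := by
    have h8 := congrArg abs h6
    rw [abs_mul] at h8
    refine (mul_le_mul_of_nonneg_left (b := cS * (‖ι (U n)‖ ^ 2 + ‖ι (U (-n))‖ ^ 2))
      (by linarith [le_abs_self (inner ℝ (S (ι (U n))) (ι (U n)) +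
        inner ℝ (S (ι (U (-n)))) (ι (U (-n))))]) (abs_nonneg _)).trans (h8.le.trans ?_)
    refine (abs_sub _ _).trans (add_le_add ?_ ?_)
    · exact abs_real_inner_le_norm _ _
    · exact abs_real_inner_le_norm _ _
  have h9 := add_sq_le_of_le (X := |(n * c : ℝ)| * cS * ‖ι (U n)‖)
    (Y := |(n * c : ℝ)| * cS * ‖ι (U (-n))‖) (p := ‖f (-n)‖) (q := ‖f n‖) (by
      have := mul_le_mul_of_nonneg_left h7 (by positivity : 0 ≤ |(n * c : ℝ)| * cS)
      nlinarith)
  have h10 : (n * c) ^ 2 * ‖ι (U n)‖ ^ 2 = (1 / cS) ^ 2 * (|(n * c : ℝ)| * cS * ‖ι (U n)‖) ^ 2 := by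
    rw [mul_pow (|(n * c : ℝ)| * cS), mul_pow |(n * c : ℝ)|, sq_abs]; field_simp
  rw [h10]
  gcongr
  linarith [sq_nonneg (|(n * c : ℝ)| * cS * ‖ι (U (-n))‖)]

/-- Square summable solutions of the systems for the modes in a closed subspace `V`. -/
lemma exists_modes_summable [CompleteSpace H] [CompleteSpace G]
    {V : Submodule ℝ (WithLp 2 (H × G))} (hV : IsClosed V.carrier) (hC : 0 < C)
    (hF : ∀ p ∈ V, ‖p.fst‖ ≤ C * ‖p.snd‖) (hcN : 0 < cN)
    (hN : ∀ g, cN * ‖g‖ ^ 2 ≤ inner ℝ (N g) g) (hN' : ∀ h k, inner ℝ (N h) k = inner ℝ h (N k))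
    (hcS : 0 < cS) (hS' : ∀ h, cS * ‖h‖ ^ 2 ≤ inner ℝ (S h) h)
    (hS : ∀ h k, inner ℝ (S h) k = inner ℝ h (S k)) {s κ : ℝ} (hs : s ^ 2 = 1) {f : ℤ → H}
    (hf : Summable fun n => ‖f n‖ ^ 2) :
    ∃ (u : ℤ → H) (g : ℤ → G), (∀ n, WithLp.toLp 2 (u n, g n) ∈ V) ∧
      (∀ n q r, WithLp.toLp 2 (q, r) ∈ V →
        inner ℝ (N (g n)) r - n * (s * κ) * inner ℝ (S (u (-n))) q = inner ℝ (f n) q) ∧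
      (Summable fun n => ‖u n‖ ^ 2) ∧ (Summable fun n => ‖g n‖ ^ 2) ∧
      Summable fun n : ℤ => ‖(-(n * κ)) • u (-n)‖ ^ 2 := by
  have : CompleteSpace V := hV.completeSpace_coe
  obtain ⟨u, hu⟩ := exists_modes (K := V) (ι := WithLp.fstL 2 ℝ H G ∘L V.subtypeL)
    (D := WithLp.sndL 2 ℝ H G ∘L V.subtypeL) (C := C)
    (fun k => WithLp.prod_norm_sq_eq_of_L2 (k : WithLp 2 (H × G))) (fun k => hF k k.2)
    hcN hN hS (s * κ) f
  have hbg := modes_bound_grad hC (fun k : V => hF k k.2) hcN hN hS hu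
  have hbd := modes_bound_deriv hcS hS' hN' hu
  have hf' : Summable fun n : ℤ => ‖f (-n)‖ ^ 2 := (Equiv.neg ℤ).summable_iff.2 hf
  have hsG : Summable fun n => ‖(u n).1.snd‖ ^ 2 :=
    Summable.of_nonneg_of_le (fun n => sq_nonneg _) hbg ((hf.add hf').mul_left _)
  have hsW : Summable fun n : ℤ => ‖(n * κ) • (u n).1.fst‖ ^ 2 :=
    Summable.of_nonneg_of_le (fun n => sq_nonneg _) (fun n => by
      have := hbd n
      rw [norm_smul, mul_pow, Real.norm_eq_abs, sq_abs]
      refine le_trans (le_of_eq ?_) this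
      rw [mul_left_comm (n : ℝ), mul_pow s, hs, one_mul]; rfl) ((hf.add hf').mul_left _)
  refine ⟨fun n => (u n).1.fst, fun n => (u n).1.snd, fun n => (u n).2,
    fun n q r hr => hu n ⟨_, hr⟩, ?_, hsG, ?_⟩
  · refine Summable.of_nonneg_of_le (fun n => sq_nonneg _) (fun n => ?_) (hsG.mul_left (C ^ 2))
    have := pow_le_pow_left₀ (norm_nonneg _) (hF _ (u n).2) 2
    rwa [mul_pow] at this
  · refine ((Equiv.neg ℤ).summable_iff.2 hsW).congr fun n => ?_
    simp

end Modes

end PeriodicControl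

end

noncomputable section

namespace PeriodicControl

variable {d : ℕ} {Ω : Set (Space d)} {T : ℝ}

/-! ### Time periodic solutions in `L²(Q)` -/

/-- `W` is the derivative of the time periodic function `U`, in terms of Fourier coefficients. -/
def IsPerDeriv (hT : 0 < T) (U W : Lp ℝ 2 (measQ Ω T)) : Prop :=
  ∀ n : ℤ, coef Ω hT n W = (-(n * freq T)) • coef Ω hT (-n) U

lemma IsPerDeriv.add {hT : 0 < T} {U W Q Z : Lp ℝ 2 (measQ Ω T)} (hU : IsPerDeriv hT U W)
    (hQ : IsPerDeriv hT Q Z) : IsPerDeriv hT (U + Q) (W + Z) := fun n => by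
  rw [map_add, map_add, hU n, hQ n, smul_add]

lemma IsPerDeriv.smul {hT : 0 < T} {U W : Lp ℝ 2 (measQ Ω T)} (hU : IsPerDeriv hT U W) (c : ℝ) :
    IsPerDeriv hT (c • U) (c • W) := fun n => by
  rw [map_smul, map_smul, hU n, smul_comm]

section

variable [IsFiniteMeasure (volume.restrict Ω)] {σ : Space d → ℝ}

lemma inner_mulL_perDeriv_antisymm {hT : 0 < T} (hσ : MemLp σ ⊤ (volume.restrict Ω))
    {U W Q Z : Lp ℝ 2 (measQ Ω T)} (hU : IsPerDeriv hT U W) (hQ : IsPerDeriv hT Q Z) :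
    inner ℝ (mulL (memLp_comp_fst hσ T) W) Q = -inner ℝ (mulL (memLp_comp_fst hσ T) Z) U := by
  have h1 := hasSum_inner_coef Ω hT (mulL (memLp_comp_fst hσ T) W) Q
  have h2 := (Equiv.neg ℤ).hasSum_iff.2
    (hasSum_inner_coef Ω hT (mulL (memLp_comp_fst hσ T) Z) U).neg
  refine h1.unique (h2.congr_fun fun n => ?_)
  simp only [Function.comp, Equiv.neg_apply]
  rw [coef_mulL hT hσ n W, coef_mulL hT hσ (-n) Z, hU n, hQ (-n), neg_neg, map_smul, map_smul,
    real_inner_smul_left, real_inner_smul_left,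
    inner_mulL_symm, real_inner_comm]
  push_cast
  ring

lemma inner_mulL_perDeriv_self {hT : 0 < T} (hσ : MemLp σ ⊤ (volume.restrict Ω))
    {U W : Lp ℝ 2 (measQ Ω T)} (hU : IsPerDeriv hT U W) :
    inner ℝ (mulL (memLp_comp_fst hσ T) W) U = 0 := by
  have := inner_mulL_perDeriv_antisymm hσ hU hU
  linarith

/-- `U`, with spatial gradient `G` and time derivative `W`, is the time periodic weak solution of
`s σ ∂_t U - ∇·(ν ∇U) = f`. -/
structure IsPerSol (hT : 0 < T) {σ ν : Space d → ℝ} (hσ : MemLp σ ⊤ (volume.restrict Ω))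
    (hν : MemLp ν ⊤ (volume.restrict Ω)) (s : ℝ) (f U W : Lp ℝ 2 (measQ Ω T))
    (G : Lp (Space d) 2 (measQ Ω T)) : Prop where
  mem : (U, G) ∈ h10 Ω T
  deriv : IsPerDeriv hT U W
  eq : ∀ q ∈ h10 Ω T, inner ℝ (mulL (memLp_comp_fst hν T) G) q.2 +
    s * inner ℝ (mulL (memLp_comp_fst hσ T) W) q.1 = inner ℝ f q.1

variable {hT : 0 < T} {ν : Space d → ℝ} {hσ : MemLp σ ⊤ (volume.restrict Ω)}
  {hν : MemLp ν ⊤ (volume.restrict Ω)} {s C σlo νlo : ℝ}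

lemma IsPerSol.add {f U W f' U' W' : Lp ℝ 2 (measQ Ω T)} {G G' : Lp (Space d) 2 (measQ Ω T)}
    (h : IsPerSol hT hσ hν s f U W G) (h' : IsPerSol hT hσ hν s f' U' W' G') :
    IsPerSol hT hσ hν s (f + f') (U + U') (W + W') (G + G') where
  mem := (h10 Ω T).add_mem h.mem h'.mem
  deriv := h.deriv.add h'.deriv
  eq q hq := by
    simp only [map_add, inner_add_left]
    linarith [h.eq q hq, h'.eq q hq]

lemma IsPerSol.smul {f U W : Lp ℝ 2 (measQ Ω T)} {G : Lp (Space d) 2 (measQ Ω T)}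
    (h : IsPerSol hT hσ hν s f U W G) (c : ℝ) :
    IsPerSol hT hσ hν s (c • f) (c • U) (c • W) (c • G) where
  mem := (h10 Ω T).smul_mem c h.mem
  deriv := h.deriv.smul c
  eq q hq := by
    simp only [map_smul, real_inner_smul_left]
    rw [← h.eq q hq]
    ring

/-- The energy estimate. -/
lemma IsPerSol.norm_le (hC : IsFriedrichsConstant Ω C) (hνlo : 0 < νlo)
    (hb : ∀ᵐ x ∂(volume.restrict Ω), νlo ≤ ν x) {f U W : Lp ℝ 2 (measQ Ω T)}
    {G : Lp (Space d) 2 (measQ Ω T)} (h : IsPerSol hT hσ hν s f U W G) :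
    ‖U‖ ≤ C ^ 2 / νlo * ‖f‖ := by
  have h1 := h.eq _ h.mem
  simp only [inner_mulL_perDeriv_self hσ h.deriv, mul_zero, add_zero] at h1
  have h2 := le_inner_mulL (memLp_comp_fst hν T) ((quasi_fst Ω T).ae hb) G
  have h3 := friedrichs_h10 hC h.mem
  simp only at h3
  have h4 := real_inner_le_norm f U
  have h5 : νlo * ‖G‖ ≤ C * ‖f‖ := by
    rcases (norm_nonneg G).eq_or_lt with h0 | h0
    · rw [← h0, mul_zero]; exact mul_nonneg hC.1.le (norm_nonneg _)
    · have : ‖f‖ * ‖U‖ ≤ ‖f‖ * (C * ‖G‖) := mul_le_mul_of_nonneg_left h3 (norm_nonneg _)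
      have h6 : νlo * ‖G‖ * ‖G‖ ≤ C * ‖f‖ * ‖G‖ := by nlinarith
      exact le_of_mul_le_mul_right h6 h0
  calc ‖U‖ ≤ C * ‖G‖ := h3
    _ ≤ C * (C * ‖f‖ / νlo) := by
      refine mul_le_mul_of_nonneg_left ?_ hC.1.le
      rw [le_div_iff₀ hνlo]; linarith
    _ = _ := by ring

lemma IsPerSol.unique (hC : IsFriedrichsConstant Ω C) (hνlo : 0 < νlo)
    (hb : ∀ᵐ x ∂(volume.restrict Ω), νlo ≤ ν x) {f U W U' W' : Lp ℝ 2 (measQ Ω T)}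
    {G G' : Lp (Space d) 2 (measQ Ω T)} (h : IsPerSol hT hσ hν s f U W G)
    (h' : IsPerSol hT hσ hν s f U' W' G') : U = U' := by
  have h1 := (h.add (h'.smul (-1))).norm_le hC hνlo hb
  have h2 : f + (-1 : ℝ) • f = 0 := by simp
  rw [h2, norm_zero, mul_zero] at h1
  have h3 := norm_le_zero_iff.1 h1
  simpa [← sub_eq_add_neg, sub_eq_zero] using h3

/-- Existence of time periodic solutions, by solving for the Fourier modes. -/
lemma exists_isPerSol (hT : 0 < T) (hσ : MemLp σ ⊤ (volume.restrict Ω))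
    (hν : MemLp ν ⊤ (volume.restrict Ω)) (hC : IsFriedrichsConstant Ω C) (hσlo : 0 < σlo)
    (hbσ : ∀ᵐ x ∂(volume.restrict Ω), σlo ≤ σ x) (hνlo : 0 < νlo)
    (hbν : ∀ᵐ x ∂(volume.restrict Ω), νlo ≤ ν x) (hs : s ^ 2 = 1) (f : Lp ℝ 2 (measQ Ω T)) :
    ∃ U W G, IsPerSol hT hσ hν s f U W G := by
  have hN (g : Lp (Space d) 2 (volume.restrict Ω)) := le_inner_mulL hν hbν g
  have hN' (g g' : Lp (Space d) 2 (volume.restrict Ω)) := inner_mulL_symm hν g g'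
  have hS (g : Lp ℝ 2 (volume.restrict Ω)) := le_inner_mulL hσ hbσ g
  have hS' (g g' : Lp ℝ 2 (volume.restrict Ω)) := inner_mulL_symm hσ g g'
  have hF := fun p (hp : p ∈ h10Space Ω hT) => friedrichs_h10Space hT hC hp
  obtain ⟨u, g, hm, heq, hsu, hsg, hsw⟩ := exists_modes_summable (isClosed_h10Space hT) hC.1
    hF hνlo hN hN' hσlo hS hS' (κ := freq T) hs (summable_norm_coef_sq Ω hT f)
  obtain ⟨U, hU⟩ := exists_coef_eq Ω hT _ hsu
  obtain ⟨G, hG⟩ := exists_coef_eq Ω hT _ hsg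
  obtain ⟨W, hW⟩ := exists_coef_eq Ω hT _ hsw
  refine ⟨U, W, G, ?_, fun n => by rw [hW, hU], ?_⟩
  · have h1 := (hasSum_tens_coef Ω hT U).prodMk (hasSum_tens_coef Ω hT G)
    refine isClosed_h10.mem_of_tendsto h1 (Eventually.of_forall fun t => ?_)
    refine (h10 Ω T).sum_mem fun n _ => ?_
    rw [hU, hG]
    exact tens_mem_h10 hT n (hm n)
  · intro q hq
    have h1 := (hasSum_inner_coef Ω hT (mulL (memLp_comp_fst hν T) G) q.2).add
      ((hasSum_inner_coef Ω hT (mulL (memLp_comp_fst hσ T) W) q.1).mul_left s)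
    refine h1.unique ((hasSum_inner_coef Ω hT f q.1).congr_fun fun n => ?_)
    have h2 : inner ℝ (mulL hν (g n)) (coef Ω hT n q.2) -
        n * (s * freq T) * inner ℝ (mulL hσ (u (-n))) (coef Ω hT n q.1) =
        inner ℝ (coef Ω hT n f) (coef Ω hT n q.1) := heq n _ _ (coef_mem_h10Space hT n hq)
    rw [coef_mulL hT hν n G, coef_mulL hT hσ n W, hG, hW, map_smul, real_inner_smul_left]
    linarith

end

end PeriodicControl

end

noncomputable section

namespace PeriodicControl

variable {d : ℕ} {Ω : Set (Space d)} {T : ℝ}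

/-! ### Time derivatives and Fourier coefficients -/

lemma inner_toLp {X E : Type*} [MeasurableSpace X] [NormedAddCommGroup E] [InnerProductSpace ℝ E]
    {μ : Measure X} {f g : X → E} (hf : MemLp f 2 μ) (hg : MemLp g 2 μ) :
    inner ℝ (hf.toLp f) (hg.toLp g) = ∫ x, inner ℝ (f x) (g x) ∂μ := by
  rw [L2.inner_def]
  refine integral_congr_ae ?_
  filter_upwards [hf.coeFn_toLp, hg.coeFn_toLp] with x h1 h2
  rw [h1, h2]

lemma tens_toLp {F : Type*} [NormedAddCommGroup F] [InnerProductSpace ℝ F] (hT : 0 < T) (n : ℤ)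
    {f : Space d → F} (hf : MemLp f 2 (volume.restrict Ω)) :
    tens Ω hT n (hf.toLp f) = (memLp_tens hf (continuous_eT T n)).toLp _ := by
  refine Lp.ext ?_
  filter_upwards [tens_ae Ω hT n (hf.toLp f), (quasi_fst Ω T).ae_eq_comp hf.coeFn_toLp,
    (memLp_tens (T := T) hf (continuous_eT T n)).coeFn_toLp] with z h1 h2 h3
  simp only [Function.comp] at h2
  rw [h1, h2, h3]

lemma eq_zero_of_inner_test (hΩ : IsOpen Ω) [IsFiniteMeasure (volume.restrict Ω)]
    (v : Lp ℝ 2 (volume.restrict Ω))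
    (h : ∀ (ψ : Space d → ℝ) (hψ : ContDiff ℝ ∞ ψ) (hc : HasCompactSupport ψ), tsupport ψ ⊆ Ω →
      inner ℝ v ((memLp_of_hasCompactSupport hψ.continuous hc Ω).toLp ψ) = 0) : v = 0 := by
  rw [Lp.eq_zero_iff_ae_eq_zero]
  have hv : Integrable v (volume.restrict Ω) := (Lp.memLp v).integrable one_le_two
  have h0 := hΩ.ae_eq_zero_of_integral_contDiff_smul_eq_zero (μ := volume.restrict Ω) (f := v)
    (hv.locallyIntegrable.locallyIntegrableOn Ω) fun ψ hψ hc hs => by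
      rw [← h ψ hψ hc hs, L2.inner_def]
      refine integral_congr_ae ?_
      filter_upwards [(memLp_of_hasCompactSupport hψ.continuous hc Ω).coeFn_toLp] with x hx
      rw [hx]
      simp
  filter_upwards [h0, ae_restrict_mem hΩ.measurableSet] with x h1 h2 using h1 h2

lemma IsH01Per.isPerDeriv (hΩ : IsOpen Ω) [IsFiniteMeasure (volume.restrict Ω)] (hT : 0 < T)
    {u w : Space d × ℝ → ℝ} (h : IsH01Per Ω T u w) :
    IsPerDeriv hT (h.1.toLp u) (h.2.1.toLp w) := by
  obtain ⟨hu, hw, a, ha, htr⟩ := h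
  intro n
  rw [← sub_eq_zero]
  refine eq_zero_of_inner_test hΩ _ fun ψ hψ hc hs => ?_
  have hL := (isLateralTest_of_space hψ hc hs).mul_time (contDiff_eT T n)
  have h1 := htr _ hL
  have hd : derivT (fun z : Space d × ℝ => eT T n z.2 * ψ z.1) = fun z =>
      n * freq T * (eT T (-n) z.2 * ψ z.1) := by
    ext1 z
    rw [derivT, ((hasDerivAt_eT T n z.2).mul_const (ψ z.1)).deriv]
    ring
  have hm := memLp_of_hasCompactSupport hψ.continuous hc Ω
  simp only [eT_period hT, sub_self, hd] at h1
  rw [inner_sub_left, real_inner_smul_left, inner_coef_left, inner_coef_left, tens_toLp,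
    tens_toLp, inner_toLp, inner_toLp]
  have e1 : ∫ z, u z * (n * freq T * (eT T (-n) z.2 * ψ z.1)) ∂measQ Ω T =
      n * freq T * ∫ z, inner ℝ (u z) (eT T (-n) z.2 • ψ z.1) ∂measQ Ω T := by
    rw [← integral_const_mul]
    refine integral_congr_ae (ae_of_all _ fun z => ?_)
    simp; ring
  have e2 : ∫ z, w z * (eT T n z.2 * ψ z.1) ∂measQ Ω T =
      ∫ z, inner ℝ (w z) (eT T n z.2 • ψ z.1) ∂measQ Ω T := by
    refine integral_congr_ae (ae_of_all _ fun z => ?_)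
    simp; ring
  rw [e1, e2] at h1
  linarith

lemma memLp_slice {φ : Space d × ℝ → ℝ} (hφ : IsLateralTest Ω φ) (t : ℝ) :
    MemLp (fun x => φ (x, t)) 2 (volume.restrict Ω) := by
  obtain ⟨hsm, K, hK, hKΩ, hz⟩ := hφ
  refine memLp_of_hasCompactSupport (hsm.continuous.comp (by fun_prop)) ?_ Ω
  exact HasCompactSupport.intro hK fun x hx => hz x hx t

variable [IsFiniteMeasure (volume.restrict Ω)]

lemma coef_toLp_ae {F : Type*} [NormedAddCommGroup F] [InnerProductSpace ℝ F]
    [CompleteSpace F] (hT : 0 < T) (n : ℤ) {f : Space d × ℝ → F} (hf : MemLp f 2 (measQ Ω T)) :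
    coef Ω hT n (hf.toLp f) =ᵐ[volume.restrict Ω] fun x => ∫ t in Ioo 0 T, eT T n t • f (x, t) := by
  filter_upwards [coef_ae Ω hT n (hf.toLp f), ae_ae_of_ae_measQ hf.coeFn_toLp] with x h1 h2
  rw [h1]
  refine integral_congr_ae ?_
  filter_upwards [h2] with t ht
  rw [ht]

lemma coef_derivT (hT : 0 < T) (n : ℤ) {φ : Space d × ℝ → ℝ} (hφ : IsLateralTest Ω φ) :
    coef Ω hT n (hφ.derivT.memLp.toLp _) + (n * freq T) • coef Ω hT (-n) (hφ.memLp.toLp _) =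
      eT T n 0 • ((memLp_slice hφ T).toLp _ - (memLp_slice hφ 0).toLp _) := by
  refine Lp.ext ?_
  filter_upwards [Lp.coeFn_add (coef Ω hT n (hφ.derivT.memLp.toLp _))
      ((n * freq T) • coef Ω hT (-n) (hφ.memLp.toLp _)),
    Lp.coeFn_smul (n * freq T) (coef Ω hT (-n) (hφ.memLp.toLp _)),
    Lp.coeFn_smul (eT T n 0) ((memLp_slice hφ T).toLp _ - (memLp_slice hφ 0).toLp _),
    Lp.coeFn_sub ((memLp_slice hφ T).toLp _) ((memLp_slice hφ 0).toLp _),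
    coef_toLp_ae hT n hφ.derivT.memLp, coef_toLp_ae hT (-n) hφ.memLp,
    (memLp_slice hφ T).coeFn_toLp, (memLp_slice hφ 0).coeFn_toLp] with x h1 h2 h3 h4 h5 h6 h7 h8
  rw [h1, Pi.add_apply, h2, Pi.smul_apply, h3, Pi.smul_apply, h4, Pi.sub_apply, h5, h6, h7, h8]
  have hc1 : Continuous fun t => eT T n t * derivT φ (x, t) :=
    (continuous_eT T n).mul (hφ.derivT.1.continuous.comp (by fun_prop))
  have hc2 : Continuous fun t => (n * freq T) * (eT T (-n) t * φ (x, t)) :=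
    continuous_const.mul ((continuous_eT T (-n)).mul (hφ.1.continuous.comp (by fun_prop)))
  have key : ∫ t in (0)..T, (eT T n t * derivT φ (x, t) +
      (n * freq T) * (eT T (-n) t * φ (x, t))) = eT T n T * φ (x, T) - eT T n 0 * φ (x, 0) := by
    refine intervalIntegral.integral_eq_sub_of_hasDerivAt
      (f := fun t => eT T n t * φ (x, t)) (fun t _ => ?_) ((hc1.add hc2).intervalIntegrable _ _)
    refine ((hasDerivAt_eT T n t).mul (hasDerivAt_time hφ.1 (x, t))).congr_deriv ?_
    simp only; ring
  rw [intervalIntegral.integral_add (hc1.intervalIntegrable _ _) (hc2.intervalIntegrable _ _),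
    intervalIntegral.integral_const_mul, intervalIntegral.integral_of_le hT.le,
    intervalIntegral.integral_of_le hT.le, integral_Ioc_eq_integral_Ioo,
    integral_Ioc_eq_integral_Ioo, eT_period hT] at key
  simp only [smul_eq_mul]
  linarith

lemma le_sq_mul_sq_add {a y : ℝ} (ha : a ≠ 0) (hy : 0 ≤ y) :
    y ≤ a ^ 2 * y ^ 2 + (1 / a) ^ 2 := by
  have h1 : |a| * |1 / a| = 1 := by rw [← abs_mul, mul_one_div_cancel ha, abs_one]
  have h2 := sq_nonneg (|a| * y - |1 / a|)
  have h3 : (|a| * y - |1 / a|) ^ 2 = a ^ 2 * y ^ 2 + (1 / a) ^ 2 - 2 * (|a| * |1 / a|) * y := by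
    rw [← sq_abs a, ← sq_abs (1 / a)]; ring
  rw [h3, h1] at h2
  linarith

lemma IsPerDeriv.summable_norm_coef {hT : 0 < T} {U W : Lp ℝ 2 (measQ Ω T)}
    (h : IsPerDeriv hT U W) : Summable fun n => ‖coef Ω hT n U‖ := by
  have h1 : Summable fun n : ℤ => ‖coef Ω hT (-n) W‖ ^ 2 :=
    (Equiv.neg ℤ).summable_iff.2 (summable_norm_coef_sq Ω hT W)
  have h2 : Summable fun n : ℤ => (1 / freq T) ^ 2 * (1 / (n : ℝ) ^ 2) :=
    (Real.summable_one_div_int_pow.2 one_lt_two).mul_left _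
  have h3 : Summable fun n : ℤ => if n = 0 then ‖coef Ω hT 0 U‖ else 0 :=
    (hasSum_ite_eq 0 ‖coef Ω hT 0 U‖).summable
  refine Summable.of_nonneg_of_le (fun n => norm_nonneg _) (fun n => ?_) ((h1.add h2).add h3)
  by_cases hn : n = 0
  · subst hn
    simp only [if_pos]
    have : 0 ≤ ‖coef Ω hT (-0) W‖ ^ 2 + (1 / freq T) ^ 2 * (1 / ((0 : ℤ) : ℝ) ^ 2) := by positivity
    linarith
  · rw [if_neg hn, add_zero, h (-n), neg_neg, norm_smul, Real.norm_eq_abs, mul_pow, sq_abs]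
    have hne : (n : ℝ) * freq T ≠ 0 := mul_ne_zero (by exact_mod_cast hn) (freq_pos hT).ne'
    have h4 : (1 / freq T) ^ 2 * (1 / (n : ℝ) ^ 2) = (1 / (n * freq T)) ^ 2 := by
      rw [← one_div_pow, ← mul_pow, one_div_mul_one_div, mul_comm]
    rw [h4]
    push_cast
    rw [neg_mul, neg_neg]
    exact le_sq_mul_sq_add hne (norm_nonneg _)

lemma IsPerDeriv.isH01Per {hT : 0 < T} {U W : Lp ℝ 2 (measQ Ω T)} (h : IsPerDeriv hT U W)
    {u w : Space d × ℝ → ℝ} (hu : U =ᵐ[measQ Ω T] u) (hw : W =ᵐ[measQ Ω T] w) :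
    IsH01Per Ω T u w := by
  have hsum : Summable fun n => eT T n 0 • coef Ω hT n U := by
    refine Summable.of_norm ?_
    refine Summable.of_nonneg_of_le (fun n => norm_nonneg _) (fun n => ?_)
      (h.summable_norm_coef.mul_left (2 / Real.sqrt T))
    rw [norm_smul]
    exact mul_le_mul_of_nonneg_right (abs_eT_le T n 0) (norm_nonneg _)
  obtain ⟨a, ha⟩ := hsum
  refine ⟨(Lp.memLp U).ae_eq hu, (Lp.memLp W).ae_eq hw, a, Lp.memLp a, fun φ hφ => ?_⟩
  have h1 := hasSum_inner_coef Ω hT U (hφ.derivT.memLp.toLp _)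
  have h2 := (Equiv.neg ℤ).hasSum_iff.2 (hasSum_inner_coef Ω hT W (hφ.memLp.toLp _))
  have h3 := ha.mapL (innerSL ℝ ((memLp_slice hφ T).toLp _ - (memLp_slice hφ 0).toLp _))
  have h4 := (h1.add h2).unique (h3.congr_fun fun n => ?_)
  · have e1 : ∫ z, u z * derivT φ z ∂measQ Ω T = inner ℝ U (hφ.derivT.memLp.toLp _) := by
      rw [L2.inner_def]
      refine integral_congr_ae ?_
      filter_upwards [hu, hφ.derivT.memLp.coeFn_toLp (μ := measQ Ω T)] with z h1 h2
      rw [h1, h2]; simp [mul_comm]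
    have e2 : ∫ z, w z * φ z ∂measQ Ω T = inner ℝ W (hφ.memLp.toLp _) := by
      rw [L2.inner_def]
      refine integral_congr_ae ?_
      filter_upwards [hw, hφ.memLp.coeFn_toLp (μ := measQ Ω T)] with z h1 h2
      rw [h1, h2]; simp [mul_comm]
    have e3 (t : ℝ) : ∫ x in Ω, a x * φ (x, t) = inner ℝ ((memLp_slice hφ t).toLp _) a := by
      rw [L2.inner_def]
      refine integral_congr_ae ?_
      filter_upwards [(memLp_slice hφ t).coeFn_toLp] with z h2
      rw [h2]; simp
    rw [e1, e2, e3, e3, h4, innerSL_apply_apply, inner_sub_left]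
  · simp only [Function.comp, Equiv.neg_apply, innerSL_apply_apply]
    rw [real_inner_smul_right, ← real_inner_smul_left, ← coef_derivT hT n hφ, h (-n), neg_neg,
      inner_add_left, real_inner_smul_left, real_inner_smul_left, real_inner_comm]
    rw [real_inner_comm (coef Ω hT (-n) _)]
    push_cast
    ring

end PeriodicControl

end

noncomputable section

namespace PeriodicControl

variable {d : ℕ} {Ω : Set (Space d)} {T : ℝ}

/-! ### The half derivative pairing -/

section

variable [IsFiniteMeasure (volume.restrict Ω)]

lemma coef_eq_cos_sin (hT : 0 < T) {u : Space d × ℝ → ℝ} (hu : MemLp u 2 (measQ Ω T)) (k : ℕ) :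
    ∀ᵐ x ∂(volume.restrict Ω),
      coef Ω hT k (hu.toLp u) x = Real.sqrt T / 2 * (cosCoeff T u k x + sinCoeff T u k x) ∧
      coef Ω hT (-k) (hu.toLp u) x = Real.sqrt T / 2 * (cosCoeff T u k x - sinCoeff T u k x) := by
  have hi := (integrable_measQ.1 (hu.integrable one_le_two)).prod_right_ae
  filter_upwards [coef_toLp_ae hT k hu, coef_toLp_ae hT (-k) hu, hi] with x h1 h2 h3
  have hcos : Integrable (fun t => u (x, t) * Real.cos (k * freq T * t))
      (volume.restrict (Ioo 0 T)) :=
    h3.mul_bdd (c := 1) (by fun_prop : Continuous _).aestronglyMeasurable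
      (ae_of_all _ fun t => by simpa using Real.abs_cos_le_one _)
  have hsin : Integrable (fun t => u (x, t) * Real.sin (k * freq T * t))
      (volume.restrict (Ioo 0 T)) :=
    h3.mul_bdd (c := 1) (by fun_prop : Continuous _).aestronglyMeasurable
      (ae_of_all _ fun t => by simpa using Real.abs_sin_le_one _)
  have hs : Real.sqrt T * Real.sqrt T = T := Real.mul_self_sqrt hT.le
  have hs0 : Real.sqrt T ≠ 0 := (Real.sqrt_pos.2 hT).ne'
  have hc : Real.sqrt T / 2 * (2 / T) = (Real.sqrt T)⁻¹ := by
    field_simp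
    rw [sq, hs]
  constructor
  · rw [h1, cosCoeff, sinCoeff, ← mul_add, ← mul_assoc, hc, ← integral_add hcos hsin,
      ← integral_const_mul]
    refine integral_congr_ae (ae_of_all _ fun t => ?_)
    simp only [eT, smul_eq_mul, Int.cast_natCast]
    field_simp
  · rw [h2, cosCoeff, sinCoeff, ← mul_sub, ← mul_assoc, hc, ← integral_sub hcos hsin,
      ← integral_const_mul]
    refine integral_congr_ae (ae_of_all _ fun t => ?_)
    simp only [eT, smul_eq_mul, Int.cast_neg, Int.cast_natCast, neg_mul, Real.cos_neg,
      Real.sin_neg]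
    field_simp
    ring

lemma integral_coeff_sq (hT : 0 < T) {u : Space d × ℝ → ℝ} (hu : MemLp u 2 (measQ Ω T)) (k : ℕ) :
    ∫ x in Ω, (cosCoeff T u k x ^ 2 + sinCoeff T u k x ^ 2) =
      2 / T * (‖coef Ω hT k (hu.toLp u)‖ ^ 2 + ‖coef Ω hT (-k) (hu.toLp u)‖ ^ 2) := by
  rw [← real_inner_self_eq_norm_sq, ← real_inner_self_eq_norm_sq, L2.inner_def, L2.inner_def,
    ← integral_add (L2.integrable_inner _ _) (L2.integrable_inner _ _), ← integral_const_mul]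
  refine integral_congr_ae ?_
  filter_upwards [coef_eq_cos_sin hT hu k] with x hx
  have hs : Real.sqrt T ^ 2 = T := Real.sq_sqrt hT.le
  rw [real_inner_self_eq_norm_sq, real_inner_self_eq_norm_sq, Real.norm_eq_abs, Real.norm_eq_abs,
    sq_abs, sq_abs, hx.1, hx.2, mul_pow, mul_pow, div_pow, hs]
  field_simp
  ring

lemma IsPerDeriv.hasHalfDeriv {hT : 0 < T} {u : Space d × ℝ → ℝ} (hu : MemLp u 2 (measQ Ω T))
    {W : Lp ℝ 2 (measQ Ω T)} (h : IsPerDeriv hT (hu.toLp u) W) : HasHalfDeriv Ω T u := by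
  have h0 := summable_norm_coef_sq Ω hT W
  have h1 : Summable fun k : ℕ => ‖coef Ω hT (k : ℤ) W‖ ^ 2 := h0.comp_injective Nat.cast_injective
  have h2 : Summable fun k : ℕ => ‖coef Ω hT (-(k : ℤ)) W‖ ^ 2 :=
    h0.comp_injective (neg_injective.comp Nat.cast_injective)
  have hω := freq_pos hT
  refine Summable.of_nonneg_of_le (fun k => ?_) (fun k => ?_)
    ((h1.add h2).mul_left (2 / T / freq T))
  · exact mul_nonneg (by positivity) (integral_nonneg fun x => by positivity)
  · rw [integral_coeff_sq hT hu, h k, h (-k), norm_smul, norm_smul, mul_pow, mul_pow,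
      Real.norm_eq_abs, Real.norm_eq_abs, sq_abs, sq_abs, neg_neg]
    push_cast
    have hk : (k : ℝ) ≤ k ^ 2 := by exact_mod_cast Nat.le_self_pow two_ne_zero k
    have e : 2 / T / freq T * ((-(k * freq T)) ^ 2 * ‖coef Ω hT (-k) (hu.toLp u)‖ ^ 2 +
        (-(-k * freq T)) ^ 2 * ‖coef Ω hT k (hu.toLp u)‖ ^ 2) = k ^ 2 * (freq T * (2 / T *
          (‖coef Ω hT k (hu.toLp u)‖ ^ 2 + ‖coef Ω hT (-k) (hu.toLp u)‖ ^ 2))) := by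
      field_simp
      ring
    rw [e, mul_assoc]
    exact mul_le_mul_of_nonneg_right hk (by positivity)

lemma halfPerp_term (hT : 0 < T) {σ : Space d → ℝ} (hσ : MemLp σ ⊤ (volume.restrict Ω))
    {u q : Space d × ℝ → ℝ} (hu : MemLp u 2 (measQ Ω T)) (hq : MemLp q 2 (measQ Ω T)) (k : ℕ) :
    T / 2 * ∫ x in Ω, σ x * (cosCoeff T u k x * (-sinCoeff T q k x) +
        sinCoeff T u k x * cosCoeff T q k x) =
      inner ℝ (mulL hσ (coef Ω hT k (hu.toLp u))) (coef Ω hT (-k) (hq.toLp q)) -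
        inner ℝ (mulL hσ (coef Ω hT (-k) (hu.toLp u))) (coef Ω hT k (hq.toLp q)) := by
  rw [L2.inner_def, L2.inner_def, ← integral_sub (L2.integrable_inner _ _)
    (L2.integrable_inner _ _), ← integral_const_mul]
  refine integral_congr_ae ?_
  filter_upwards [coef_eq_cos_sin hT hu k, coef_eq_cos_sin hT hq k,
    mulL_ae hσ (coef Ω hT k (hu.toLp u)), mulL_ae hσ (coef Ω hT (-k) (hu.toLp u))]
    with x h1 h2 h3 h4
  have hs : Real.sqrt T ^ 2 = T := Real.sq_sqrt hT.le
  rw [h3, h4, real_inner_smul_left, real_inner_smul_left, h1.1, h1.2, h2.1, h2.2]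
  have e (a b : ℝ) : inner ℝ (Real.sqrt T / 2 * a) (Real.sqrt T / 2 * b) = T / 4 * (a * b) := by
    change Real.sqrt T / 2 * b * (Real.sqrt T / 2 * a) = T / 4 * (a * b)
    linear_combination a * b / 4 * hs
  rw [e, e]
  ring

lemma IsPerDeriv.halfPerp_eq {hT : 0 < T} {σ : Space d → ℝ}
    (hσ : MemLp σ ⊤ (volume.restrict Ω)) {u q : Space d × ℝ → ℝ} (hu : MemLp u 2 (measQ Ω T))
    (hq : MemLp q 2 (measQ Ω T)) {W : Lp ℝ 2 (measQ Ω T)} (h : IsPerDeriv hT (hu.toLp u) W) :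
    halfPerp Ω T σ u q = inner ℝ (mulL (memLp_comp_fst hσ T) W) (hq.toLp q) := by
  have h1 := (hasSum_inner_coef Ω hT (mulL (memLp_comp_fst hσ T) W) (hq.toLp q)).nat_add_neg
  have h0 : coef Ω hT 0 W = 0 := by rw [h 0]; simp
  rw [coef_mulL hT hσ 0 W, h0, map_zero, inner_zero_left, add_zero] at h1
  rw [← h1.tsum_eq, halfPerp, ← tsum_mul_left]
  refine tsum_congr fun k => ?_
  rw [mul_left_comm, halfPerp_term hT hσ hu hq, coef_mulL hT hσ k W, coef_mulL hT hσ (-k) W, h k,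
    h (-k), neg_neg, map_smul, map_smul, real_inner_smul_left, real_inner_smul_left]
  push_cast
  ring

end

lemma halfPerp_antisymm (Ω : Set (Space d)) (T : ℝ) (σ : Space d → ℝ) (u q : Space d × ℝ → ℝ) :
    halfPerp Ω T σ u q = -halfPerp Ω T σ q u := by
  rw [halfPerp, halfPerp, ← mul_neg, ← tsum_neg]
  congr 1
  refine tsum_congr fun k => ?_
  rw [← mul_neg, ← integral_neg]
  congr 1
  refine integral_congr_ae (ae_of_all _ fun x => ?_)
  simp only
  ring

/-! ### Weak solutions -/

namespace H1half

lemma memLp_val (y : H1half Ω T) : MemLp y.val 2 (measQ Ω T) := y.isH10Zero.1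

lemma memLp_grad (y : H1half Ω T) : MemLp y.grad 2 (measQ Ω T) := y.isH10Zero.2.1

/-- The class in `L²(Q)`. -/
def toL2 (y : H1half Ω T) : Lp ℝ 2 (measQ Ω T) := y.memLp_val.toLp y.val

/-- The class of the gradient in `L²(Q)^d`. -/
def gradL2 (y : H1half Ω T) : Lp (Space d) 2 (measQ Ω T) := y.memLp_grad.toLp y.grad

lemma toL2_ae (y : H1half Ω T) : y.toL2 =ᵐ[measQ Ω T] y.val := y.memLp_val.coeFn_toLp

lemma gradL2_ae (y : H1half Ω T) : y.gradL2 =ᵐ[measQ Ω T] y.grad := y.memLp_grad.coeFn_toLp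

lemma mem_h10 [IsFiniteMeasure (volume.restrict Ω)] (y : H1half Ω T) :
    (y.toL2, y.gradL2) ∈ h10 Ω T :=
  (toLp_mem_h10_iff _ _).2 y.isH10Zero

lemma exists_of_isPerDeriv [IsFiniteMeasure (volume.restrict Ω)] {hT : 0 < T}
    {U W : Lp ℝ 2 (measQ Ω T)} {G : Lp (Space d) 2 (measQ Ω T)} (hm : (U, G) ∈ h10 Ω T)
    (h : IsPerDeriv hT U W) : ∃ y : H1half Ω T, y.toL2 = U ∧ y.gradL2 = G := by
  refine ⟨⟨U, G, mem_h10_iff.1 hm, ?_⟩, Lp.toLp_coeFn _ _, Lp.toLp_coeFn _ _⟩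
  refine IsPerDeriv.hasHalfDeriv (hT := hT) (Lp.memLp U) (W := W) ?_
  rwa [Lp.toLp_coeFn]

end H1half

variable [IsFiniteMeasure (volume.restrict Ω)]

/-- `y` is a weak solution, tested in `H^{1,1/2}_{0,per}(Q)`, of `s σ ∂_t y - ∇·(ν ∇y) = f`. -/
def IsWeakSol {ν : Space d → ℝ} (hν : MemLp ν ⊤ (volume.restrict Ω)) (σ : Space d → ℝ) (s : ℝ)
    (f : Lp ℝ 2 (measQ Ω T)) (y : H1half Ω T) : Prop :=
  ∀ q : H1half Ω T, inner ℝ (mulL (memLp_comp_fst hν T) y.gradL2) q.gradL2 +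
    s * halfPerp Ω T σ y.val q.val = inner ℝ f q.toL2

section

variable {hT : 0 < T} {σ ν : Space d → ℝ} {hσ : MemLp σ ⊤ (volume.restrict Ω)}
  {hν : MemLp ν ⊤ (volume.restrict Ω)} {s : ℝ}

lemma IsPerSol.isWeakSol {f W : Lp ℝ 2 (measQ Ω T)} {y : H1half Ω T}
    (h : IsPerSol hT hσ hν s f y.toL2 W y.gradL2) : IsWeakSol hν σ s f y := fun q => by
  rw [h.deriv.halfPerp_eq hσ y.memLp_val q.memLp_val]
  exact h.eq _ q.mem_h10

/-- Duality between a problem and its adjoint. -/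
lemma IsWeakSol.inner_eq {f g Z W : Lp ℝ 2 (measQ Ω T)} {G : Lp (Space d) 2 (measQ Ω T)}
    {y : H1half Ω T} (h : IsWeakSol hν σ s f y) (hz : IsPerSol hT hσ hν (-s) g Z W G) :
    inner ℝ g y.toL2 = inner ℝ f Z := by
  obtain ⟨z, rfl, rfl⟩ := H1half.exists_of_isPerDeriv hz.mem hz.deriv
  have h1 := h z
  have h2 := hz.eq _ y.mem_h10
  rw [halfPerp_antisymm, hz.deriv.halfPerp_eq hσ z.memLp_val y.memLp_val, inner_mulL_symm,
    real_inner_comm] at h1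
  change _ + s * -inner ℝ (mulL (memLp_comp_fst hσ T) W) y.toL2 = _ at h1
  simp only at h2
  linarith

variable {C σlo νlo : ℝ}

/-- Every weak solution has a time derivative in `L²(Q)` and solves the equation against all of
`H^{1,0}_0(Q)`. -/
lemma IsWeakSol.exists_isPerSol (hC : IsFriedrichsConstant Ω C) (hσlo : 0 < σlo)
    (hbσ : ∀ᵐ x ∂(volume.restrict Ω), σlo ≤ σ x) (hνlo : 0 < νlo)
    (hbν : ∀ᵐ x ∂(volume.restrict Ω), νlo ≤ ν x) (hs : s ^ 2 = 1) {f : Lp ℝ 2 (measQ Ω T)}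
    {y : H1half Ω T} (h : IsWeakSol hν σ s f y) :
    ∃ W, IsPerSol hT hσ hν s f y.toL2 W y.gradL2 := by
  obtain ⟨U, W, G, hsol⟩ := PeriodicControl.exists_isPerSol hT hσ hν hC hσlo hbσ hνlo hbν hs f
  obtain ⟨y', rfl, rfl⟩ := H1half.exists_of_isPerDeriv hsol.mem hsol.deriv
  have hval : y.toL2 = y'.toL2 := by
    refine ext_inner_left ℝ fun g => ?_
    obtain ⟨Z, WZ, GZ, hz⟩ := PeriodicControl.exists_isPerSol (s := -s) hT hσ hν hC hσlo hbσ hνlo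
      hbν (by rwa [neg_sq]) g
    rw [h.inner_eq hz, hsol.isWeakSol.inner_eq hz]
  have hmem : (0, y.gradL2 - y'.gradL2) ∈ h10 Ω T := by
    have := (h10 Ω T).sub_mem y.mem_h10 y'.mem_h10
    rwa [Prod.mk_sub_mk, hval, sub_self] at this
  have hgrad : y.gradL2 = y'.gradL2 := by
    have h0 : IsPerDeriv hT (0 : Lp ℝ 2 (measQ Ω T)) 0 := fun n => by simp
    obtain ⟨z, hz, hzg⟩ := H1half.exists_of_isPerDeriv hmem h0
    have h1 := h z
    have h2 := hsol.eq _ z.mem_h10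
    have hz0 : IsPerDeriv hT (z.memLp_val.toLp z.val) 0 := by
      change IsPerDeriv hT z.toL2 0
      rwa [hz]
    rw [halfPerp_antisymm, hz0.halfPerp_eq hσ z.memLp_val y.memLp_val, hz, hzg] at h1
    simp only [map_zero, inner_zero_left, inner_zero_right, neg_zero, mul_zero, add_zero] at h1
    simp only [hz, hzg, inner_zero_right, mul_zero, add_zero] at h2
    have h3 := le_inner_mulL (memLp_comp_fst hν T) ((quasi_fst Ω T).ae hbν) (y.gradL2 - y'.gradL2)
    rw [map_sub, inner_sub_left, h1, h2, sub_zero] at h3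
    have h4 : ‖y.gradL2 - y'.gradL2‖ ^ 2 = 0 :=
      le_antisymm (by nlinarith) (sq_nonneg _)
    simpa [sub_eq_zero] using h4
  exact ⟨W, by rwa [hval, hgrad]⟩

end

end PeriodicControl

end

noncomputable section

namespace PeriodicControl

variable {d : ℕ}

lemma l2norm_eq_of_ae {X E : Type*} [MeasurableSpace X] [NormedAddCommGroup E] {μ : Measure X}
    {F : Lp E 2 μ} {f : X → E} (h : F =ᵐ[μ] f) : l2norm μ f = ‖F‖ := by
  rw [l2norm, Lp.norm_def, eLpNorm_congr_ae h]

/-! ### The control problem in `L²(Q)` -/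

namespace Problem

variable (P : Problem d)

instance : IsFiniteMeasure (volume.restrict P.Ω) :=
  ⟨by simpa using P.isBounded_Ω.measure_lt_top⟩

lemma ae_mem_Ω : ∀ᵐ x ∂(volume.restrict P.Ω), x ∈ P.Ω := ae_restrict_mem P.isOpen_Ω.measurableSet

lemma memLp_σ : MemLp P.σ ⊤ (volume.restrict P.Ω) := by
  refine memLp_top_of_bound P.aemeasurable_σ.aestronglyMeasurable P.σhi ?_
  filter_upwards [P.ae_mem_Ω] with x hx
  rw [Real.norm_eq_abs, abs_of_nonneg (P.σlo_pos.le.trans (P.σ_mem x hx).1)]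
  exact (P.σ_mem x hx).2

lemma memLp_ν : MemLp P.ν ⊤ (volume.restrict P.Ω) := by
  refine memLp_top_of_bound P.aemeasurable_ν.aestronglyMeasurable P.νhi ?_
  filter_upwards [P.ae_mem_Ω] with x hx
  rw [Real.norm_eq_abs, abs_of_nonneg (P.νlo_pos.le.trans (P.ν_mem x hx).1)]
  exact (P.ν_mem x hx).2

lemma ae_σlo_le : ∀ᵐ x ∂(volume.restrict P.Ω), P.σlo ≤ P.σ x := by
  filter_upwards [P.ae_mem_Ω] with x hx using (P.σ_mem x hx).1

lemma ae_νlo_le : ∀ᵐ x ∂(volume.restrict P.Ω), P.νlo ≤ P.ν x := by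
  filter_upwards [P.ae_mem_Ω] with x hx using (P.ν_mem x hx).1

/-- Multiplication by `σ` in `L²(Q)`. -/
abbrev mulσ : Lp ℝ 2 (measQ P.Ω P.T) →L[ℝ] Lp ℝ 2 (measQ P.Ω P.T) :=
  mulL (memLp_comp_fst P.memLp_σ P.T)

/-- Multiplication by `ν` in `L²(Q)^d`. -/
abbrev mulν : Lp (Space d) 2 (measQ P.Ω P.T) →L[ℝ] Lp (Space d) 2 (measQ P.Ω P.T) :=
  mulL (memLp_comp_fst P.memLp_ν P.T)

/-- The desired state in `L²(Q)`. -/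
def ydL2 : Lp ℝ 2 (measQ P.Ω P.T) := P.memLp_yd.toLp P.yd

lemma ydL2_ae : P.ydL2 =ᵐ[measQ P.Ω P.T] P.yd := P.memLp_yd.coeFn_toLp

/-- Time periodic solutions of `s σ ∂_t U - ∇·(ν ∇U) = f`. -/
abbrev IsSol (s : ℝ) (f U W : Lp ℝ 2 (measQ P.Ω P.T)) (G : Lp (Space d) 2 (measQ P.Ω P.T)) :
    Prop :=
  IsPerSol P.T_pos P.memLp_σ P.memLp_ν s f U W G

variable {P}

lemma exists_isSol {C : ℝ} (hC : IsFriedrichsConstant P.Ω C) {s : ℝ} (hs : s ^ 2 = 1)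
    (f : Lp ℝ 2 (measQ P.Ω P.T)) : ∃ U W G, P.IsSol s f U W G :=
  PeriodicControl.exists_isPerSol P.T_pos P.memLp_σ P.memLp_ν hC P.σlo_pos P.ae_σlo_le P.νlo_pos
    P.ae_νlo_le hs f

lemma IsSol.unique {C : ℝ} (hC : IsFriedrichsConstant P.Ω C) {s : ℝ}
    {f U W U' W' : Lp ℝ 2 (measQ P.Ω P.T)} {G G' : Lp (Space d) 2 (measQ P.Ω P.T)}
    (h : P.IsSol s f U W G) (h' : P.IsSol s f U' W' G') : U = U' :=
  IsPerSol.unique hC P.νlo_pos P.ae_νlo_le h h'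

lemma isWeakSol_iff {C : ℝ} (hC : IsFriedrichsConstant P.Ω C) {s : ℝ} (hs : s ^ 2 = 1)
    {f : Lp ℝ 2 (measQ P.Ω P.T)} {y : P.StateSpace} :
    IsWeakSol P.memLp_ν P.σ s f y ↔ ∃ W, P.IsSol s f y.toL2 W y.gradL2 :=
  ⟨fun h => h.exists_isPerSol hC P.σlo_pos P.ae_σlo_le P.νlo_pos P.ae_νlo_le hs,
    fun ⟨_, h⟩ => h.isWeakSol⟩

lemma integral_ν_grad (y q : P.StateSpace) :
    ∫ z, P.ν z.1 * inner ℝ (y.grad z) (q.grad z) ∂P.μ = inner ℝ (P.mulν y.gradL2) q.gradL2 := by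
  rw [inner_mulL]
  refine integral_congr_ae ?_
  filter_upwards [y.gradL2_ae, q.gradL2_ae] with z h1 h2
  rw [h1, h2]

lemma integrable_ν_grad (y q : P.StateSpace) :
    Integrable (fun z => P.ν z.1 * inner ℝ (y.grad z) (q.grad z)) P.μ := by
  refine (L2.integrable_inner (𝕜 := ℝ) (P.mulν y.gradL2) q.gradL2).congr ?_
  filter_upwards [y.gradL2_ae, q.gradL2_ae, mulL_ae (memLp_comp_fst P.memLp_ν P.T) y.gradL2]
    with z h1 h2 h3
  rw [h3, h1, h2, real_inner_smul_left]

lemma integral_mul_val {f : Lp ℝ 2 (measQ P.Ω P.T)} {v : Space d × ℝ → ℝ}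
    (hv : f =ᵐ[measQ P.Ω P.T] v) (q : P.StateSpace) :
    ∫ z, v z * q.val z ∂P.μ = inner ℝ f q.toL2 := by
  rw [L2.inner_def]
  refine integral_congr_ae ?_
  filter_upwards [hv, q.toL2_ae] with z h1 h2
  rw [h1, h2]
  simp [mul_comm]

lemma integrable_mul_val {f : Lp ℝ 2 (measQ P.Ω P.T)} {v : Space d × ℝ → ℝ}
    (hv : f =ᵐ[measQ P.Ω P.T] v) (q : P.StateSpace) :
    Integrable (fun z => v z * q.val z) P.μ := by
  refine (L2.integrable_inner (𝕜 := ℝ) f q.toL2).congr ?_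
  filter_upwards [hv, q.toL2_ae] with z h1 h2
  rw [h1, h2]
  simp [mul_comm]

lemma isState_iff {C : ℝ} (hC : IsFriedrichsConstant P.Ω C) {v : Space d × ℝ → ℝ}
    {f : Lp ℝ 2 (measQ P.Ω P.T)} (hv : f =ᵐ[measQ P.Ω P.T] v) {y : P.StateSpace} :
    P.IsState v y ↔ ∃ W, P.IsSol 1 f y.toL2 W y.gradL2 := by
  rw [← isWeakSol_iff hC (one_pow 2)]
  refine forall_congr' fun q => ?_
  rw [integral_ν_grad, integral_mul_val hv, one_mul]

lemma isAdjoint_iff {C : ℝ} (hC : IsFriedrichsConstant P.Ω C) {y p : P.StateSpace} :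
    P.IsAdjoint y p ↔ ∃ W, P.IsSol (-1) (y.toL2 - P.ydL2) p.toL2 W p.gradL2 := by
  rw [← isWeakSol_iff hC (by norm_num)]
  refine forall_congr' fun q => ?_
  rw [integral_sub (integrable_mul_val y.toL2_ae q) (integrable_ν_grad p q), integral_ν_grad,
    integral_mul_val P.ydL2_ae, integral_mul_val y.toL2_ae, inner_sub_left]
  constructor <;> intro h <;> linarith

lemma isOptimalitySystem_iff {C : ℝ} (hC : IsFriedrichsConstant P.Ω C) {y p : P.StateSpace} :
    P.IsOptimalitySystem y p ↔ (∃ W, P.IsSol (-1) (y.toL2 - P.ydL2) p.toL2 W p.gradL2) ∧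
      ∃ W, P.IsSol 1 (-P.lam⁻¹ • p.toL2) y.toL2 W y.gradL2 := by
  rw [IsOptimalitySystem, isAdjoint_iff hC, ← isWeakSol_iff (s := 1) hC (one_pow 2)]
  refine and_congr_right fun _ => forall_congr' fun q => ?_
  rw [integral_add (integrable_ν_grad y q) ((integrable_mul_val p.toL2_ae q).const_mul _),
    integral_const_mul, integral_ν_grad, integral_mul_val p.toL2_ae, real_inner_smul_left, one_mul]
  constructor <;> intro h <;> linarith

/-! ### Optimality -/

/-- The cost functional in `L²(Q)`. -/
def costL2 (P : Problem d) (Y f : Lp ℝ 2 (measQ P.Ω P.T)) : ℝ :=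
  1 / 2 * ‖Y - P.ydL2‖ ^ 2 + P.lam / 2 * ‖f‖ ^ 2

lemma cost_eq {f : Lp ℝ 2 (measQ P.Ω P.T)} {v : Space d × ℝ → ℝ}
    (hv : f =ᵐ[measQ P.Ω P.T] v) (y : P.StateSpace) :
    P.cost y.val v = P.costL2 y.toL2 f := by
  rw [cost, costL2, μ, l2norm_eq_of_ae hv,
    l2norm_eq_of_ae ((Lp.coeFn_sub _ _).trans (y.toL2_ae.sub P.ydL2_ae))]

lemma inner_adjoint {g f Y W p Wp : Lp ℝ 2 (measQ P.Ω P.T)}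
    {G Gp : Lp (Space d) 2 (measQ P.Ω P.T)} (h : P.IsSol 1 f Y W G)
    (hp : P.IsSol (-1) g p Wp Gp) : inner ℝ g Y = inner ℝ f p := by
  have h1 := h.eq _ hp.mem
  have h2 := hp.eq _ h.mem
  have h3 := inner_mulL_perDeriv_antisymm P.memLp_σ h.deriv hp.deriv
  simp only at h1 h2
  rw [inner_mulL_symm, real_inner_comm] at h1
  linarith

lemma costL2_eq {u Y W p Wp v Yv Wv : Lp ℝ 2 (measQ P.Ω P.T)}
    {G Gp Gv : Lp (Space d) 2 (measQ P.Ω P.T)} (h : P.IsSol 1 u Y W G)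
    (hp : P.IsSol (-1) (Y - P.ydL2) p Wp Gp) (hu : u = -P.lam⁻¹ • p) (hv : P.IsSol 1 v Yv Wv Gv) :
    P.costL2 Yv v = P.costL2 Y u + (1 / 2 * ‖Y - Yv‖ ^ 2 + P.lam / 2 * ‖u - v‖ ^ 2) := by
  have h1 := inner_adjoint h hp
  have h2 := inner_adjoint hv hp
  have hl : p = -P.lam • u := by
    rw [hu, smul_smul, neg_mul_neg, mul_inv_cancel₀ P.lam_pos.ne', one_smul]
  rw [hl, real_inner_smul_right] at h1 h2
  have h3 : Yv - P.ydL2 = (Y - P.ydL2) - (Y - Yv) := by abel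
  rw [costL2, costL2, h3, norm_sub_sq_real (Y - P.ydL2), inner_sub_right, h1, h2,
    norm_sub_sq_real u v, real_inner_self_eq_norm_sq, real_inner_comm u v]
  ring

lemma eq_zero_of_forall_nonneg {a c : ℝ} (hc : 0 ≤ c) (h : ∀ t : ℝ, 0 ≤ t * a + t ^ 2 * c) :
    a = 0 := by
  have h1 := h (-a / (c + 1))
  have h2 : -a / (c + 1) * a + (-a / (c + 1)) ^ 2 * c = -(a / (c + 1)) ^ 2 := by
    have : c + 1 ≠ 0 := by positivity
    field_simp
    ring
  rw [h2] at h1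
  have h3 : a / (c + 1) = 0 := by
    have := sq_nonneg (a / (c + 1))
    exact pow_eq_zero_iff two_ne_zero |>.1 (by linarith)
  rcases div_eq_zero_iff.1 h3 with h4 | h4
  · exact h4
  · linarith

/-- First order optimality condition. -/
lemma eq_of_minimal {C : ℝ} (hC : IsFriedrichsConstant P.Ω C)
    {u Y W p Wp : Lp ℝ 2 (measQ P.Ω P.T)}
    {G Gp : Lp (Space d) 2 (measQ P.Ω P.T)} (h : P.IsSol 1 u Y W G)
    (hp : P.IsSol (-1) (Y - P.ydL2) p Wp Gp)
    (hmin : ∀ v Yv Wv Gv, P.IsSol 1 v Yv Wv Gv → P.costL2 Y u ≤ P.costL2 Yv v) :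
    u = -P.lam⁻¹ • p := by
  obtain ⟨Z, WZ, GZ, hZ⟩ := exists_isSol hC (one_pow 2) (p + P.lam • u)
  have h1 := inner_adjoint hZ hp
  have h2 : ‖p + P.lam • u‖ ^ 2 = 0 := by
    refine eq_zero_of_forall_nonneg
      (c := 1 / 2 * ‖Z‖ ^ 2 + P.lam / 2 * ‖p + P.lam • u‖ ^ 2)
      (add_nonneg (by positivity) (mul_nonneg (by linarith [P.lam_pos]) (sq_nonneg _))) fun t => ?_
    have h3 := hmin _ _ _ _ (h.add (hZ.smul t))
    have h4 : Y + t • Z - P.ydL2 = (Y - P.ydL2) + t • Z := by abel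
    rw [costL2, costL2, h4, norm_add_sq_real (Y - P.ydL2), norm_add_sq_real u,
      real_inner_smul_right, real_inner_smul_right, h1, norm_smul, norm_smul, mul_pow, mul_pow,
      Real.norm_eq_abs, sq_abs] at h3
    have h5 : ‖p + P.lam • u‖ ^ 2 = inner ℝ (p + P.lam • u) p +
        P.lam * inner ℝ u (p + P.lam • u) := by
      rw [← real_inner_self_eq_norm_sq]
      nth_rewrite 2 [add_comm]
      rw [inner_add_right, real_inner_smul_right, real_inner_comm u, add_comm]
    nth_rewrite 1 [h5]
    linarith
  have h3 : p = -(P.lam • u) := by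
    rw [← add_eq_zero_iff_eq_neg]
    simpa using h2
  rw [h3, smul_neg, neg_smul, neg_neg, smul_smul, inv_mul_cancel₀ P.lam_pos.ne', one_smul]

/-- The control-to-state map. -/
lemma exists_solutionOperator {C : ℝ} (hC : IsFriedrichsConstant P.Ω C) :
    ∃ S : Lp ℝ 2 (measQ P.Ω P.T) →L[ℝ] Lp ℝ 2 (measQ P.Ω P.T),
      ∀ f, ∃ W G, P.IsSol 1 f (S f) W G := by
  choose S W G h using fun f : Lp ℝ 2 (measQ P.Ω P.T) => exists_isSol hC (one_pow 2) f
  refine ⟨LinearMap.mkContinuous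
    { toFun := S
      map_add' := fun f g => IsSol.unique hC (h (f + g)) ((h f).add (h g))
      map_smul' := fun c f => IsSol.unique hC (h (c • f)) ((h f).smul c) } (C ^ 2 / P.νlo)
    fun f => (h f).norm_le hC P.νlo_pos P.ae_νlo_le, fun f => ⟨W f, G f, h f⟩⟩

/-- Existence of a solution of the optimality system. -/
lemma exists_optimal {C : ℝ} (hC : IsFriedrichsConstant P.Ω C) :
    ∃ Y W p Wp : Lp ℝ 2 (measQ P.Ω P.T), ∃ G Gp : Lp (Space d) 2 (measQ P.Ω P.T),
      P.IsSol 1 (-P.lam⁻¹ • p) Y W G ∧ P.IsSol (-1) (Y - P.ydL2) p Wp Gp := by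
  obtain ⟨S, hS⟩ := exists_solutionOperator hC
  let B : Lp ℝ 2 (measQ P.Ω P.T) →L[ℝ] Lp ℝ 2 (measQ P.Ω P.T) →L[ℝ] ℝ :=
    (innerSL ℝ).bilinearComp S S + P.lam • innerSL ℝ
  have hB (u w : Lp ℝ 2 (measQ P.Ω P.T)) : B u w = inner ℝ (S u) (S w) + P.lam * inner ℝ u w := rfl
  have hco : IsCoercive B := ⟨P.lam, P.lam_pos, fun u => by
    rw [hB, real_inner_self_eq_norm_mul_norm, real_inner_self_eq_norm_mul_norm]
    nlinarith [mul_self_nonneg ‖S u‖]⟩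
  let u := hco.continuousLinearEquivOfBilin.symm (ContinuousLinearMap.adjoint S P.ydL2)
  have hu (w : Lp ℝ 2 (measQ P.Ω P.T)) :
      inner ℝ (S u) (S w) + P.lam * inner ℝ u w = inner ℝ P.ydL2 (S w) := by
    rw [← hB, ← hco.continuousLinearEquivOfBilin_apply, ContinuousLinearEquiv.apply_symm_apply,
      ContinuousLinearMap.adjoint_inner_left]
  obtain ⟨W, G, hY⟩ := hS u
  obtain ⟨p, Wp, Gp, hp⟩ := exists_isSol (s := -1) hC (by norm_num) (S u - P.ydL2)
  have hup : u = -P.lam⁻¹ • p := by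
    have h0 : p = -P.lam • u := by
      refine ext_inner_left ℝ fun w => ?_
      obtain ⟨Ww, Gw, hw⟩ := hS w
      have h1 := inner_adjoint hw hp
      have h2 := hu w
      rw [inner_sub_left] at h1
      rw [real_inner_smul_right, real_inner_comm u w]
      linarith
    rw [h0, smul_smul, neg_mul_neg, inv_mul_cancel₀ P.lam_pos.ne', one_smul]
  exact ⟨S u, W, p, Wp, G, Gp, hup ▸ hY, hp⟩

lemma exists_state {C : ℝ} (hC : IsFriedrichsConstant P.Ω C) {v : Space d × ℝ → ℝ}
    (hv : MemLp v 2 P.μ) : ∃ y : P.StateSpace, P.IsState v y ∧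
      ∀ y' : P.StateSpace, P.IsState v y' → y'.val =ᵐ[P.μ] y.val := by
  have hf : hv.toLp v =ᵐ[measQ P.Ω P.T] v := hv.coeFn_toLp
  obtain ⟨U, W, G, h⟩ := exists_isSol hC (one_pow 2) (hv.toLp v)
  obtain ⟨y, rfl, rfl⟩ := H1half.exists_of_isPerDeriv h.mem h.deriv
  refine ⟨y, (isState_iff hC hf).2 ⟨W, h⟩, fun y' h' => ?_⟩
  obtain ⟨W', h'⟩ := (isState_iff hC hf).1 h'
  have := IsSol.unique hC h' h
  exact (y'.toL2_ae.symm.trans (by rw [this])).trans y.toL2_ae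

lemma exists_adjoint {C : ℝ} (hC : IsFriedrichsConstant P.Ω C) (y : P.StateSpace) :
    ∃ p : P.StateSpace, P.IsAdjoint y p := by
  obtain ⟨U, W, G, h⟩ := exists_isSol (s := -1) hC (by norm_num) (y.toL2 - P.ydL2)
  obtain ⟨p, rfl, rfl⟩ := H1half.exists_of_isPerDeriv h.mem h.deriv
  exact ⟨p, (isAdjoint_iff hC).2 ⟨W, h⟩⟩

lemma adjoint_unique {C : ℝ} (hC : IsFriedrichsConstant P.Ω C) {y p p' : P.StateSpace}
    (h : P.IsAdjoint y p) (h' : P.IsAdjoint y p') : p'.val =ᵐ[P.μ] p.val := by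
  obtain ⟨W, h⟩ := (isAdjoint_iff hC).1 h
  obtain ⟨W', h'⟩ := (isAdjoint_iff hC).1 h'
  have := IsSol.unique hC h' h
  exact (p'.toL2_ae.symm.trans (by rw [this])).trans p.toL2_ae

lemma smul_toL2_ae (p : P.StateSpace) :
    (-P.lam⁻¹ • p.toL2 : Lp ℝ 2 (measQ P.Ω P.T)) =ᵐ[measQ P.Ω P.T]
      fun z => -P.lam⁻¹ * p.val z := by
  filter_upwards [Lp.coeFn_smul (-P.lam⁻¹) p.toL2, p.toL2_ae] with z h1 h2
  rw [h1, Pi.smul_apply, h2, smul_eq_mul]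

lemma isOptimal_isAdjoint_iff {C : ℝ} (hC : IsFriedrichsConstant P.Ω C) {u : Space d × ℝ → ℝ}
    {y p : P.StateSpace} : (P.IsOptimal u y ∧ P.IsAdjoint y p) ↔
      (P.IsOptimalitySystem y p ∧ u =ᵐ[P.μ] fun z => -P.lam⁻¹ * p.val z) := by
  rw [isOptimalitySystem_iff hC, isAdjoint_iff hC]
  constructor
  · rintro ⟨⟨hu, hy, hmin⟩, Wp, hp⟩
    have hf : hu.toLp u =ᵐ[measQ P.Ω P.T] u := hu.coeFn_toLp
    obtain ⟨W, hY⟩ := (isState_iff hC hf).1 hy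
    have hup : hu.toLp u = -P.lam⁻¹ • p.toL2 := by
      refine eq_of_minimal hC hY hp fun v Yv Wv Gv hv => ?_
      obtain ⟨yv, rfl, rfl⟩ := H1half.exists_of_isPerDeriv hv.mem hv.deriv
      have := hmin v yv (Lp.memLp v) ((isState_iff hC EventuallyEq.rfl).2 ⟨Wv, hv⟩)
      rwa [cost_eq hf, cost_eq EventuallyEq.rfl] at this
    refine ⟨⟨⟨Wp, hp⟩, W, hup ▸ hY⟩, ?_⟩
    have h2 := smul_toL2_ae p
    rw [← hup] at h2
    exact hf.symm.trans h2
  · rintro ⟨⟨⟨Wp, hp⟩, W, hY⟩, hu⟩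
    have hf : (-P.lam⁻¹ • p.toL2 : Lp ℝ 2 (measQ P.Ω P.T)) =ᵐ[measQ P.Ω P.T] u :=
      (smul_toL2_ae p).trans hu.symm
    refine ⟨⟨(Lp.memLp _).ae_eq hf, (isState_iff hC hf).2 ⟨W, hY⟩, fun v yv hv hyv => ?_⟩, Wp, hp⟩
    obtain ⟨f, hfv⟩ : ∃ f : Lp ℝ 2 (measQ P.Ω P.T), f =ᵐ[measQ P.Ω P.T] v :=
      ⟨hv.toLp v, hv.coeFn_toLp⟩
    obtain ⟨Wv, hyv⟩ := (isState_iff hC hfv).1 hyv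
    rw [cost_eq hf, cost_eq hfv, costL2_eq hY hp rfl hyv]
    have := P.lam_pos
    have : 0 ≤ 1 / 2 * ‖y.toL2 - yv.toL2‖ ^ 2 +
      P.lam / 2 * ‖-P.lam⁻¹ • p.toL2 - f‖ ^ 2 := by positivity
    linarith

/-- An optimal control, its state and an adjoint state, in `L²(Q)`. -/
lemma IsOptimal.exists_isSol {C : ℝ} (hC : IsFriedrichsConstant P.Ω C) {u : Space d × ℝ → ℝ}
    {y : P.StateSpace} (h : P.IsOptimal u y) : ∃ (p : P.StateSpace)
      (W Wp : Lp ℝ 2 (measQ P.Ω P.T)), P.IsAdjoint y p ∧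
      P.IsSol 1 (-P.lam⁻¹ • p.toL2) y.toL2 W y.gradL2 ∧
      P.IsSol (-1) (y.toL2 - P.ydL2) p.toL2 Wp p.gradL2 ∧
      (-P.lam⁻¹ • p.toL2 : Lp ℝ 2 (measQ P.Ω P.T)) =ᵐ[measQ P.Ω P.T] u := by
  obtain ⟨p, hp⟩ := exists_adjoint hC y
  obtain ⟨hsys, hu⟩ := (isOptimal_isAdjoint_iff hC).1 ⟨h, hp⟩
  obtain ⟨⟨Wp, h1⟩, W, h2⟩ := (isOptimalitySystem_iff hC).1 hsys
  exact ⟨p, W, Wp, hp, h2, h1, (smul_toL2_ae p).trans hu.symm⟩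

lemma errorSq_eq {f g : Lp ℝ 2 (measQ P.Ω P.T)} {u v : Space d × ℝ → ℝ}
    (hu : f =ᵐ[measQ P.Ω P.T] u) (hv : g =ᵐ[measQ P.Ω P.T] v) (yu yv : P.StateSpace) :
    P.errorSq u yu.val v yv.val =
      1 / 2 * ‖yu.toL2 - yv.toL2‖ ^ 2 + P.lam / 2 * ‖f - g‖ ^ 2 := by
  rw [errorSq, μ, l2norm_eq_of_ae ((Lp.coeFn_sub _ _).trans (yu.toL2_ae.sub yv.toL2_ae)),
    l2norm_eq_of_ae ((Lp.coeFn_sub _ _).trans (hu.sub hv))]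

lemma optimal_unique {C : ℝ} (hC : IsFriedrichsConstant P.Ω C) {u u' : Space d × ℝ → ℝ}
    {y y' : P.StateSpace} (h : P.IsOptimal u y) (h' : P.IsOptimal u' y') : u' =ᵐ[P.μ] u := by
  obtain ⟨p, W, Wp, -, h1, h2, h3⟩ := h.exists_isSol hC
  obtain ⟨p', W', Wp', -, h1', h2', h3'⟩ := h'.exists_isSol hC
  have hle := h'.2.2 u y h.1 h.2.1
  rw [cost_eq h3, cost_eq h3', costL2_eq h1 h2 rfl h1'] at hle
  have hz : P.lam / 2 * ‖-P.lam⁻¹ • p.toL2 - -P.lam⁻¹ • p'.toL2‖ ^ 2 ≤ 0 := by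
    have := sq_nonneg ‖y.toL2 - y'.toL2‖
    linarith
  have h0 : ‖-P.lam⁻¹ • p.toL2 - -P.lam⁻¹ • p'.toL2‖ ^ 2 = 0 := by
    have := P.lam_pos
    have h4 := sq_nonneg ‖-P.lam⁻¹ • p.toL2 - -P.lam⁻¹ • p'.toL2‖
    nlinarith
  have h5 : -P.lam⁻¹ • p.toL2 = -P.lam⁻¹ • p'.toL2 := by
    rw [← sub_eq_zero]; simpa using h0
  rw [← h5] at h3'
  exact h3'.symm.trans h3

end Problem

end PeriodicControl

end

noncomputable section

namespace PeriodicControl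

variable {d : ℕ}

/-! ### The spaces of the approximations -/

namespace H11

variable {Ω : Set (Space d)} {T : ℝ} (η : H11 Ω T)

/-- The class in `L²(Q)`. -/
def toL2 : Lp ℝ 2 (measQ Ω T) := η.isH10Zero.1.toLp η.val

/-- The class of the gradient in `L²(Q)^d`. -/
def gradL2 : Lp (Space d) 2 (measQ Ω T) := η.isH10Zero.2.1.toLp η.grad

/-- The class of the time derivative in `L²(Q)`. -/
def dtL2 : Lp ℝ 2 (measQ Ω T) := η.isH01Per.2.1.toLp η.dt

lemma toL2_ae : η.toL2 =ᵐ[measQ Ω T] η.val := η.isH10Zero.1.coeFn_toLp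

lemma gradL2_ae : η.gradL2 =ᵐ[measQ Ω T] η.grad := η.isH10Zero.2.1.coeFn_toLp

lemma dtL2_ae : η.dtL2 =ᵐ[measQ Ω T] η.dt := η.isH01Per.2.1.coeFn_toLp

lemma mem_h10 [IsFiniteMeasure (volume.restrict Ω)] : (η.toL2, η.gradL2) ∈ h10 Ω T :=
  (toLp_mem_h10_iff _ _).2 η.isH10Zero

lemma isPerDeriv [IsFiniteMeasure (volume.restrict Ω)] (hΩ : IsOpen Ω) (hT : 0 < T) :
    IsPerDeriv hT η.toL2 η.dtL2 :=
  η.isH01Per.isPerDeriv hΩ hT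

end H11

namespace Hdiv

variable {Ω : Set (Space d)} {T : ℝ} (τ : Hdiv Ω T)

/-- The class in `L²(Q)^d`. -/
def valL2 : Lp (Space d) 2 (measQ Ω T) := τ.memLp_val.toLp τ.val

/-- The class of the divergence in `L²(Q)`. -/
def divL2 : Lp ℝ 2 (measQ Ω T) := τ.memLp_div.toLp τ.div

lemma valL2_ae : τ.valL2 =ᵐ[measQ Ω T] τ.val := τ.memLp_val.coeFn_toLp

lemma divL2_ae : τ.divL2 =ᵐ[measQ Ω T] τ.div := τ.memLp_div.coeFn_toLp

lemma inner_div [IsFiniteMeasure (volume.restrict Ω)]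
    {q : Lp ℝ 2 (measQ Ω T) × Lp (Space d) 2 (measQ Ω T)} (hq : q ∈ h10 Ω T) :
    inner ℝ τ.divL2 q.1 = -inner ℝ τ.valL2 q.2 := by
  have hcl : IsClosed {q : Lp ℝ 2 (measQ Ω T) × Lp (Space d) 2 (measQ Ω T) |
      inner ℝ τ.divL2 q.1 = -inner ℝ τ.valL2 q.2} := isClosed_eq (by fun_prop) (by fun_prop)
  refine closure_minimal ?_ hcl hq
  rintro q ⟨φ, hφ, rfl⟩
  change inner ℝ τ.divL2 (hφ.memLp.toLp φ) = -inner ℝ τ.valL2 (hφ.memLp_gradX.toLp (gradX φ))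
  rw [divL2, valL2, inner_toLp, inner_toLp, ← τ.integral_div φ hφ]
  refine integral_congr_ae (ae_of_all _ fun z => ?_)
  simp [mul_comm]

lemma exists_of_inner [IsFiniteMeasure (volume.restrict Ω)] {D : Lp ℝ 2 (measQ Ω T)}
    {V : Lp (Space d) 2 (measQ Ω T)} {v : Space d × ℝ → Space d} {w : Space d × ℝ → ℝ}
    (hV : V =ᵐ[measQ Ω T] v) (hD : D =ᵐ[measQ Ω T] w)
    (h : ∀ q ∈ h10 Ω T, inner ℝ D q.1 = -inner ℝ V q.2) :
    ∃ τ : Hdiv Ω T, τ.val = v ∧ τ.div = w := by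
  refine ⟨⟨v, w, (Lp.memLp V).ae_eq hV, (Lp.memLp D).ae_eq hD, fun φ hφ => ?_⟩, rfl, rfl⟩
  have h1 := h _ (lateral_mem_h10 hφ)
  simp only [L2.inner_def] at h1
  refine Eq.trans (integral_congr_ae ?_) (h1.trans (congrArg Neg.neg (integral_congr_ae ?_)))
  · filter_upwards [hD, hφ.memLp.coeFn_toLp (μ := measQ Ω T)] with z h2 h3
    rw [h2, h3]; simp [mul_comm]
  · filter_upwards [hV, hφ.memLp_gradX.coeFn_toLp (μ := measQ Ω T)] with z h2 h3
    rw [h2, h3]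

end Hdiv

/-! ### Residuals and estimates -/

lemma tendsto_half_mul_nhdsGT (c : ℝ) :
    Tendsto (fun α : ℝ => α / 2 * c) (𝓝[>] 0) (𝓝 0) := by
  have h : Continuous fun α : ℝ => α / 2 * c := by fun_prop
  simpa using (h.tendsto 0).mono_left nhdsWithin_le_nhds

namespace Problem

variable {P : Problem d}

lemma mulσ_ae {f : Lp ℝ 2 (measQ P.Ω P.T)} {g : Space d × ℝ → ℝ} (h : f =ᵐ[measQ P.Ω P.T] g) :
    P.mulσ f =ᵐ[measQ P.Ω P.T] fun z => P.σ z.1 * g z := by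
  filter_upwards [mulL_ae (memLp_comp_fst P.memLp_σ P.T) f, h] with z h1 h2
  rw [h1, h2, smul_eq_mul]

lemma mulν_ae {f : Lp (Space d) 2 (measQ P.Ω P.T)} {g : Space d × ℝ → Space d}
    (h : f =ᵐ[measQ P.Ω P.T] g) :
    P.mulν f =ᵐ[measQ P.Ω P.T] fun z => P.ν z.1 • g z := by
  filter_upwards [mulL_ae (memLp_comp_fst P.memLp_ν P.T) f, h] with z h1 h2
  rw [h1, h2]

lemma l2norm_R1 (η : H11 P.Ω P.T) (τ : Hdiv P.Ω P.T) {f : Lp ℝ 2 (measQ P.Ω P.T)}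
    {v : Space d × ℝ → ℝ} (hv : f =ᵐ[measQ P.Ω P.T] v) :
    l2norm P.μ (P.R1 η τ v) = ‖P.mulσ η.dtL2 - τ.divL2 - f‖ :=
  l2norm_eq_of_ae ((Lp.coeFn_sub _ _).trans
    (((Lp.coeFn_sub _ _).trans ((mulσ_ae η.dtL2_ae).sub τ.divL2_ae)).sub hv))

lemma l2norm_R2 (η : H11 P.Ω P.T) (τ : Hdiv P.Ω P.T) :
    l2norm P.μ (P.R2 η τ) = ‖τ.valL2 - P.mulν η.gradL2‖ :=
  l2norm_eq_of_ae ((Lp.coeFn_sub _ _).trans (τ.valL2_ae.sub (mulν_ae η.gradL2_ae)))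

lemma l2norm_R3 (ζ : H11 P.Ω P.T) (ρ : Hdiv P.Ω P.T) (η : H11 P.Ω P.T) :
    l2norm P.μ (P.R3 ζ ρ η) = ‖η.toL2 - P.ydL2 + ρ.divL2 + P.mulσ ζ.dtL2‖ :=
  l2norm_eq_of_ae ((Lp.coeFn_add _ _).trans (((Lp.coeFn_add _ _).trans
    (((Lp.coeFn_sub _ _).trans (η.toL2_ae.sub P.ydL2_ae)).add ρ.divL2_ae)).add
      (mulσ_ae ζ.dtL2_ae)))

lemma l2norm_R4 (ζ : H11 P.Ω P.T) (ρ : Hdiv P.Ω P.T) :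
    l2norm P.μ (P.R4 ζ ρ) = ‖ρ.valL2 - P.mulν ζ.gradL2‖ :=
  l2norm_R2 ζ ρ

lemma l2norm_sub_yd (η : H11 P.Ω P.T) :
    l2norm P.μ (η.val - P.yd) = ‖η.toL2 - P.ydL2‖ :=
  l2norm_eq_of_ae ((Lp.coeFn_sub _ _).trans (η.toL2_ae.sub P.ydL2_ae))

lemma integral_bilinear (η ζ : H11 P.Ω P.T) :
    ∫ z, (P.ν z.1 * inner ℝ (η.grad z) (ζ.grad z) + P.σ z.1 * η.dt z * ζ.val z
        + P.lam⁻¹ * ζ.val z ^ 2) ∂P.μ =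
      inner ℝ (P.mulν η.gradL2) ζ.gradL2 + inner ℝ (P.mulσ η.dtL2) ζ.toL2 +
        P.lam⁻¹ * ‖ζ.toL2‖ ^ 2 := by
  rw [← real_inner_self_eq_norm_sq, L2.inner_def, L2.inner_def, L2.inner_def,
    ← integral_const_mul, ← integral_add (L2.integrable_inner _ _) (L2.integrable_inner _ _),
    ← integral_add ((L2.integrable_inner _ _).add (L2.integrable_inner _ _))
      ((L2.integrable_inner _ _).const_mul _)]
  refine integral_congr_ae ?_
  filter_upwards [mulν_ae η.gradL2_ae, ζ.gradL2_ae, mulσ_ae η.dtL2_ae, ζ.toL2_ae] with z h1 h2 h3 h4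
  rw [h1, h2, h3, h4, real_inner_smul_left, real_inner_self_eq_norm_sq, Real.norm_eq_abs, sq_abs]
  simp [mul_comm]

/-- The energy estimate for the deviation of an approximation `η` from a state. -/
lemma norm_grad_sub_le {C : ℝ} (hC : IsFriedrichsConstant P.Ω C)
    {f Y W : Lp ℝ 2 (measQ P.Ω P.T)} {G : Lp (Space d) 2 (measQ P.Ω P.T)} (h : P.IsSol 1 f Y W G)
    (η : H11 P.Ω P.T) (τ : Hdiv P.Ω P.T) :
    P.νlo * ‖G - η.gradL2‖ ≤
      C * ‖P.mulσ η.dtL2 - τ.divL2 - f‖ + ‖τ.valL2 - P.mulν η.gradL2‖ := by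
  have hm : (Y - η.toL2, G - η.gradL2) ∈ h10 P.Ω P.T := (h10 P.Ω P.T).sub_mem h.mem η.mem_h10
  have hd : IsPerDeriv P.T_pos (Y - η.toL2) (W - η.dtL2) := by
    have := h.deriv.add ((η.isPerDeriv P.isOpen_Ω P.T_pos).smul (-1))
    simpa only [neg_one_smul, ← sub_eq_add_neg] using this
  have h1 := h.eq _ hm
  have h2 := inner_mulL_perDeriv_self P.memLp_σ hd
  have h3 := le_inner_mulL (memLp_comp_fst P.memLp_ν P.T) ((quasi_fst P.Ω P.T).ae P.ae_νlo_le)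
    (G - η.gradL2)
  have h4 := τ.inner_div hm
  have h5 := friedrichs_h10 hC hm
  have h6 := abs_real_inner_le_norm (P.mulσ η.dtL2 - τ.divL2 - f) (Y - η.toL2)
  have h7 := real_inner_le_norm (τ.valL2 - P.mulν η.gradL2) (G - η.gradL2)
  simp only at h1 h4 h5
  have h8 := neg_abs_le (inner ℝ (P.mulσ η.dtL2 - τ.divL2 - f) (Y - η.toL2))
  have h9 : inner ℝ (P.mulν (G - η.gradL2)) (G - η.gradL2) =
      -inner ℝ (P.mulσ η.dtL2 - τ.divL2 - f) (Y - η.toL2) +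
        inner ℝ (τ.valL2 - P.mulν η.gradL2) (G - η.gradL2) := by
    rw [map_sub, inner_sub_left] at h2
    rw [map_sub, inner_sub_left, inner_sub_left, inner_sub_left, inner_sub_left]
    linarith
  have h10 : ‖P.mulσ η.dtL2 - τ.divL2 - f‖ * ‖Y - η.toL2‖ ≤
      ‖P.mulσ η.dtL2 - τ.divL2 - f‖ * (C * ‖G - η.gradL2‖) :=
    mul_le_mul_of_nonneg_left h5 (norm_nonneg _)
  rcases (norm_nonneg (G - η.gradL2)).eq_or_lt with h0 | h0
  · rw [← h0, mul_zero]
    exact add_nonneg (mul_nonneg hC.1.le (norm_nonneg _)) (norm_nonneg _)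
  · refine le_of_mul_le_mul_right ?_ h0
    have h11 : P.νlo * ‖G - η.gradL2‖ * ‖G - η.gradL2‖ = P.νlo * ‖G - η.gradL2‖ ^ 2 := by ring
    rw [h11, add_mul]
    linarith

lemma mu1_pos : 0 < P.mu1 :=
  mul_pos (by positivity) (lt_min P.νlo_pos P.σlo_pos)

lemma two_mul_mu1_sq_le : 2 * P.mu1 ^ 2 ≤ P.νlo ^ 2 := by
  have h0 : 0 < min P.νlo P.σlo := lt_min P.νlo_pos P.σlo_pos
  have h : (min P.νlo P.σlo) ^ 2 ≤ P.νlo ^ 2 := pow_le_pow_left₀ h0.le (min_le_left _ _) 2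
  rw [mu1, mul_pow, div_pow, Real.sq_sqrt zero_le_two]
  linarith

lemma half_sq_le_majorant {α β C r₁ r₂ m n x ν μ : ℝ} (hα : 0 < α) (hβ : 0 < β)
    (hn : 0 ≤ n) (hx : 0 ≤ x)
    (hμ : 0 < μ) (hμν : 2 * μ ^ 2 ≤ ν ^ 2) (hν : 0 < ν) (hxb : ν * x ≤ C * (C * r₁ + r₂))
    (hnm : n ≤ m + x) :
    1 / 2 * n ^ 2 ≤ (1 + α) / 2 * m ^ 2 + (1 + α) * (1 + β) * C ^ 2 / (2 * α * μ ^ 2) *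
      (r₂ ^ 2 + C ^ 2 / β * r₁ ^ 2) := by
  have h1 : n ^ 2 ≤ (m + x) ^ 2 := pow_le_pow_left₀ hn hnm 2
  have h2 : (m + x) ^ 2 ≤ (1 + α) * m ^ 2 + (1 + α) / α * x ^ 2 := by
    have : (1 + α) * m ^ 2 + (1 + α) / α * x ^ 2 - (m + x) ^ 2 = (α * m - x) ^ 2 / α := by
      field_simp
      ring
    have h0 : 0 ≤ (α * m - x) ^ 2 / α := by positivity
    linarith
  have h3 : μ ^ 2 * x ^ 2 ≤ C ^ 2 * (C * r₁ + r₂) ^ 2 := by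
    have h4 := pow_le_pow_left₀ (by positivity) hxb 2
    rw [mul_pow, mul_pow] at h4
    refine le_trans (mul_le_mul_of_nonneg_right ?_ (sq_nonneg x)) h4
    linarith [sq_nonneg μ]
  have h5 : (C * r₁ + r₂) ^ 2 ≤ (1 + β) * (r₂ ^ 2 + C ^ 2 / β * r₁ ^ 2) := by
    have : (1 + β) * (r₂ ^ 2 + C ^ 2 / β * r₁ ^ 2) - (C * r₁ + r₂) ^ 2 =
        (β * r₂ - C * r₁) ^ 2 / β := by
      field_simp
      ring
    have h0 : 0 ≤ (β * r₂ - C * r₁) ^ 2 / β := by positivity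
    linarith
  have h6 : x ^ 2 ≤ C ^ 2 * ((1 + β) * (r₂ ^ 2 + C ^ 2 / β * r₁ ^ 2)) / μ ^ 2 := by
    rw [le_div_iff₀ (by positivity), mul_comm]
    exact h3.trans (mul_le_mul_of_nonneg_left h5 (sq_nonneg C))
  have h7 := mul_le_mul_of_nonneg_left h6 (by positivity : 0 ≤ (1 + α) / α)
  have h8 : (1 + α) / α * (C ^ 2 * ((1 + β) * (r₂ ^ 2 + C ^ 2 / β * r₁ ^ 2)) / μ ^ 2) =
      2 * ((1 + α) * (1 + β) * C ^ 2 / (2 * α * μ ^ 2) * (r₂ ^ 2 + C ^ 2 / β * r₁ ^ 2)) := by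
    field_simp
  rw [h8] at h7
  linarith

lemma mul_le_minorant {A B C b g lam ν μ : ℝ} (hA : 0 ≤ A) (hB : 0 ≤ B)
    (hlam : 0 < lam) (hμ : 0 < μ) (hμν : 2 * μ ^ 2 ≤ ν ^ 2) (hν : 0 < ν)
    (hg : ν * g ≤ B + C * (lam⁻¹ * b)) :
    A * g ≤ C ^ 2 / (μ ^ 2 * lam) * A ^ 2 + 1 / μ * B * A + 1 / (2 * lam) * b ^ 2 := by
  have hμν' : μ ≤ ν := by
    refine le_of_sq_le_sq ?_ hν.le
    linarith [sq_nonneg μ]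
  have h1 : A * g ≤ A * B / ν + A * (C * (lam⁻¹ * b)) / ν := by
    rw [← add_div, le_div_iff₀ hν]
    have := mul_le_mul_of_nonneg_left hg hA
    linarith
  have h2 : A * B / ν ≤ 1 / μ * B * A := by
    rw [one_div_mul_eq_div, div_mul_eq_mul_div, mul_comm B A]
    exact div_le_div_of_nonneg_left (by positivity) hμ hμν'
  have h3 : A * (C * (lam⁻¹ * b)) / ν ≤
      1 / (2 * lam) * b ^ 2 + C ^ 2 * A ^ 2 / (2 * lam * ν ^ 2) := by
    have : 1 / (2 * lam) * b ^ 2 + C ^ 2 * A ^ 2 / (2 * lam * ν ^ 2) - A * (C * (lam⁻¹ * b)) / ν =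
        (b - C * A / ν) ^ 2 / (2 * lam) := by
      field_simp
      ring
    have h0 : 0 ≤ (b - C * A / ν) ^ 2 / (2 * lam) := by positivity
    linarith
  have h4 : C ^ 2 * A ^ 2 / (2 * lam * ν ^ 2) ≤ C ^ 2 / (μ ^ 2 * lam) * A ^ 2 := by
    rw [div_mul_eq_mul_div]
    refine div_le_div_of_nonneg_left (by positivity) (by positivity) ?_
    have : μ ^ 2 ≤ 2 * ν ^ 2 := by linarith [sq_nonneg μ, sq_nonneg ν]
    have := mul_le_mul_of_nonneg_left this hlam.le
    linarith
  linarith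

/-- The cost majorant is an upper bound of the cost. -/
lemma costL2_le_costMajorant {C : ℝ} (hC : IsFriedrichsConstant P.Ω C)
    {f Y W : Lp ℝ 2 (measQ P.Ω P.T)} {G : Lp (Space d) 2 (measQ P.Ω P.T)} (h : P.IsSol 1 f Y W G)
    {v : Space d × ℝ → ℝ} (hv : f =ᵐ[measQ P.Ω P.T] v) (η : H11 P.Ω P.T) (τ : Hdiv P.Ω P.T)
    {α β : ℝ} (hα : 0 < α) (hβ : 0 < β) : P.costL2 Y f ≤ P.costMajorant C α β η τ v := by
  have h1 := norm_grad_sub_le hC h η τ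
  have hm : (Y - η.toL2, G - η.gradL2) ∈ h10 P.Ω P.T := (h10 P.Ω P.T).sub_mem h.mem η.mem_h10
  have h2 := friedrichs_h10 hC hm
  simp only at h2
  have h3 : P.νlo * ‖Y - η.toL2‖ ≤
      C * (C * ‖P.mulσ η.dtL2 - τ.divL2 - f‖ + ‖τ.valL2 - P.mulν η.gradL2‖) := by
    have h4 := mul_le_mul_of_nonneg_left h2 P.νlo_pos.le
    have h5 := mul_le_mul_of_nonneg_left h1 hC.1.le
    linarith
  have h4 : ‖Y - P.ydL2‖ ≤ ‖η.toL2 - P.ydL2‖ + ‖Y - η.toL2‖ := by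
    have := norm_add_le (η.toL2 - P.ydL2) (Y - η.toL2)
    rwa [show η.toL2 - P.ydL2 + (Y - η.toL2) = Y - P.ydL2 by abel] at this
  have h5 := half_sq_le_majorant hα hβ (norm_nonneg _) (norm_nonneg _) P.mu1_pos
    P.two_mul_mu1_sq_le P.νlo_pos h3 h4
  rw [costMajorant, gam, l2norm_sub_yd, l2norm_R1 η τ hv, l2norm_R2, μ, l2norm_eq_of_ae hv, costL2]
  linarith

/-- The cost minorant is a lower bound of the optimal cost. -/
lemma costMinorant_le_costL2 {C : ℝ} (hC : IsFriedrichsConstant P.Ω C)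
    {Y W p : Lp ℝ 2 (measQ P.Ω P.T)} {G : Lp (Space d) 2 (measQ P.Ω P.T)}
    (h : P.IsSol 1 (-P.lam⁻¹ • p) Y W G) (η ζ : H11 P.Ω P.T) (τ ρ : Hdiv P.Ω P.T) :
    P.costMinorant C η ζ τ ρ ≤ P.costL2 Y (-P.lam⁻¹ • p) := by
  have hlam := P.lam_pos
  have hm : (Y - η.toL2, G - η.gradL2) ∈ h10 P.Ω P.T := (h10 P.Ω P.T).sub_mem h.mem η.mem_h10
  have hd : IsPerDeriv P.T_pos (Y - η.toL2) (W - η.dtL2) := by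
    have := h.deriv.add ((η.isPerDeriv P.isOpen_Ω P.T_pos).smul (-1))
    simpa only [neg_one_smul, ← sub_eq_add_neg] using this
  have hζ : (-P.lam⁻¹ • ζ.toL2 : Lp ℝ 2 (measQ P.Ω P.T)) =ᵐ[measQ P.Ω P.T]
      fun z => -P.lam⁻¹ * ζ.val z := by
    filter_upwards [Lp.coeFn_smul (-P.lam⁻¹) ζ.toL2, ζ.toL2_ae] with z h1 h2
    rw [h1, Pi.smul_apply, h2, smul_eq_mul]
  rw [costMinorant, integral_bilinear, l2norm_sub_yd, l2norm_R1 η τ hζ, l2norm_R2, l2norm_R3,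
    l2norm_R4, μ, l2norm_eq_of_ae ζ.toL2_ae]
  set R₁ := P.mulσ η.dtL2 - τ.divL2 - -P.lam⁻¹ • ζ.toL2 with hR₁
  set R₂ := τ.valL2 - P.mulν η.gradL2 with hR₂
  set R₃ := η.toL2 - P.ydL2 + ρ.divL2 + P.mulσ ζ.dtL2 with hR₃
  set R₄ := ρ.valL2 - P.mulν ζ.gradL2 with hR₄
  have hgrad : P.νlo * ‖G - η.gradL2‖ ≤ (C * ‖R₁‖ + ‖R₂‖) + C * (P.lam⁻¹ * ‖p - ζ.toL2‖) := by
    have h1 := norm_grad_sub_le hC h η τ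
    have h2 : P.mulσ η.dtL2 - τ.divL2 - -P.lam⁻¹ • p = R₁ + P.lam⁻¹ • (p - ζ.toL2) := by
      rw [hR₁, smul_sub, neg_smul, neg_smul]; abel
    rw [h2] at h1
    have h3 := mul_le_mul_of_nonneg_left (norm_add_le R₁ (P.lam⁻¹ • (p - ζ.toL2))) hC.1.le
    rw [norm_smul, Real.norm_of_nonneg (inv_nonneg.2 hlam.le)] at h3
    linarith
  have hmain := mul_le_minorant (A := C * ‖R₃‖ + ‖R₄‖)
    (add_nonneg (mul_nonneg hC.1.le (norm_nonneg _)) (norm_nonneg _))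
    (add_nonneg (mul_nonneg hC.1.le (norm_nonneg _)) (norm_nonneg _))
    hlam P.mu1_pos P.two_mul_mu1_sq_le P.νlo_pos hgrad
  have hlow : -((C * ‖R₃‖ + ‖R₄‖) * ‖G - η.gradL2‖) ≤
      inner ℝ R₃ (Y - η.toL2) + inner ℝ R₄ (G - η.gradL2) := by
    have h1 := neg_le_of_abs_le (abs_real_inner_le_norm R₃ (Y - η.toL2))
    have h2 := neg_le_of_abs_le (abs_real_inner_le_norm R₄ (G - η.gradL2))
    have h3 := friedrichs_h10 hC hm
    simp only at h3
    have h4 := mul_le_mul_of_nonneg_left h3 (norm_nonneg R₃)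
    linarith
  have hid : inner ℝ R₃ (Y - η.toL2) + inner ℝ R₄ (G - η.gradL2) =
      inner ℝ (η.toL2 - P.ydL2) (Y - η.toL2) + P.lam⁻¹ * inner ℝ ζ.toL2 (p - ζ.toL2) +
      (inner ℝ (P.mulν η.gradL2) ζ.gradL2 + inner ℝ (P.mulσ η.dtL2) ζ.toL2 +
        P.lam⁻¹ * ‖ζ.toL2‖ ^ 2) := by
    have h1 := h.eq _ ζ.mem_h10
    have h2 := inner_mulL_perDeriv_antisymm P.memLp_σ hd (ζ.isPerDeriv P.isOpen_Ω P.T_pos)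
    have h3 := ρ.inner_div hm
    have h4 : inner ℝ (P.mulν ζ.gradL2) (G - η.gradL2) =
        inner ℝ (P.mulν G) ζ.gradL2 - inner ℝ (P.mulν η.gradL2) ζ.gradL2 := by
      rw [inner_mulL_symm, real_inner_comm, map_sub, inner_sub_left]
    rw [map_sub, inner_sub_left] at h2
    simp only [real_inner_smul_left] at h1 h3
    rw [hR₃, hR₄, inner_add_left, inner_add_left, inner_sub_left _ _ (G - η.gradL2), h4,
      inner_sub_right ζ.toL2, real_inner_self_eq_norm_sq, real_inner_comm p ζ.toL2]
    linarith
  have hcost : P.costL2 Y (-P.lam⁻¹ • p) = 1 / 2 * ‖η.toL2 - P.ydL2‖ ^ 2 +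
      1 / (2 * P.lam) * ‖ζ.toL2‖ ^ 2 + inner ℝ (η.toL2 - P.ydL2) (Y - η.toL2) +
      P.lam⁻¹ * inner ℝ ζ.toL2 (p - ζ.toL2) + 1 / 2 * ‖Y - η.toL2‖ ^ 2 +
      1 / (2 * P.lam) * ‖p - ζ.toL2‖ ^ 2 := by
    have h1 := norm_add_sq_real (η.toL2 - P.ydL2) (Y - η.toL2)
    rw [show η.toL2 - P.ydL2 + (Y - η.toL2) = Y - P.ydL2 by abel] at h1
    have h2 := norm_add_sq_real ζ.toL2 (p - ζ.toL2)
    rw [add_sub_cancel] at h2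
    rw [costL2, norm_smul, mul_pow, Real.norm_eq_abs, sq_abs, h1, h2]
    field_simp
    ring
  rw [hcost]
  have h0 := sq_nonneg ‖Y - η.toL2‖
  linarith

lemma errorMajorant_eq (C α β : ℝ) (η ζ : H11 P.Ω P.T) (τ ρ : Hdiv P.Ω P.T)
    (v : Space d × ℝ → ℝ) : P.errorMajorant C α β η ζ τ ρ v =
      P.costMajorant C α β η τ v - P.costMinorant C η ζ τ ρ := by
  rw [errorMajorant, costMajorant, costMinorant]
  ring

/-- The guaranteed error bound. -/
lemma errorSq_le_errorMajorant {C : ℝ} (hC : IsFriedrichsConstant P.Ω C) {u v : Space d × ℝ → ℝ}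
    {yu yv : P.StateSpace} (hu : P.IsOptimal u yu) (hv : MemLp v 2 P.μ) (hyv : P.IsState v yv)
    (η ζ : H11 P.Ω P.T) (τ ρ : Hdiv P.Ω P.T) {α β : ℝ} (hα : 0 < α) (hβ : 0 < β) :
    P.errorSq u yu.val v yv.val ≤ P.errorMajorant C α β η ζ τ ρ v := by
  obtain ⟨p, W, Wp, -, h1, h2, h3⟩ := hu.exists_isSol hC
  obtain ⟨f, hf⟩ : ∃ f : Lp ℝ 2 (measQ P.Ω P.T), f =ᵐ[measQ P.Ω P.T] v :=
    ⟨hv.toLp v, hv.coeFn_toLp⟩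
  obtain ⟨Wv, h4⟩ := (isState_iff hC hf).1 hyv
  have h5 := costL2_eq h1 h2 rfl h4
  have h6 := costL2_le_costMajorant hC h4 hf η τ hα hβ
  have h7 := costMinorant_le_costL2 hC h1 η ζ τ ρ
  rw [errorSq_eq h3 hf, errorMajorant_eq]
  linarith

lemma l2norm_zero' {X E : Type*} [MeasurableSpace X] [NormedAddCommGroup E] {μ : Measure X}
    {f : X → E} (h : ∀ᵐ x ∂μ, f x = 0) : l2norm μ f = 0 := by
  rw [l2norm, eLpNorm_congr_ae (g := 0) h]
  simp

/-- The majorant at the exact solution. -/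
lemma exists_exact {C : ℝ} (hC : IsFriedrichsConstant P.Ω C) {u : Space d × ℝ → ℝ}
    {y p : P.StateSpace} (hu : P.IsOptimal u y) (hp : P.IsAdjoint y p) :
    ∃ (η ζ : H11 P.Ω P.T) (τ ρ : Hdiv P.Ω P.T),
      (η.val = y.val ∧ η.grad = y.grad) ∧ (ζ.val = p.val ∧ ζ.grad = p.grad) ∧
      τ.val = (fun z => P.ν z.1 • y.grad z) ∧ ρ.val = (fun z => P.ν z.1 • p.grad z) ∧
      ∀ α β : ℝ, P.errorMajorant C α β η ζ τ ρ u = α / 2 * l2norm P.μ (y.val - P.yd) ^ 2 := by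
  obtain ⟨hsys, hup⟩ := (isOptimal_isAdjoint_iff hC).1 ⟨hu, hp⟩
  obtain ⟨⟨Wp, h2⟩, W, h1⟩ := (isOptimalitySystem_iff hC).1 hsys
  have hf : (-P.lam⁻¹ • p.toL2 : Lp ℝ 2 (measQ P.Ω P.T)) =ᵐ[measQ P.Ω P.T] u :=
    (smul_toL2_ae p).trans hup.symm
  let η : H11 P.Ω P.T := ⟨y.val, y.grad, W, y.isH10Zero,
    h1.deriv.isH01Per y.toL2_ae EventuallyEq.rfl⟩
  let ζ : H11 P.Ω P.T := ⟨p.val, p.grad, Wp, p.isH10Zero,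
    h2.deriv.isH01Per p.toL2_ae EventuallyEq.rfl⟩
  obtain ⟨τ, hτ, hτd⟩ := Hdiv.exists_of_inner (D := P.mulσ W - -P.lam⁻¹ • p.toL2)
    (mulν_ae y.gradL2_ae)
    ((Lp.coeFn_sub _ _).trans ((mulσ_ae EventuallyEq.rfl).sub hf)) fun q hq => by
      have := h1.eq q hq
      rw [inner_sub_left]
      linarith
  obtain ⟨ρ, hρ, hρd⟩ := Hdiv.exists_of_inner (D := -(y.toL2 - P.ydL2) - P.mulσ Wp)
    (mulν_ae p.gradL2_ae)
    ((Lp.coeFn_sub _ _).trans (((Lp.coeFn_neg _).trans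
      ((Lp.coeFn_sub _ _).trans (y.toL2_ae.sub P.ydL2_ae)).neg).sub
        (mulσ_ae EventuallyEq.rfl))) fun q hq => by
      have := h2.eq q hq
      rw [inner_sub_left, inner_neg_left]
      linarith
  refine ⟨η, ζ, τ, ρ, ⟨rfl, rfl⟩, ⟨rfl, rfl⟩, hτ, hρ, fun α β => ?_⟩
  have e1 : l2norm P.μ (P.R1 η τ u) = 0 := l2norm_zero' (ae_of_all _ fun z => by
    simp [R1, hτd, η])
  have e2 : l2norm P.μ (P.R2 η τ) = 0 := l2norm_zero' (ae_of_all _ fun z => by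
    simp [R2, hτ, η])
  have e3 : l2norm P.μ (P.R3 ζ ρ η) = 0 := l2norm_zero' (ae_of_all _ fun z => by
    simp [R3, hρd, η, ζ]
    ring)
  have e4 : l2norm P.μ (P.R4 ζ ρ) = 0 := l2norm_zero' (ae_of_all _ fun z => by
    simp [R4, hρ, ζ])
  have e5 : l2norm P.μ u ^ 2 = P.lam⁻¹ ^ 2 * ‖p.toL2‖ ^ 2 := by
    rw [μ, l2norm_eq_of_ae hf, norm_smul, mul_pow, Real.norm_eq_abs, sq_abs, neg_sq]
  have e6 : l2norm P.μ ζ.val = ‖p.toL2‖ := l2norm_eq_of_ae p.toL2_ae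
  have hW : η.dtL2 = W := Lp.toLp_coeFn _ _
  have e7 := h1.eq _ p.mem_h10
  simp only [one_mul, real_inner_smul_left, real_inner_self_eq_norm_sq] at e7
  rw [errorMajorant, integral_bilinear, e1, e2, e3, e4, e5, e6, hW]
  change _ + (inner ℝ (P.mulν y.gradL2) p.gradL2 + inner ℝ (P.mulσ W) p.toL2 +
    P.lam⁻¹ * ‖p.toL2‖ ^ 2) + _ + _ = _
  rw [e7]
  have := P.lam_pos
  simp only [η]
  field_simp
  ring

end Problem

end PeriodicControl

end

open PeriodicControl in
theorem mainTheorem5 {d : ℕ} (hd : 1 ≤ d ∧ d ≤ 3) (P : Problem d) :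
    -- states, the optimal control with its state, and its adjoint state exist and are unique
    (∀ v : Space d × ℝ → ℝ, MemLp v 2 P.μ →
      ∃ y : P.StateSpace, P.IsState v y ∧
        ∀ y' : P.StateSpace, P.IsState v y' → y'.val =ᵐ[P.μ] y.val) ∧
    (∃ (u : Space d × ℝ → ℝ) (y p : P.StateSpace), P.IsOptimal u y ∧ P.IsAdjoint y p ∧
      (∀ (u' : Space d × ℝ → ℝ) (y' : P.StateSpace), P.IsOptimal u' y' → u' =ᵐ[P.μ] u) ∧
      (∀ p' : P.StateSpace, P.IsAdjoint y p' → p'.val =ᵐ[P.μ] p.val)) ∧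
    -- minimizing the cost is equivalent to the optimality system, with `p(u) = -λu`
    (∀ (u : Space d × ℝ → ℝ) (y p : P.StateSpace),
      (P.IsOptimal u y ∧ P.IsAdjoint y p) ↔
        (P.IsOptimalitySystem y p ∧ u =ᵐ[P.μ] fun z => -P.lam⁻¹ * p.val z)) ∧
    -- a Friedrichs constant exists, and the results hold with every such constant
    (∃ CF : ℝ, IsFriedrichsConstant P.Ω CF) ∧
    ∀ CF : ℝ, IsFriedrichsConstant P.Ω CF →
      -- the guaranteed error majorant
      (∀ (u : Space d × ℝ → ℝ) (yu : P.StateSpace), P.IsOptimal u yu →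
        ∀ (v : Space d × ℝ → ℝ) (yv : P.StateSpace), MemLp v 2 P.μ → P.IsState v yv →
        ∀ (η ζ : H11 P.Ω P.T) (τ ρ : Hdiv P.Ω P.T) (α β : ℝ), 0 < α → 0 < β →
          P.errorSq u yu.val v yv.val ≤ P.errorMajorant CF α β η ζ τ ρ v ∧
          P.errorMajorant CF α β η ζ τ ρ v =
            P.costMajorant CF α β η τ v - P.costMinorant CF η ζ τ ρ) ∧
      -- the infimum of the majorant over all its arguments is zero
      IsGLB {m : ℝ | ∃ (η ζ : H11 P.Ω P.T) (τ ρ : Hdiv P.Ω P.T) (v : Space d × ℝ → ℝ) (α β : ℝ),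
        MemLp v 2 P.μ ∧ 0 < α ∧ 0 < β ∧ m = P.errorMajorant CF α β η ζ τ ρ v} 0 ∧
      -- it is approached at the exact solution as `α → 0`
      (∀ (u : Space d × ℝ → ℝ) (y p : P.StateSpace), P.IsOptimal u y → P.IsAdjoint y p →
        ∃ (η ζ : H11 P.Ω P.T) (τ ρ : Hdiv P.Ω P.T),
          (η.val = y.val ∧ η.grad = y.grad) ∧ (ζ.val = p.val ∧ ζ.grad = p.grad) ∧
          τ.val = (fun z => P.ν z.1 • y.grad z) ∧ ρ.val = (fun z => P.ν z.1 • p.grad z) ∧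
          (∀ α β : ℝ, 0 < α → 0 < β →
            P.errorMajorant CF α β η ζ τ ρ u = α / 2 * l2norm P.μ (y.val - P.yd) ^ 2) ∧
          (∀ β : ℝ, 0 < β →
            Tendsto (fun α : ℝ => P.errorMajorant CF α β η ζ τ ρ u) (𝓝[>] 0) (𝓝 0))) := by
  have hex := exists_friedrichs hd.1 P.isOpen_Ω P.isBounded_Ω
  obtain ⟨C, hC⟩ := hex
  obtain ⟨u, y, p, hu, hp⟩ : ∃ (u : Space d × ℝ → ℝ) (y p : P.StateSpace),
      P.IsOptimal u y ∧ P.IsAdjoint y p := by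
    obtain ⟨Y, W, p, Wp, G, Gp, h1, h2⟩ := Problem.exists_optimal (P := P) hC
    obtain ⟨y, rfl, rfl⟩ := H1half.exists_of_isPerDeriv h1.mem h1.deriv
    obtain ⟨p, rfl, rfl⟩ := H1half.exists_of_isPerDeriv h2.mem h2.deriv
    exact ⟨_, y, p, (Problem.isOptimal_isAdjoint_iff hC).2
      ⟨(Problem.isOptimalitySystem_iff hC).2 ⟨⟨Wp, h2⟩, W, h1⟩, EventuallyEq.rfl⟩⟩
  refine ⟨fun v hv => Problem.exists_state hC hv,
    ⟨u, y, p, hu, hp, fun u' y' h' => Problem.optimal_unique hC hu h',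
      fun p' h' => Problem.adjoint_unique hC hp h'⟩,
    fun u y p => Problem.isOptimal_isAdjoint_iff hC, ⟨C, hC⟩, fun CF hCF => ⟨?_, ⟨?_, ?_⟩, ?_⟩⟩
  · exact fun u yu hu v yv hv hyv η ζ τ ρ α β hα hβ =>
      ⟨Problem.errorSq_le_errorMajorant hCF hu hv hyv η ζ τ ρ hα hβ,
        Problem.errorMajorant_eq CF α β η ζ τ ρ v⟩
  · rintro m ⟨η, ζ, τ, ρ, v, α, β, hv, hα, hβ, rfl⟩
    obtain ⟨yv, hyv, -⟩ := Problem.exists_state hCF hv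
    refine le_trans ?_ (Problem.errorSq_le_errorMajorant hCF hu hv hyv η ζ τ ρ hα hβ)
    have := P.lam_pos
    unfold Problem.errorSq
    positivity
  · intro b hb
    obtain ⟨η, ζ, τ, ρ, -, -, -, -, h⟩ := Problem.exists_exact hCF hu hp
    refine ge_of_tendsto (tendsto_half_mul_nhdsGT (l2norm P.μ (y.val - P.yd) ^ 2)) ?_
    filter_upwards [self_mem_nhdsWithin] with α hα
    exact hb ⟨η, ζ, τ, ρ, u, α, 1, hu.1, hα, one_pos, (h α 1).symm⟩
  · intro u y p hu hp
    obtain ⟨η, ζ, τ, ρ, h1, h2, h3, h4, h⟩ := Problem.exists_exact hCF hu hp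
    refine ⟨η, ζ, τ, ρ, h1, h2, h3, h4, fun α β _ _ => h α β, fun β _ => ?_⟩
    simp only [h]
    exact tendsto_half_mul_nhdsGT _
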